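/- **Conventions.** A promise problem is a pair $A=(A_{\rm yes},A_{\rm no})$ of disjoint subsets of $\{0,1\}^*$; $B$ is a subproblem of $A$ if $B_{\rm yes}\subseteq A_{\rm yes}$ and $B_{\rm no}\subseteq A_{\rm no}$. A program *totally decides* $A$ if it halts on every input $x\in\{0,1\}^*$, with output $1$ if $x\in A_{\rm yes}$, output $0$ if $x\in A_{\rm no}$, and output $10$ otherwise; $A$ is *totally decidable* if some program totally decides it. A set $C$ of promise problems is *recursively presentable* if there is a computable sequence $M_0,M_1,\dots$ of (Gödel numbers of) programs that halt on all inputs such that $C$ consists of exactly those promise problems that are totally decided by some $M_i$. It is *recursively representable* if it is the set of all subproblems of the members of a recursively presentable class. (Programs may be those of any universal model of computation, e.g. deterministic Turing machines.) A function $f:\mathbb N_0\to\mathbb N_0$ is in $\mathrm{poly}$ if it is polynomially bounded and some polynomial-time deterministic Turing machine outputs the binary representation of $f(n)$ on every input of length $n$. Let $\mathcal E=(\mathcal E_m)_{m\in\mathbb N_0}$ be a family of quantum channels, $\mathcal E_m$ being a completely positive trace-preserving map on the operators on $m$ qubits. A *$\mathrm{QMA}_{\mathcal E}$-machine* $M$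 is a polynomial-time deterministic Turing machine that on input $x\in\{0,1\}^*$ outputs an encoding of a quantum circuit $U_x$ of gates $H$, $T$, $\mathrm{CNOT}$ on $m(|x|)$ witness qubits and $k(|x|)$ further qubits initialised to $|0\rangle$, where $k,m\in\mathrm{poly}$ (an output that encodes no circuit stands for a trivial circuit that never accepts). Write $P_x(\rho)=\operatorname{Tr}\big(\Pi_{\rm acc}U_x(\rho\otimes|0^k\rangle\langle0^k|)U_x^\dagger\big)$ for its acceptance probability on the witness state $\rho$, where $\Pi_{\rm acc}$ projects the first qubit onto $|1\rangle$. The machine *decides* $A$ if - for every $x\in A_{\rm yes}$ there is a unit vector $|\psi\rangle\in\mathbb C^{2^{m(|x|)}}$ with $P_x\big(\mathcal E_{m(|x|)}(|\psi\rangle\langle\psi|)\big)\ge\frac23$, and - for every $x\in A_{\rm no}$ and every unit vector $|\psi\rangle\in\mathbb C^{2^{m(|x|)}}$, $P_x\big(|\psi\rangle\langle\psi|\big)\le\frac13$. The *extremal problem* of $M$ is the problem decided by $M$ of which every problem decided by $M$ is a subproblem. $\mathrm{QMA}_{\mathcal E}$ is the set of all promise problems decided by $\mathrm{QMA}_{\mathcal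 E}$-machines, and $\mathrm{QMA}_{\mathcal E}^*$ is the set of all extremal problems of $\mathrm{QMA}_{\mathcal E}$-machines. The family $\mathcal E$ has a *computable Stinespring dilation over the algebraic numbers* if there are numbers $l_m$ and unitary matrices $V_m$ on $m+l_m$ qubits such that $$\mathcal E_m(\rho)=\operatorname{Tr}_{l_m}\big(V_m(\rho\otimes|0^{l_m}\rangle\langle 0^{l_m}|)V_m^\dagger\big)\quad\text{for all } m \text{ and } \rho$$ ($\operatorname{Tr}_{l_m}$ being the partial trace over the $l_m$ ancilla qubits), all entries of $V_m$ are algebraic, $l_m$ is computable from $m$, and from $m$, a row index and a column index one can compute an exact description of that entry of $V_m$: a nonzero rational polynomial and a rectangle with rational corners in the complex plane that contains the entry and no other root of the polynomial. **Theorem.** Let $\mathcal E=(\mathcal E_m)_m$ be a quantum channel family that has a computable Stinespring dilation over the algebraic numbers. Then every $\mathrm{QMA}_{\mathcal E}$-machine has an extremal problem, and this problem is totally decidable. Moreover, $\mathrm{QMA}_{\mathcal E}^*$ is recursively presentable and $\mathrm{QMA}_{\mathcal E}$ is recursively representable. -/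

import Mathlib

open scoped Matrix

noncomputable section

namespace NoisyQMA

/-! ## Deterministic Turing machines with a runtime -/

/-- A deterministic Turing machine with a two-way infinite tape over `{0, 1, □}`: the symbols are
`some false`, `some true`, and the blank `none`. The states are `0, …, numStates`, and the
transition function gives the new state, the symbol written and the head movement
(`none` means that the head does not move). -/
structure DTM where
  numStates : ℕ
  initial : Fin (numStates + 1)
  final : Fin (numStates + 1) → Bool
  transition : Fin (numStates + 1) → Option Bool →
    Fin (numStates + 1) × Option Bool × Option Turing.Dir

/-- A configuration: the current state, and the tape as seen from the head. -/
structure DTM.Cfg (M : DTM) where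
  state : Fin (M.numStates + 1)
  tape : Turing.Tape (Option Bool)

/-- The head starts on the first symbol of the input, and all other cells are blank. -/
def DTM.start (M : DTM) (x : List Bool) : M.Cfg :=
  ⟨M.initial, Turing.Tape.mk₁ (x.map some)⟩

/-- One computational step. A configuration with a final state does not change any more. -/
def DTM.step (M : DTM) (c : M.Cfg) : M.Cfg :=
  if M.final c.state then c
  else
    let r := M.transition c.state c.tape.head
    let t := c.tape.write r.2.1
    ⟨r.1, match r.2.2 with
      | none => t
      | some d => t.move d⟩

/-- `w` is the string written between the head position and the next blank. -/
def Reads (t : Turing.Tape (Option Bool)) (w : List Bool) : Prop :=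
  ∀ i : ℕ, i ≤ w.length → t.nth (i : ℤ) = w[i]?

/-- On input `x` the machine halts after at most `n` steps, with output `w`. -/
def DTM.OutputsWithin (M : DTM) (x w : List Bool) (n : ℕ) : Prop :=
  M.final (M.step^[n] (M.start x)).state = true ∧ Reads (M.step^[n] (M.start x)).tape w

/-- The machine computes `f`, and its runtime is bounded by a polynomial in the input length. -/
def DTM.ComputesInPolyTime (M : DTM) (f : List Bool → List Bool) : Prop :=
  ∃ p : Polynomial ℕ, ∀ x, M.OutputsWithin x (f x) (p.eval x.length)

/-- The binary representation without leading zeros, most significant bit first. -/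
def bin (n : ℕ) : List Bool := if n = 0 then [false] else n.bits.reverse

/-- The set `poly`: the polynomially bounded `f : ℕ → ℕ` for which a DTM outputs `bin (f n)` on
every input of length `n`, in polynomial time. -/
def InPoly (f : ℕ → ℕ) : Prop :=
  (∃ p : Polynomial ℕ, ∀ n, f n ≤ p.eval n) ∧
  ∃ M : DTM, M.ComputesInPolyTime (fun x => bin (f x.length))

/-! ## Promise problems, total decidability, recursive (re)presentability -/

/-- A promise problem: two disjoint sets of strings. -/
structure PromiseProblem where
  yes : Set (List Bool)
  no : Set (List Bool)
  disjoint : Disjoint yes no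

/-- `A` is a subproblem (a promise restriction) of `B`. -/
def PromiseProblem.IsSubproblem (A B : PromiseProblem) : Prop :=
  A.yes ⊆ B.yes ∧ A.no ⊆ B.no

/-- The program with Gödel number `c` (a code of Mathlib's universal model of computation) halts
on input `x` with output `w`. -/
def ProgramOutputs (c : Nat.Partrec.Code) (x w : List Bool) : Prop :=
  Encodable.encode w ∈ c.eval (Encodable.encode x)

/-- The program outputs `1` on yes-instances, `0` on no-instances, `10` on all other strings. -/
def TotallyDecides (c : Nat.Partrec.Code) (A : PromiseProblem) : Prop :=
  (∀ x ∈ A.yes, ProgramOutputs c x [true]) ∧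
  (∀ x ∈ A.no, ProgramOutputs c x [false]) ∧
  (∀ x, x ∉ A.yes ∪ A.no → ProgramOutputs c x [true, false])

def TotallyDecidable (A : PromiseProblem) : Prop :=
  ∃ c : Nat.Partrec.Code, TotallyDecides c A

/-- There is a computable series of (Gödel numbers of) halting programs, such that the class
consists of exactly those promise problems that one of them totally decides. -/
def RecursivelyPresentable (K : Set PromiseProblem) : Prop :=
  ∃ c : ℕ → Nat.Partrec.Code, Computable c ∧
    (∀ i x, ∃ w, ProgramOutputs (c i) x w) ∧
    ∀ A, A ∈ K ↔ ∃ i, TotallyDecides (c i) A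

/-- The closure of a class under promise restriction. -/
def restrictionClosure (K : Set PromiseProblem) : Set PromiseProblem :=
  {A | ∃ B ∈ K, A.IsSubproblem B}

def RecursivelyRepresentable (K : Set PromiseProblem) : Prop :=
  ∃ K₀, RecursivelyPresentable K₀ ∧ K = restrictionClosure K₀

/-! ## Quantum states, channels and dilations -/

/-- The computational basis of `n` qubits. -/
abbrev Bits (n : ℕ) : Type := Fin n → Bool

/-- Operators on `n` qubits. -/
abbrev Op (n : ℕ) : Type := Matrix (Bits n) (Bits n) ℂ

/-- `|ψ⟩⟨ψ|`. -/
def pureState {n : ℕ} (ψ : Bits n → ℂ) : Op n := Matrix.vecMulVec ψ (star ψ)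

/-- `|ψ⟩` is a state vector. -/
def IsState {n : ℕ} (ψ : Bits n → ℂ) : Prop := ∑ i, ‖ψ i‖ ^ 2 = 1

/-- `ρ ⊗ |0^l⟩⟨0^l|`: the ancillas are the last `l` qubits. -/
def withAncillas {n : ℕ} (l : ℕ) (ρ : Op n) : Op (n + l) := fun s t =>
  if (∀ j, s (Fin.natAdd n j) = false) ∧ (∀ j, t (Fin.natAdd n j) = false) then
    ρ (fun i => s (Fin.castAdd l i)) (fun i => t (Fin.castAdd l i))
  else 0

/-- The partial trace over the last `l` qubits. -/
def partialTrace {n : ℕ} (l : ℕ) (X : Op (n + l)) : Op n := fun s t =>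
  ∑ z : Bits l, X (Fin.append s z) (Fin.append t z)

open scoped ComplexOrder in
/-- A quantum channel on `n` qubits: a trace-preserving, completely positive linear map. -/
structure QuantumChannel (n : ℕ) where
  map : Op n →ₗ[ℂ] Op n
  trace_preserving : ∀ X, (map X).trace = X.trace
  completely_positive : ∀ (d : ℕ) (X : Matrix (Fin d × Bits n) (Fin d × Bits n) ℂ),
    X.PosSemidef →
    (Matrix.of fun p q : Fin d × Bits n =>
      map (Matrix.of fun i j => X (p.1, i) (q.1, j)) p.2 q.2).PosSemidef

/-- Exact descriptions of algebraic numbers: `(coeffs, (a, b), (c, d), N)` stands for the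
polynomial with the given integer coefficients (constant term first), and for the rectangle
`[a/(N+1), b/(N+1)] × [c/(N+1), d/(N+1)]` in the complex plane. -/
abbrev AlgebraicCode : Type := List ℤ × (ℤ × ℤ) × (ℤ × ℤ) × ℕ

def AlgebraicCode.evalPoly (r : AlgebraicCode) (z : ℂ) : ℂ :=
  r.1.foldr (fun (a : ℤ) v => (a : ℂ) + z * v) 0

def AlgebraicCode.InRectangle (r : AlgebraicCode) (z : ℂ) : Prop :=
  (r.2.1.1 : ℝ) / (r.2.2.2 + 1) ≤ z.re ∧ z.re ≤ (r.2.1.2 : ℝ) / (r.2.2.2 + 1) ∧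
  (r.2.2.1.1 : ℝ) / (r.2.2.2 + 1) ≤ z.im ∧ z.im ≤ (r.2.2.1.2 : ℝ) / (r.2.2.2 + 1)

/-- The polynomial is not zero, and `z` is its only root in the rectangle. -/
def AlgebraicCode.Represents (r : AlgebraicCode) (z : ℂ) : Prop :=
  (∃ a ∈ r.1, a ≠ 0) ∧
  AlgebraicCode.evalPoly r z = 0 ∧ AlgebraicCode.InRectangle r z ∧
  ∀ y, AlgebraicCode.evalPoly r y = 0 → AlgebraicCode.InRectangle r y → y = z

/-- `V` (a unitary on `n` qubits and `l` ancilla qubits) is a Stinespring dilation of `Φ`. -/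
def IsStinespringDilation {n : ℕ} (Φ : QuantumChannel n) (l : ℕ) (V : Op (n + l)) : Prop :=
  V ∈ Matrix.unitaryGroup (Bits (n + l)) ℂ ∧
  ∀ ρ, Φ.map ρ = partialTrace l (V * withAncillas l ρ * Vᴴ)

/-- There are Stinespring dilations `V m` of the channels `E m`, with algebraic entries, such that
the number `l m` of ancilla qubits is computable from `m`, and exact descriptions of the entries of
`V m` are computable from `m` and the row and column indices (as bit strings). -/
def HasComputableStinespringDilation (E : ∀ m, QuantumChannel m) : Prop :=
  ∃ (l : ℕ → ℕ) (V : ∀ m, Op (m + l m)) (entry : ℕ × List Bool × List Bool → AlgebraicCode),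
    Computable l ∧ Computable entry ∧
    ∀ m, IsStinespringDilation (E m) (l m) (V m) ∧
      ∀ i j, AlgebraicCode.Represents (entry (m, List.ofFn i, List.ofFn j)) (V m i j)

/-! ## Quantum circuits -/

/-- The elementary gates, on `n` qubits. -/
inductive Gate (n : ℕ) where
  | H (q : Fin n)
  | T (q : Fin n)
  | CNOT (control target : Fin n) (ne : control ≠ target)

/-- A single-qubit operator, acting on qubit `q`. -/
def onQubit {n : ℕ} (q : Fin n) (G : Matrix Bool Bool ℂ) : Op n := fun x y =>
  if ∀ j, j ≠ q → x j = y j then G (x q) (y q) else 0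

def hadamard : Matrix Bool Bool ℂ := fun a b =>
  (1 / (Real.sqrt 2 : ℂ)) * (if a = true ∧ b = true then -1 else 1)

def tGate : Matrix Bool Bool ℂ :=
  Matrix.diagonal fun a => if a = true then Complex.exp (Complex.I * (Real.pi / 4)) else 1

def cnot {n : ℕ} (c t : Fin n) : Op n := fun x y =>
  if x = Function.update y t (xor (y t) (y c)) then 1 else 0

def Gate.matrix {n : ℕ} : Gate n → Op n
  | .H q => onQubit q hadamard
  | .T q => onQubit q tGate
  | .CNOT c t _ => cnot c t

/-- A circuit on `witness` witness qubits followed by `ancilla` further qubits, which are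
initialised to `0`. The gates are listed in the order in which they act. -/
structure Circuit where
  witness : ℕ
  ancilla : ℕ
  pos : 0 < witness + ancilla
  gates : List (Gate (witness + ancilla))

/-- The product of the gates, the first gate being the rightmost factor. -/
def Circuit.unitary (C : Circuit) : Op (C.witness + C.ancilla) :=
  C.gates.foldl (fun U g => g.matrix * U) 1

/-- The projector `|1⟩⟨1|` on the output qubit, which is the first qubit. -/
def Circuit.acceptProjector (C : Circuit) : Op (C.witness + C.ancilla) :=
  Matrix.diagonal fun x => if x ⟨0, C.pos⟩ = true then 1 else 0

/-- The acceptance probability for the witness state (density matrix) `ρ`. -/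
def Circuit.acceptProb (C : Circuit) (ρ : Op C.witness) : ℝ :=
  (C.acceptProjector * (C.unitary * withAncillas C.ancilla ρ * C.unitaryᴴ)).trace.re

/-- Gates as bit strings: the type of the gate (`01`, `10`, `11`), then the qubits (counted from 1)
in unary, separated by `0`. -/
def Gate.encode {n : ℕ} : Gate n → List Bool
  | .H q => [false, true, false] ++ List.replicate (q + 1) true
  | .T q => [true, false, false] ++ List.replicate (q + 1) true
  | .CNOT c t _ => [true, true, false] ++ List.replicate (c + 1) true ++
      false :: List.replicate (t + 1) true

/-- Circuits as bit strings: the two numbers of qubits in unary, then the gates, everything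
separated by `0`. -/
def Circuit.encode (C : Circuit) : List Bool :=
  List.replicate C.witness true ++ false :: (List.replicate C.ancilla true ++
    C.gates.flatMap fun g => false :: g.encode)

theorem replicate_append_inj {a b : ℕ} {l l' : List Bool}
    (hl : l.head? ≠ some true) (hl' : l'.head? ≠ some true)
    (h : List.replicate a true ++ l = List.replicate b true ++ l') : a = b ∧ l = l' := by
  induction a generalizing b with
  | zero =>
    cases b with
    | zero => exact ⟨rfl, by simpa using h⟩
    | succ b => simp [List.replicate_succ] at h; simp [h] at hl
  | succ a ih =>
    cases b with
    | zero => simp [List.replicate_succ] at h; simp [← h] at hl'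
    | succ b =>
      simp only [List.replicate_succ, List.cons_append, List.cons.injEq, true_and] at h
      obtain ⟨rfl, h2⟩ := ih h
      exact ⟨rfl, h2⟩

theorem head_flatMap_ne {n : ℕ} (gs : List (Gate n)) :
    (gs.flatMap fun g => false :: g.encode).head? ≠ some true := by
  cases gs <;> simp

theorem gates_encode_injective {n : ℕ} : ∀ gs gs' : List (Gate n),
    (gs.flatMap fun g => false :: g.encode) = (gs'.flatMap fun g => false :: g.encode) →
      gs = gs'
  | [], [], _ => rfl
  | [], _ :: _, h => by simp at h
  | _ :: _, [], h => by simp at h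
  | g :: gs, g' :: gs', h => by
    have ih := gates_encode_injective gs gs'
    have e := head_flatMap_ne gs
    have e' := head_flatMap_ne gs'
    simp only [List.flatMap_cons, List.cons_append, List.cons.injEq, true_and] at h
    cases g with
    | H q =>
      cases g' with
      | H q' =>
        simp only [Gate.encode, List.append_assoc, List.append_cancel_left_eq] at h
        obtain ⟨h1, h2⟩ := replicate_append_inj e e' h
        rw [ih h2, Fin.ext (by omega : (q : ℕ) = q')]
      | T q' => simp [Gate.encode] at h
      | CNOT c t ne => simp [Gate.encode] at h
    | T q =>
      cases g' with
      | H q' => simp [Gate.encode] at h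
      | T q' =>
        simp only [Gate.encode, List.append_assoc, List.append_cancel_left_eq] at h
        obtain ⟨h1, h2⟩ := replicate_append_inj e e' h
        rw [ih h2, Fin.ext (by omega : (q : ℕ) = q')]
      | CNOT c t ne => simp [Gate.encode] at h
    | CNOT c t ne =>
      cases g' with
      | H q' => simp [Gate.encode] at h
      | T q' => simp [Gate.encode] at h
      | CNOT c' t' ne' =>
        have h' : List.replicate (c + 1) true ++ (false :: (List.replicate (t + 1) true ++
            gs.flatMap fun g => false :: g.encode)) = List.replicate (c' + 1) true ++
            (false :: (List.replicate (t' + 1) true ++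
              gs'.flatMap fun g => false :: g.encode)) := by
          simpa [Gate.encode] using h
        obtain ⟨h1, h2⟩ := replicate_append_inj (by simp) (by simp) h'
        obtain ⟨h3, h4⟩ := replicate_append_inj e e' (List.cons.inj h2).2
        obtain rfl : c = c' := Fin.ext (by omega)
        obtain rfl : t = t' := Fin.ext (by omega)
        rw [ih h4]

theorem Circuit.encode_injective : Function.Injective Circuit.encode := by
  rintro ⟨m, k, hp, gs⟩ ⟨m', k', hp', gs'⟩ h
  simp only [Circuit.encode] at h
  obtain ⟨rfl, h1⟩ := replicate_append_inj (by simp) (by simp) h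
  obtain ⟨rfl, h2⟩ :=
    replicate_append_inj (head_flatMap_ne gs) (head_flatMap_ne gs') (List.cons.inj h1).2
  rw [gates_encode_injective gs gs' h2]

/-- The trivial circuit, which never accepts: no gates, and its only qubit is initialised to `0`. -/
def trivialCircuit : Circuit := ⟨0, 1, Nat.one_pos, []⟩

open Classical in
/-- The circuit described by `w`: the unique circuit with encoding `w`, and the trivial circuit if
`w` is not the encoding of a circuit. -/
def Circuit.ofString (w : List Bool) : Circuit :=
  if h : ∃ C : Circuit, C.encode = w then h.choose else trivialCircuit

/-! ## The classes -/

/-- A polynomial-time generated family of quantum circuits `(U_x)` on `k(|x|) + m(|x|)` qubits,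
`m(|x|)` of which are witness qubits, with `k, m ∈ poly`. It is given by a DTM that on input `x`
outputs (within polynomial time) the string that describes the circuit. A string that encodes no
circuit describes the trivial circuit, on which `sizes` puts no condition. -/
structure QMAMachine where
  dtm : DTM
  output : List Bool → List Bool
  computes : dtm.ComputesInPolyTime output
  m : ℕ → ℕ
  k : ℕ → ℕ
  m_poly : InPoly m
  k_poly : InPoly k
  sizes : ∀ (x : List Bool) (C : Circuit), C.encode = output x → C.witness = m x.length ∧ C.ancilla = k x.length

def QMAMachine.circuit (M : QMAMachine) (x : List Bool) : Circuit :=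
  Circuit.ofString (M.output x)

/-- `M`, considered as a `QMA_E`-machine, decides `A`: for every yes-instance some witness is
accepted with probability at least `2/3` after it has passed the channel; for every no-instance all
(noiseless) witnesses are accepted with probability at most `1/3`. -/
def QMAMachine.Decides (E : ∀ m, QuantumChannel m) (M : QMAMachine) (A : PromiseProblem) : Prop :=
  (∀ x ∈ A.yes, ∃ ψ : Bits (M.circuit x).witness → ℂ, IsState ψ ∧
    2 / 3 ≤ (M.circuit x).acceptProb ((E _).map (pureState ψ))) ∧
  (∀ x ∈ A.no, ∀ ψ : Bits (M.circuit x).witness → ℂ, IsState ψ →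
    (M.circuit x).acceptProb (pureState ψ) ≤ 1 / 3)

/-- The extremal problem of `M`: the problem decided by `M` with the weakest promise, of which
every problem decided by `M` is a subproblem. -/
def QMAMachine.IsExtremalProblem (E : ∀ m, QuantumChannel m) (M : QMAMachine)
    (A : PromiseProblem) : Prop :=
  M.Decides E A ∧ ∀ B : PromiseProblem, M.Decides E B → B.IsSubproblem A

/-- The class `QMA_E`. -/
def QMA (E : ∀ m, QuantumChannel m) : Set PromiseProblem :=
  {A | ∃ M : QMAMachine, M.Decides E A}

/-- The class `QMA_E^*` of the extremal problems of `QMA_E`-machines. -/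
def QMAStar (E : ∀ m, QuantumChannel m) : Set PromiseProblem :=
  {A | ∃ M : QMAMachine, M.IsExtremalProblem E A}

end NoisyQMA

end

/-! Two positive operators decide everything about a circuit with unitary U. Let Q be the
compression of U†ΠU to ancillas in the state 0 (`Circuit.acceptOp`), and R the compression of V†(Q ⊗
1)V, where V is the Stinespring dilation (`dilatedOp`). Cyclicity of the trace gives P(ρ) = tr(Qρ)
and P(E(ρ)) = tr(Rρ). So the yes-condition says that R has an eigenvalue ≥ 2/3, and the no-condition
that no eigenvalue of Q exceeds 1/3. The map Q ↦ R is positive and unital, so Q ≤ 1/3 forces R ≤ 1/3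
and the two conditions exclude each other (`not_acceptsNoisy_of_rejectsAll`). The strings that
satisfy them therefore form a promise problem, and it is the extremal one.

Both conditions are decidable (`computable_verdicts`). Matrix entries can be approximated to any
precision, because a root isolated by a rectangle is found by a search over finer and finer grids
(`compC_of_represents`). Approximation alone cannot compare an eigenvalue λ with a threshold that it
may equal. But λ is algebraic: a multiple of uλ - v is an algebraic integer with computable bounds
on its degree and its conjugates, and its norm is a nonzero integer unless uλ = v. This bounds |uλ -
v| from below by a computable number (`one_le_norm_sub_mul`). Given such a gap, the trace of a high
power of the scaled operator, suitably normalised, is either at least 1 or at most 1/2, and a rough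
approximation tells which (`computable_exists_one_le`, `computable_exists_one_lt`). No eigenvalue is
ever computed.

For the presentation, machines are coded by three Turing machines and a clock. A code cannot be
checked on all inputs at once, so `MachineCode.safeOutput` checks it on all strings up to the
current one and outputs the empty string, which stands for the trivial circuit, from the first
failure on. A defective code then has a nonempty output on finitely many strings only, and a machine
with a lookup table produces this in polynomial time (`exists_dtm_of_eventually_const`). So every
code yields a genuine machine (`MachineCode.exists_machine`), and every machine has a code
(`QMAMachine.exists_code`). Composition with the verdict presents the class of extremal problems;
its closure under subproblems is the whole class (`qma_eq_restrictionClosure`). -/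

open scoped Matrix

/-! ## Computability of elementary functions -/

namespace NoisyQMA

section ComputableLibrary

attribute [fun_prop] Computable

variable {α β γ σ : Type*} [Primcodable α] [Primcodable β] [Primcodable γ] [Primcodable σ]

@[fun_prop] theorem computable_id : Computable (fun a : α => a) := Computable.id

@[fun_prop] theorem computable_const (s : σ) : Computable (fun _ : α => s) := Computable.const s

@[fun_prop] theorem computable_comp {f : β → σ} {g : α → β} (hf : Computable f)
    (hg : Computable g) : Computable (fun a => f (g a)) := hf.comp hg

@[fun_prop] theorem computable_fst {f : α → β × γ} (hf : Computable f) :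
    Computable (fun a => (f a).1) := Computable.fst.comp hf

@[fun_prop] theorem computable_snd {f : α → β × γ} (hf : Computable f) :
    Computable (fun a => (f a).2) := Computable.snd.comp hf

@[fun_prop] theorem computable_mk {f : α → β} {g : α → γ} (hf : Computable f)
    (hg : Computable g) : Computable (fun a => (f a, g a)) := hf.pair hg

@[fun_prop] theorem computable_nat_add {f g : α → ℕ} (hf : Computable f) (hg : Computable g) :
    Computable (fun a => f a + g a) := Primrec.nat_add.to_comp.comp hf hg

@[fun_prop] theorem computable_nat_mul {f g : α → ℕ} (hf : Computable f) (hg : Computable g) :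
    Computable (fun a => f a * g a) := Primrec.nat_mul.to_comp.comp hf hg

@[fun_prop] theorem computable_nat_sub {f g : α → ℕ} (hf : Computable f) (hg : Computable g) :
    Computable (fun a => f a - g a) := Primrec.nat_sub.to_comp.comp hf hg

@[fun_prop] theorem computable_nat_div {f g : α → ℕ} (hf : Computable f) (hg : Computable g) :
    Computable (fun a => f a / g a) := Primrec.nat_div.to_comp.comp hf hg

@[fun_prop] theorem computable_nat_mod {f g : α → ℕ} (hf : Computable f) (hg : Computable g) :
    Computable (fun a => f a % g a) := Primrec.nat_mod.to_comp.comp hf hg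

@[fun_prop] theorem computable_nat_pow {f g : α → ℕ} (hf : Computable f) (hg : Computable g) :
    Computable (fun a => f a ^ g a) :=
  (Primrec₂.unpaired'.1 Nat.Primrec.pow).to_comp.comp hf hg

@[fun_prop] theorem computable_bool {f : α → Bool} (hf : Computable f) (g : Bool → σ) :
    Computable (fun a => g (f a)) := (Primrec.dom_bool g).to_comp.comp hf

@[fun_prop] theorem computable_not {f : α → Bool} (hf : Computable f) :
    Computable (fun a => !(f a)) := computable_bool hf _

@[fun_prop] theorem computable_and {f g : α → Bool} (hf : Computable f) (hg : Computable g) :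
    Computable (fun a => f a && g a) := Primrec.and.to_comp.comp hf hg

@[fun_prop] theorem computable_or {f g : α → Bool} (hf : Computable f) (hg : Computable g) :
    Computable (fun a => f a || g a) := Primrec.or.to_comp.comp hf hg

@[fun_prop] theorem computable_decide_eq [DecidableEq σ] {f g : α → σ} (hf : Computable f)
    (hg : Computable g) : Computable (fun a => decide (f a = g a)) :=
  (Primrec.eq (α := σ)).decide.to_comp.comp hf hg

@[fun_prop] theorem computable_decide_le {f g : α → ℕ} (hf : Computable f)
    (hg : Computable g) : Computable (fun a => decide (f a ≤ g a)) :=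
  Primrec.nat_le.decide.to_comp.comp hf hg

@[fun_prop] theorem computable_decide_lt {f g : α → ℕ} (hf : Computable f)
    (hg : Computable g) : Computable (fun a => decide (f a < g a)) :=
  Primrec.nat_lt.decide.to_comp.comp hf hg

@[fun_prop] theorem computable_decide_not {p : α → Prop} [∀ a, Decidable (p a)]
    (hp : Computable (fun a => decide (p a))) : Computable (fun a => decide (¬ p a)) :=
  (computable_not hp).of_eq fun a => by simp

@[fun_prop] theorem computable_decide_and {p q : α → Prop} [∀ a, Decidable (p a)]
    [∀ a, Decidable (q a)] (hp : Computable (fun a => decide (p a)))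
    (hq : Computable (fun a => decide (q a))) : Computable (fun a => decide (p a ∧ q a)) :=
  (computable_and hp hq).of_eq fun a => by simp

@[fun_prop] theorem computable_decide_or {p q : α → Prop} [∀ a, Decidable (p a)]
    [∀ a, Decidable (q a)] (hp : Computable (fun a => decide (p a)))
    (hq : Computable (fun a => decide (q a))) : Computable (fun a => decide (p a ∨ q a)) :=
  (computable_or hp hq).of_eq fun a => by simp

theorem computable_decide_iff {p q : α → Prop} [∀ a, Decidable (p a)]
    [∀ a, Decidable (q a)] (h : ∀ a, p a ↔ q a) (hp : Computable (fun a => decide (p a))) :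
    Computable (fun a => decide (q a)) :=
  hp.of_eq fun a => by simp [h]

@[fun_prop] theorem computable_cond {c : α → Bool} {f g : α → σ} (hc : Computable c)
    (hf : Computable f) (hg : Computable g) : Computable (fun a => cond (c a) (f a) (g a)) :=
  Computable.cond hc hf hg

@[fun_prop] theorem computable_ite {p : α → Prop} [∀ a, Decidable (p a)] {f g : α → σ}
    (hp : Computable (fun a => decide (p a))) (hf : Computable f) (hg : Computable g) :
    Computable (fun a => if p a then f a else g a) :=
  (Computable.cond hp hf hg).of_eq fun a => by by_cases h : p a <;> simp [h]

@[fun_prop] theorem computable_nat_rec {f : α → ℕ} {g : α → σ} {h : α → ℕ → σ → σ}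
    (hf : Computable f) (hg : Computable g)
    (hh : Computable (fun p : α × ℕ × σ => h p.1 p.2.1 p.2.2)) :
    Computable (fun a => Nat.rec (motive := fun _ => σ) (g a) (h a) (f a)) :=
  Computable.nat_rec hf hg (h := fun a p => h a p.1 p.2) hh

@[fun_prop] theorem computable_iterate {f : α → ℕ} {g : α → σ} {h : α → σ → σ}
    (hf : Computable f) (hg : Computable g) (hh : Computable (fun p : α × σ => h p.1 p.2)) :
    Computable (fun a => (h a)^[f a] (g a)) := by
  have : Computable (fun a => Nat.rec (motive := fun _ => σ) (g a) (fun _ s => h a s) (f a)) := by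
    fun_prop
  refine this.of_eq fun a => ?_
  induction f a with
  | zero => rfl
  | succ n ih => rw [Function.iterate_succ_apply', ← ih]

@[fun_prop] theorem computable_sum_range {f : α → ℕ} {h : α → ℕ → ℕ} (hf : Computable f)
    (hh : Computable (fun p : α × ℕ => h p.1 p.2)) :
    Computable (fun a => ∑ i ∈ Finset.range (f a), h a i) := by
  have : Computable (fun a => Nat.rec (motive := fun _ => ℕ) 0 (fun i s => s + h a i) (f a)) := by
    fun_prop
  refine this.of_eq fun a => ?_
  induction f a with
  | zero => rfl
  | succ n ih => rw [Finset.sum_range_succ, ← ih]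

@[fun_prop] theorem computable_prod_range {f : α → ℕ} {h : α → ℕ → ℕ} (hf : Computable f)
    (hh : Computable (fun p : α × ℕ => h p.1 p.2)) :
    Computable (fun a => ∏ i ∈ Finset.range (f a), h a i) := by
  have : Computable (fun a => Nat.rec (motive := fun _ => ℕ) 1 (fun i s => s * h a i) (f a)) := by
    fun_prop
  refine this.of_eq fun a => ?_
  induction f a with
  | zero => rfl
  | succ n ih => rw [Finset.prod_range_succ, ← ih]

@[fun_prop] theorem computable_decide_forall_lt {f : α → ℕ} {p : α → ℕ → Prop}
    [∀ a i, Decidable (p a i)] (hf : Computable f)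
    (hp : Computable (fun q : α × ℕ => decide (p q.1 q.2))) :
    Computable (fun a => decide (∀ i, i < f a → p a i)) := by
  have : Computable (fun a => Nat.rec (motive := fun _ => Bool) true
      (fun i s => s && decide (p a i)) (f a)) :=
    computable_nat_rec (h := fun a i s => s && decide (p a i)) hf (by fun_prop)
      (computable_and (by fun_prop) (hp.comp (show Computable fun q : α × ℕ × Bool => (q.1, q.2.1) by
        fun_prop)))
  refine this.of_eq fun a => ?_
  induction f a with
  | zero => simp
  | succ n ih =>
    rw [Bool.eq_iff_iff] at ih ⊢
    simp only [Bool.and_eq_true, ih, decide_eq_true_eq, Nat.lt_succ_iff_lt_or_eq]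
    grind

@[fun_prop] theorem computable_option_getD {f : α → Option β} {g : α → β} (hf : Computable f)
    (hg : Computable g) : Computable (fun a => (f a).getD (g a)) := Computable.option_getD hf hg

@[fun_prop] theorem computable_some {f : α → β} (hf : Computable f) :
    Computable (fun a => some (f a)) := Computable.option_some.comp hf

@[fun_prop] theorem computable_isSome {f : α → Option β} (hf : Computable f) :
    Computable (fun a => (f a).isSome) := Primrec.option_isSome.to_comp.comp hf

@[fun_prop] theorem computable_getElem? {f : α → List β} {g : α → ℕ} (hf : Computable f)
    (hg : Computable g) : Computable (fun a => (f a)[g a]?) :=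
  Primrec.list_getElem?.to_comp.comp hf hg

@[fun_prop] theorem computable_getD {f : α → List β} {g : α → ℕ} {d : α → β}
    (hf : Computable f) (hg : Computable g) (hd : Computable d) :
    Computable (fun a => (f a).getD (g a) (d a)) := by
  simp only [List.getD_eq_getElem?_getD]; fun_prop

@[fun_prop] theorem computable_length {f : α → List β} (hf : Computable f) :
    Computable (fun a => (f a).length) := Computable.list_length.comp hf

@[fun_prop] theorem computable_cons {f : α → β} {g : α → List β} (hf : Computable f)
    (hg : Computable g) : Computable (fun a => f a :: g a) :=
  Primrec.list_cons.to_comp.comp hf hg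

@[fun_prop] theorem computable_reverse {f : α → List β} (hf : Computable f) :
    Computable (fun a => (f a).reverse) := Computable.list_reverse.comp hf

@[fun_prop] theorem computable_tail {f : α → List β} (hf : Computable f) :
    Computable (fun a => (f a).tail) := Primrec.list_tail.to_comp.comp hf

@[fun_prop] theorem computable_head? {f : α → List β} (hf : Computable f) :
    Computable (fun a => (f a).head?) := Primrec.list_head?.to_comp.comp hf

@[fun_prop] theorem computable_list_range {f : α → ℕ} (hf : Computable f) :
    Computable (fun a => List.range (f a)) := Primrec.list_range.to_comp.comp hf

-- The fold is an iteration that carries the unread rest of the list in its state and consumes one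
-- head per step.
@[fun_prop] theorem computable_foldl {f : α → List β} {g : α → σ} {h : α → σ → β → σ}
    (hf : Computable f) (hg : Computable g)
    (hh : Computable (fun p : α × σ × β => h p.1 p.2.1 p.2.2)) :
    Computable (fun a => List.foldl (h a) (g a) (f a)) := by
  have step : Computable (fun q : (α × σ) × List β =>
      ((q.2.head?.map fun b => h q.1.1 q.1.2 b).getD q.1.2)) :=
    Computable.option_getD
      (Computable.option_map (by fun_prop) (g := fun (q : (α × σ) × List β) b => h q.1.1 q.1.2 b)
        (show Computable (fun q : ((α × σ) × List β) × β => h q.1.1.1 q.1.1.2 q.2) by fun_prop))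
      (by fun_prop)
  have step' : Computable (fun q : α × σ × List β =>
      ((q.2.2.head?.map fun b => h q.1 q.2.1 b).getD q.2.1)) :=
    step.comp (show Computable (fun q : α × σ × List β => ((q.1, q.2.1), q.2.2)) by fun_prop)
  have : Computable (fun a =>
      ((fun s : σ × List β => ((s.2.head?.map fun b => h a s.1 b).getD s.1, s.2.tail))^[(f a).length]
        (g a, f a)).1) := by fun_prop
  refine this.of_eq fun a => ?_
  generalize g a = s
  generalize f a = l
  induction l generalizing s with
  | nil => rfl
  | cons b l ih => simpa using ih (h a s b)

@[fun_prop] theorem computable_foldr {f : α → List β} {g : α → σ} {h : α → β → σ → σ}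
    (hf : Computable f) (hg : Computable g)
    (hh : Computable (fun p : α × β × σ => h p.1 p.2.1 p.2.2)) :
    Computable (fun a => List.foldr (h a) (g a) (f a)) := by
  have : Computable (fun a => List.foldl (fun s b => h a b s) (g a) (f a).reverse) := by fun_prop
  exact this.of_eq fun a => by simp

@[fun_prop] theorem computable_map {f : α → List β} {h : α → β → σ} (hf : Computable f)
    (hh : Computable (fun p : α × β => h p.1 p.2)) :
    Computable (fun a => (f a).map (h a)) := by
  have : Computable (fun a => List.foldr (fun b s => h a b :: s) [] (f a)) := by fun_prop
  exact this.of_eq fun a => by induction f a <;> simp_all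

@[fun_prop] theorem computable_replicate {f : α → ℕ} {g : α → β} (hf : Computable f)
    (hg : Computable g) : Computable (fun a => List.replicate (f a) (g a)) := by
  have : Computable (fun a => (List.range (f a)).map fun _ => g a) := by fun_prop
  exact this.of_eq fun a => by simp

@[fun_prop] theorem computable_testBit {f g : α → ℕ} (hf : Computable f) (hg : Computable g) :
    Computable (fun a => (f a).testBit (g a)) := by
  have : Computable (fun a => decide (f a / 2 ^ g a % 2 = 1)) := by fun_prop
  exact this.of_eq fun a => by rw [Nat.testBit_eq_decide_div_mod_eq]

/-- Unbounded search for a witness that always exists. -/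
theorem exists_computable_search {p : α → β → Prop} [∀ a b, Decidable (p a b)]
    [Inhabited β]
    (hp : Computable (fun q : α × β => decide (p q.1 q.2))) (h : ∀ a, ∃ b, p a b) :
    ∃ f : α → β, Computable f ∧ ∀ a, p a (f a) := by
  -- The search runs over codes in ℕ; a number that decodes to nothing counts as a failure.
  let o : α → ℕ → Option β := fun a n =>
    (Encodable.decode (α := β) n).bind fun b => if p a b then some b else none
  have ho : Computable₂ o := by
    have h1 : Computable (fun q : (α × ℕ) × β => decide (p q.1.1 q.2)) :=
      hp.comp (f := fun q : α × β => decide (p q.1 q.2)) (g := fun q : (α × ℕ) × β => (q.1.1, q.2))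
        (by fun_prop)
    have h2 : Computable (fun q : (α × ℕ) × β => if p q.1.1 q.2 then some q.2 else none) :=
      computable_ite h1 (by fun_prop) (by fun_prop)
    exact Computable.option_bind (f := fun q : α × ℕ => Encodable.decode (α := β) q.2)
      (g := fun q b => if p q.1 b then some b else none)
      (Computable.decode.comp Computable.snd) h2
  have hdom : ∀ a, (Nat.rfindOpt (o a)).Dom := fun a => by
    obtain ⟨b, hb⟩ := h a
    exact Nat.rfindOpt_dom.2 ⟨Encodable.encode b, b, by simp [o, hb]⟩
  refine ⟨fun a => (Nat.rfindOpt (o a)).get (hdom a),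
    Partrec.of_eq_tot (Partrec.rfindOpt ho) fun a => Part.get_mem _, fun a => ?_⟩
  obtain ⟨n, hn⟩ := Nat.rfindOpt_spec (Part.get_mem (hdom a))
  simp only [o, Option.mem_def, Option.bind_eq_some_iff] at hn
  obtain ⟨b, -, hb⟩ := hn
  split_ifs at hb with hpb
  cases hb
  exact hpb

/-! ### Integers -/

/-- The encoding of ℤ puts the nonnegative numbers on even codes and the negative ones on odd codes.
Through differences of natural numbers this reduces integer arithmetic to ℕ. -/
theorem encode_int_natSub (a b : ℕ) : Encodable.encode ((a : ℤ) - b) =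
    if b ≤ a then 2 * (a - b) else 2 * (b - a - 1) + 1 := by
  split_ifs with h
  · obtain ⟨c, rfl⟩ := Nat.exists_eq_add_of_le h
    have : ((b + c : ℕ) : ℤ) - b = Int.ofNat c := by push_cast; simp
    have h2 : Encodable.encode (Int.ofNat c) = Equiv.natSumNatEquivNat (Sum.inl c) := rfl
    rw [this, h2]
    simp
  · obtain ⟨c, rfl⟩ := Nat.exists_eq_add_of_lt (not_le.1 h)
    have : (a : ℤ) - (a + c + 1 : ℕ) = Int.negSucc c := by
      rw [Int.negSucc_eq]; push_cast; ring
    have h2 : Encodable.encode (Int.negSucc c) = Equiv.natSumNatEquivNat (Sum.inr c) := rfl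
    rw [this, h2]
    simp
    omega

theorem computable_natSub {f g : α → ℕ} (hf : Computable f) (hg : Computable g) :
    Computable (fun a => (f a : ℤ) - g a) := by
  refine Computable.encode_iff.1 ?_
  simp only [encode_int_natSub]
  fun_prop

@[fun_prop] theorem computable_toNat {f : α → ℤ} (hf : Computable f) :
    Computable (fun a => (f a).toNat) := by
  have h : Computable (fun a => Encodable.encode (f a)) := Computable.encode.comp hf
  have : Computable (fun a => if Encodable.encode (f a) % 2 = 0 then
    Encodable.encode (f a) / 2 else 0) := by fun_prop
  refine this.of_eq fun a => ?_
  have := encode_int_natSub (f a).toNat (-f a).toNat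
  rw [Int.toNat_sub_toNat_neg] at this
  rw [this]
  split_ifs <;> omega

theorem computable_negToNat {f : α → ℤ} (hf : Computable f) :
    Computable (fun a => (-f a).toNat) := by
  have h : Computable (fun a => Encodable.encode (f a)) := Computable.encode.comp hf
  have : Computable (fun a => if Encodable.encode (f a) % 2 = 0 then
    0 else Encodable.encode (f a) / 2 + 1) := by fun_prop
  refine this.of_eq fun a => ?_
  have := encode_int_natSub (f a).toNat (-f a).toNat
  rw [Int.toNat_sub_toNat_neg] at this
  rw [this]
  split_ifs <;> omega

@[fun_prop] theorem computable_natCast {f : α → ℕ} (hf : Computable f) :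
    Computable (fun a => (f a : ℤ)) :=
  (computable_natSub hf (computable_const 0)).of_eq fun a => by simp

@[fun_prop] theorem computable_int_add {f g : α → ℤ} (hf : Computable f) (hg : Computable g) :
    Computable (fun a => f a + g a) := by
  have h1 := computable_negToNat hf
  have h2 := computable_negToNat hg
  refine (computable_natSub (f := fun a => (f a).toNat + (g a).toNat)
    (g := fun a => (-f a).toNat + (-g a).toNat) (by fun_prop) (by fun_prop)).of_eq fun a => ?_
  omega

@[fun_prop] theorem computable_int_neg {f : α → ℤ} (hf : Computable f) :
    Computable (fun a => - f a) := by
  have h1 := computable_negToNat hf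
  refine (computable_natSub (f := fun a => (-f a).toNat)
    (g := fun a => (f a).toNat) (by fun_prop) (by fun_prop)).of_eq fun a => ?_
  omega

@[fun_prop] theorem computable_int_sub {f g : α → ℤ} (hf : Computable f) (hg : Computable g) :
    Computable (fun a => f a - g a) := by
  simp only [sub_eq_add_neg]; fun_prop

@[fun_prop] theorem computable_int_mul {f g : α → ℤ} (hf : Computable f) (hg : Computable g) :
    Computable (fun a => f a * g a) := by
  have h1 := computable_negToNat hf
  have h2 := computable_negToNat hg
  refine (computable_natSub
    (f := fun a => (f a).toNat * (g a).toNat + (-f a).toNat * (-g a).toNat)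
    (g := fun a => (f a).toNat * (-g a).toNat + (-f a).toNat * (g a).toNat)
    (by fun_prop) (by fun_prop)).of_eq fun a => ?_
  conv_rhs => rw [← Int.toNat_sub_toNat_neg (f a), ← Int.toNat_sub_toNat_neg (g a)]
  push_cast
  ring

@[fun_prop] theorem computable_int_le {f g : α → ℤ} (hf : Computable f) (hg : Computable g) :
    Computable (fun a => decide (f a ≤ g a)) := by
  have h : Computable (fun a => decide ((f a - g a).toNat ≤ 0)) := by fun_prop
  exact computable_decide_iff (fun a => by omega) h

@[fun_prop] theorem computable_natAbs {f : α → ℤ} (hf : Computable f) :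
    Computable (fun a => (f a).natAbs) := by
  have h1 := computable_negToNat hf
  have : Computable (fun a => (f a).toNat + (-f a).toNat) := by fun_prop
  exact this.of_eq fun a => by omega

end ComputableLibrary

end NoisyQMA

namespace NoisyQMA

/-! ## Computable families of complex numbers -/

/-- `((x, y), k)` stands for the complex number `(x + iy) / 2 ^ k`. -/
abbrev GaussDyadic : Type := (ℤ × ℤ) × ℕ

noncomputable def GaussDyadic.val (d : GaussDyadic) : ℂ := ((d.1.1 : ℂ) + d.1.2 * Complex.I) / 2 ^ d.2

def GaussDyadic.add (d e : GaussDyadic) : GaussDyadic :=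
  ((d.1.1 * ((2 ^ e.2 : ℕ) : ℤ) + e.1.1 * ((2 ^ d.2 : ℕ) : ℤ),
    d.1.2 * ((2 ^ e.2 : ℕ) : ℤ) + e.1.2 * ((2 ^ d.2 : ℕ) : ℤ)), d.2 + e.2)

def GaussDyadic.mul (d e : GaussDyadic) : GaussDyadic :=
  ((d.1.1 * e.1.1 - d.1.2 * e.1.2, d.1.1 * e.1.2 + d.1.2 * e.1.1), d.2 + e.2)

def GaussDyadic.conj (d : GaussDyadic) : GaussDyadic := ((d.1.1, -d.1.2), d.2)

namespace GaussDyadic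

theorem val_add (d e : GaussDyadic) : (d.add e).val = d.val + e.val := by
  simp only [val, add]
  push_cast
  field_simp
  ring

theorem val_mul (d e : GaussDyadic) : (d.mul e).val = d.val * e.val := by
  simp only [val, mul]
  push_cast
  rw [pow_add, div_mul_div_comm]
  congr 1
  linear_combination (-(d.1.2 : ℂ) * e.1.2) * Complex.I_sq

theorem val_conj (d : GaussDyadic) : d.conj.val = star d.val := by
  simp [val, conj]

theorem val_re (d : GaussDyadic) : d.val.re = d.1.1 / 2 ^ d.2 := by
  have : d.val = (((d.1.1 / 2 ^ d.2 : ℝ)) : ℂ) + ((d.1.2 / 2 ^ d.2 : ℝ) : ℂ) * Complex.I := by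
    simp only [val]; push_cast; ring
  rw [this]; simp [-Complex.ofReal_div]

theorem val_im (d : GaussDyadic) : d.val.im = d.1.2 / 2 ^ d.2 := by
  have : d.val = (((d.1.1 / 2 ^ d.2 : ℝ)) : ℂ) + ((d.1.2 / 2 ^ d.2 : ℝ) : ℂ) * Complex.I := by
    simp only [val]; push_cast; ring
  rw [this]; simp [-Complex.ofReal_div]

theorem norm_val_le (d : GaussDyadic) : ‖d.val‖ ≤ ((d.1.1.natAbs + d.1.2.natAbs : ℕ) : ℝ) := by
  have h1 : (1 : ℝ) ≤ 2 ^ d.2 := one_le_pow₀ (by norm_num)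
  refine (Complex.norm_le_abs_re_add_abs_im _).trans ?_
  rw [val_re, val_im, abs_div, abs_div, abs_of_pos (by positivity : (0 : ℝ) < 2 ^ d.2)]
  push_cast [Nat.cast_natAbs]
  gcongr <;> exact div_le_self (abs_nonneg _) h1

section
variable {α : Type*} [Primcodable α]

@[fun_prop] theorem computable_add {f g : α → GaussDyadic} (hf : Computable f)
    (hg : Computable g) : Computable (fun a => (f a).add (g a)) := by
  unfold add; fun_prop

@[fun_prop] theorem computable_mul {f g : α → GaussDyadic} (hf : Computable f)
    (hg : Computable g) : Computable (fun a => (f a).mul (g a)) := by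
  unfold mul; fun_prop

@[fun_prop] theorem computable_conj {f : α → GaussDyadic} (hf : Computable f) :
    Computable (fun a => (f a).conj) := by
  unfold conj; fun_prop

end

end GaussDyadic

section
variable {α β : Type*} [Primcodable α] [Primcodable β]

/-- Dyadic approximations of `f a` with any given precision are computable from `a`. -/
def CompC (f : α → ℂ) : Prop :=
  ∃ g : α → ℕ → GaussDyadic, Computable (fun p : α × ℕ => g p.1 p.2) ∧
    ∀ a n, ‖f a - (g a n).val‖ ≤ (1 / 2) ^ n

theorem CompC.of_eq {f f' : α → ℂ} (hf : CompC f) (h : ∀ a, f a = f' a) : CompC f' := by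
  rwa [← funext h]

theorem CompC.comp {f : β → ℂ} (hf : CompC f) {h : α → β} (hh : Computable h) :
    CompC (fun a => f (h a)) := by
  obtain ⟨g, hg, hfg⟩ := hf
  exact ⟨fun a n => g (h a) n, by fun_prop, fun a n => hfg _ n⟩

theorem compC_val {g : α → GaussDyadic} (hg : Computable g) : CompC (fun a => (g a).val) :=
  ⟨fun a _ => g a, by fun_prop, fun a n => by simp⟩

theorem compC_natCast {g : α → ℕ} (hg : Computable g) : CompC (fun a => (g a : ℂ)) :=
  (compC_val (g := fun a => (((g a : ℤ), 0), 0)) (by fun_prop)).of_eq fun a => by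
    simp [GaussDyadic.val]

theorem CompC.ite {p : α → Prop} [∀ a, Decidable (p a)] {f f' : α → ℂ}
    (hp : Computable (fun a => decide (p a))) (hf : CompC f) (hf' : CompC f') :
    CompC (fun a => if p a then f a else f' a) := by
  obtain ⟨g, hg, hfg⟩ := hf
  obtain ⟨g', hg', hfg'⟩ := hf'
  refine ⟨fun a n => if p a then g a n else g' a n,
    computable_ite (hp.comp Computable.fst) hg hg', fun a n => ?_⟩
  by_cases h : p a
  · simpa [h] using hfg a n
  · simpa [h] using hfg' a n

theorem CompC.star {f : α → ℂ} (hf : CompC f) : CompC (fun a => star (f a)) := by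
  obtain ⟨g, hg, hfg⟩ := hf
  refine ⟨fun a n => (g a n).conj, by fun_prop, fun a n => ?_⟩
  rw [GaussDyadic.val_conj, ← star_sub, norm_star]
  exact hfg a n

/-- Since N ≤ 2 ^ N, taking N extra bits absorbs an error that occurs N times. -/
theorem natCast_mul_half_pow_le (n N : ℕ) : (N : ℝ) * (1 / 2) ^ (n + N) ≤ (1 / 2) ^ n := by
  have h : (N : ℝ) ≤ 2 ^ N := by exact_mod_cast N.lt_two_pow_self.le
  rw [pow_add, mul_comm, mul_assoc]
  refine mul_le_of_le_one_right (by positivity) ?_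
  rw [one_div, inv_pow, inv_mul_le_iff₀ (by positivity), mul_one]
  exact h

theorem CompC.sum_range {f : α → ℕ → ℂ} (hf : CompC (fun p : α × ℕ => f p.1 p.2)) {N : α → ℕ}
    (hN : Computable N) : CompC (fun a => ∑ i ∈ Finset.range (N a), f a i) := by
  obtain ⟨g, hg, hfg⟩ := hf
  refine ⟨fun a n => Nat.rec (motive := fun _ => GaussDyadic) ((0, 0), 0)
    (fun i s => s.add (g (a, i) (n + N a))) (N a), by fun_prop, fun a n => ?_⟩
  have key : ∀ k M : ℕ, ‖∑ i ∈ Finset.range M, f a i - GaussDyadic.val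
      (Nat.rec (motive := fun _ => GaussDyadic) ((0, 0), 0) (fun i s => s.add (g (a, i) k)) M)‖
      ≤ M * (1 / 2) ^ k := by
    intro k M
    induction M with
    | zero => simp [GaussDyadic.val]
    | succ M ih =>
      rw [Finset.sum_range_succ, GaussDyadic.val_add, add_sub_add_comm]
      refine (norm_add_le _ _).trans ?_
      push_cast
      rw [add_mul, one_mul]
      exact add_le_add ih (hfg (a, M) k)
  exact (key _ _).trans (natCast_mul_half_pow_le n (N a))

/-- Exchange the factors one at a time; each exchange costs at most ε times the bound on the
remaining factors. -/
theorem norm_prod_sub_prod_le {x y : ℕ → ℂ} {B ε : ℝ} (hB : 1 ≤ B) (hε : 0 ≤ ε) :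
    ∀ N : ℕ, (∀ i < N, ‖x i‖ ≤ B ∧ ‖y i‖ ≤ B ∧ ‖x i - y i‖ ≤ ε) →
      ‖∏ i ∈ Finset.range N, x i - ∏ i ∈ Finset.range N, y i‖ ≤ N * B ^ N * ε := by
  intro N h
  induction N with
  | zero => simp
  | succ N ih =>
    have h1 := ih fun i hi => h i (by omega)
    obtain ⟨h2, -, h4⟩ := h N (by omega)
    have h5 : ‖∏ i ∈ Finset.range N, y i‖ ≤ B ^ N := by
      rw [norm_prod]
      refine (Finset.prod_le_prod (fun _ _ => norm_nonneg _) fun i hi =>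
        (h i (by simp at hi; omega)).2.1).trans (by simp)
    rw [Finset.prod_range_succ, Finset.prod_range_succ]
    have e : (∏ i ∈ Finset.range N, x i) * x N - (∏ i ∈ Finset.range N, y i) * y N =
      (∏ i ∈ Finset.range N, x i - ∏ i ∈ Finset.range N, y i) * x N +
        (∏ i ∈ Finset.range N, y i) * (x N - y N) := by ring
    rw [e]
    refine (norm_add_le _ _).trans ?_
    rw [norm_mul, norm_mul]
    calc _ ≤ (N * B ^ N * ε) * B + B ^ N * ε := by gcongr
      _ ≤ (N * B ^ N * ε) * B + (B ^ N * ε) * B := by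
        exact add_le_add_right (le_mul_of_one_le_right (by positivity) hB) _
      _ = _ := by push_cast; ring

theorem CompC.prod_range {f : α → ℕ → ℂ} (hf : CompC (fun p : α × ℕ => f p.1 p.2)) {N : α → ℕ}
    (hN : Computable N) : CompC (fun a => ∏ i ∈ Finset.range (N a), f a i) := by
  obtain ⟨g, hg, hfg⟩ := hf
  -- Approximations with error 1 give a computable bound. Of the summand 2, one unit covers the step
  -- to the exact factors and one the step back to finer approximations.
  let B : α → ℕ := fun a =>
    2 + ∑ i ∈ Finset.range (N a), ((g (a, i) 0).1.1.natAbs + (g (a, i) 0).1.2.natAbs)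
  have hB : Computable B := by unfold B; fun_prop
  -- The error is amplified by at most N * B ^ N ≤ 2 ^ (N + N * B), hence the number of extra bits.
  refine ⟨fun a n => Nat.rec (motive := fun _ => GaussDyadic) ((1, 0), 0)
    (fun i s => s.mul (g (a, i) (n + (N a + N a * B a)))) (N a), by fun_prop, fun a n => ?_⟩
  have hval : ∀ k M : ℕ, GaussDyadic.val
      (Nat.rec (motive := fun _ => GaussDyadic) ((1, 0), 0) (fun i s => s.mul (g (a, i) k)) M) =
      ∏ i ∈ Finset.range M, (g (a, i) k).val := by
    intro k M
    induction M with
    | zero => simp [GaussDyadic.val]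
    | succ M ih => rw [Finset.prod_range_succ, GaussDyadic.val_mul, ih]
  rw [hval]
  have hb : ∀ i < N a, ‖f a i‖ ≤ (B a : ℝ) - 1 := by
    intro i hi
    have h1 := (g (a, i) 0).norm_val_le
    have h2 : (g (a, i) 0).1.1.natAbs + (g (a, i) 0).1.2.natAbs ≤ B a - 2 := by
      have := Finset.single_le_sum (f := fun i => (g (a, i) 0).1.1.natAbs +
        (g (a, i) 0).1.2.natAbs) (fun _ _ => Nat.zero_le _) (Finset.mem_range.2 hi)
      simp only [B]; omega
    have h3 : (((g (a, i) 0).1.1.natAbs + (g (a, i) 0).1.2.natAbs : ℕ) : ℝ) + 2 ≤ B a := by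
      have : 2 ≤ B a := by simp [B]
      exact_mod_cast (by omega : (g (a, i) 0).1.1.natAbs + (g (a, i) 0).1.2.natAbs + 2 ≤ B a)
    have h4 := hfg (a, i) 0
    have h5 := norm_sub_norm_le (f a i) (g (a, i) 0).val
    simp only [pow_zero] at h4
    linarith
  have hB2 : (2 : ℝ) ≤ B a := by simp [B]; positivity
  refine (norm_prod_sub_prod_le (B := B a) (ε := (1 / 2) ^ (n + (N a + N a * B a)))
    (by linarith) (by positivity) (N a) fun i hi => ⟨by linarith [hb i hi], ?_, hfg (a, i) _⟩).trans ?_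
  · have h1 := hfg (a, i) (n + (N a + N a * B a))
    have h2 : ((1 : ℝ) / 2) ^ (n + (N a + N a * B a)) ≤ 1 :=
      pow_le_one₀ (by norm_num) (by norm_num)
    have h3 := norm_sub_norm_le (g (a, i) (n + (N a + N a * B a))).val (f a i)
    rw [norm_sub_rev] at h3
    linarith [hb i hi]
  · have h1 : (N a : ℝ) ≤ 2 ^ N a := by exact_mod_cast (N a).lt_two_pow_self.le
    have h2 : (B a : ℝ) ≤ 2 ^ B a := by exact_mod_cast (B a).lt_two_pow_self.le
    calc (N a : ℝ) * (B a : ℝ) ^ N a * (1 / 2) ^ (n + (N a + N a * B a))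
        ≤ 2 ^ N a * (2 ^ B a) ^ N a * (1 / 2) ^ (n + (N a + N a * B a)) := by gcongr
      _ = (1 / 2) ^ n * ((2 * (1 / 2)) ^ N a * (2 * (1 / 2)) ^ (N a * B a)) := by
        rw [← pow_mul, pow_add, pow_add, mul_pow, mul_pow, mul_comm (B a)]; ring
      _ = (1 / 2) ^ n := by norm_num

theorem CompC.mul {f g : α → ℂ} (hf : CompC f) (hg : CompC g) : CompC (fun a => f a * g a) := by
  have h : CompC (fun p : α × ℕ => if p.2 = 0 then f p.1 else g p.1) :=
    CompC.ite (by fun_prop) (hf.comp Computable.fst) (hg.comp Computable.fst)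
  exact (CompC.prod_range (f := fun a i => if i = 0 then f a else g a) h
    (computable_const 2)).of_eq fun a => by simp [Finset.prod_range_succ]

open Classical in
-- The promised gap between 1/2 and 1 makes the comparison decidable: an approximation with error
-- 1/8 is compared with 3/4.
theorem CompC.computable_decide {f : α → ℂ} (hf : CompC f)
    (h : ∀ a, (f a).re ≤ 1 / 2 ∨ 1 ≤ (f a).re) : Computable (fun a => decide (1 ≤ (f a).re)) := by
  obtain ⟨g, hg, hfg⟩ := hf
  have : Computable (fun a => decide (3 * ((2 ^ (g a 3).2 : ℕ) : ℤ) ≤ 4 * (g a 3).1.1)) := by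
    fun_prop
  refine this.of_eq fun a => ?_
  have h1 := (Complex.abs_re_le_norm _).trans (hfg a 3)
  rw [Complex.sub_re, GaussDyadic.val_re, abs_le] at h1
  rw [decide_eq_decide]
  have h2 : (3 * ((2 ^ (g a 3).2 : ℕ) : ℤ) ≤ 4 * (g a 3).1.1) ↔
      (3 / 4 : ℝ) ≤ (g a 3).1.1 / 2 ^ (g a 3).2 := by
    rw [le_div_iff₀ (by positivity), ← Int.cast_le (R := ℝ)]
    push_cast
    constructor <;> intro h <;> linarith
  rw [h2]
  have h3 : ((1 : ℝ) / 2) ^ 3 = 1 / 8 := by norm_num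
  rw [h3] at h1
  rcases h a with h | h <;> constructor <;> intro h' <;> linarith

end

end NoisyQMA

namespace NoisyQMA

/-! ## Approximating algebraic numbers -/

def evalDyadic (l : List ℤ) (u : GaussDyadic) : GaussDyadic :=
  l.foldr (fun a v => GaussDyadic.add ((a, 0), 0) (GaussDyadic.mul u v)) ((0, 0), 0)

theorem val_evalDyadic (r : AlgebraicCode) (u : GaussDyadic) :
    (evalDyadic r.1 u).val = r.evalPoly u.val := by
  unfold evalDyadic AlgebraicCode.evalPoly
  induction r.1 with
  | nil => simp [GaussDyadic.val]
  | cons a l ih =>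
    rw [List.foldr_cons, List.foldr_cons, GaussDyadic.val_add, GaussDyadic.val_mul, ih]
    simp [GaussDyadic.val]

/-- A bound on the polynomial on the disc of radius `R`, and a Lipschitz constant. -/
def boundAndLipschitz (R : ℕ) (l : List ℤ) : ℕ × ℕ :=
  l.foldr (fun a s => (a.natAbs + R * s.1, s.1 + R * s.2)) (0, 0)

theorem norm_evalPoly_sub_le (r : AlgebraicCode) (R : ℕ) {y z : ℂ} (hy : ‖y‖ ≤ R) (hz : ‖z‖ ≤ R) :
    ‖r.evalPoly y - r.evalPoly z‖ ≤ (boundAndLipschitz R r.1).2 * ‖y - z‖ := by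
  unfold AlgebraicCode.evalPoly boundAndLipschitz
  -- The induction follows Horner's scheme; the Lipschitz bound for a longer list uses the bound on
  -- the value for the shorter one.
  suffices h : ∀ l : List ℤ,
      ‖l.foldr (fun (a : ℤ) v => (a : ℂ) + z * v) 0‖ ≤
        (l.foldr (fun (a : ℤ) (s : ℕ × ℕ) => (a.natAbs + R * s.1, s.1 + R * s.2)) (0, 0)).1 ∧
      ‖l.foldr (fun (a : ℤ) v => (a : ℂ) + y * v) 0 -
        l.foldr (fun (a : ℤ) v => (a : ℂ) + z * v) 0‖ ≤
        (l.foldr (fun (a : ℤ) (s : ℕ × ℕ) => (a.natAbs + R * s.1, s.1 + R * s.2)) (0, 0)).2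
          * ‖y - z‖ from (h r.1).2
  intro l
  induction l with
  | nil => simp
  | cons a l ih =>
    obtain ⟨h1, h2⟩ := ih
    simp only [List.foldr_cons]
    generalize l.foldr (fun (a : ℤ) v => (a : ℂ) + z * v) 0 = vz at *
    generalize l.foldr (fun (a : ℤ) v => (a : ℂ) + y * v) 0 = vy at *
    generalize l.foldr (fun (a : ℤ) (s : ℕ × ℕ) => (a.natAbs + R * s.1, s.1 + R * s.2)) (0, 0) = s
      at *
    constructor
    · refine (norm_add_le _ _).trans ?_
      rw [norm_mul, Complex.norm_intCast]
      push_cast [Nat.cast_natAbs]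
      gcongr
    · have e : (a : ℂ) + y * vy - (a + z * vz) = (y - z) * vz + y * (vy - vz) := by ring
      rw [e]
      refine (norm_add_le _ _).trans ?_
      rw [norm_mul, norm_mul]
      push_cast
      calc ‖y - z‖ * ‖vz‖ + ‖y‖ * ‖vy - vz‖ ≤ ‖y - z‖ * s.1 + R * (s.2 * ‖y - z‖) := by gcongr
        _ = _ := by ring

theorem continuous_evalPoly (r : AlgebraicCode) : Continuous r.evalPoly := by
  unfold AlgebraicCode.evalPoly
  induction r.1 with
  | nil => exact continuous_const
  | cons a l ih => exact continuous_const.add (continuous_id.mul ih)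

namespace AlgebraicCode

/-- The rectangle lies in the square with this half side length. -/
def radius (r : AlgebraicCode) : ℕ :=
  r.2.1.1.natAbs + r.2.1.2.natAbs + r.2.2.1.1.natAbs + r.2.2.1.2.natAbs + 1

/-- The points of a grid with mesh `1 / 2 ^ k`. -/
def gridPoint (r : AlgebraicCode) (k s t : ℕ) : GaussDyadic :=
  (((s : ℤ) - ((r.radius * 2 ^ k : ℕ) : ℤ), (t : ℤ) - ((r.radius * 2 ^ k : ℕ) : ℤ)), k)

/-- `u` is close to the rectangle. -/
def isNear (r : AlgebraicCode) (u : GaussDyadic) : Bool :=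
  decide (r.2.1.1 * ((2 ^ u.2 : ℕ) : ℤ) ≤ (u.1.1 + 1) * ((r.2.2.2 + 1 : ℕ) : ℤ)) &&
  decide ((u.1.1 - 1) * ((r.2.2.2 + 1 : ℕ) : ℤ) ≤ r.2.1.2 * ((2 ^ u.2 : ℕ) : ℤ)) &&
  decide (r.2.2.1.1 * ((2 ^ u.2 : ℕ) : ℤ) ≤ (u.1.2 + 1) * ((r.2.2.2 + 1 : ℕ) : ℤ)) &&
  decide ((u.1.2 - 1) * ((r.2.2.2 + 1 : ℕ) : ℤ) ≤ r.2.2.1.2 * ((2 ^ u.2 : ℕ) : ℤ))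

/-- The disc of radius `2 * r.radius` contains the whole grid, whose points have coordinates of
absolute value at most `r.radius`. -/
def lipschitz (r : AlgebraicCode) : ℕ := (boundAndLipschitz (2 * r.radius) r.1).2

/-- The value of the polynomial at `u` is small. -/
def isSmall (r : AlgebraicCode) (u : GaussDyadic) : Bool :=
  decide (((evalDyadic r.1 u).1.1.natAbs ^ 2 + (evalDyadic r.1 u).1.2.natAbs ^ 2) * 4 ^ u.2 ≤
    (2 * r.lipschitz) ^ 2 * 4 ^ (evalDyadic r.1 u).2)

/-- If `(s, t)` is an approximate root, then it is close to `c.2`. -/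
def isHarmless (r : AlgebraicCode) (n : ℕ) (c : ℕ × ℕ × ℕ) (s t : ℕ) : Bool :=
  (!(r.isNear (r.gridPoint c.1 s t) && r.isSmall (r.gridPoint c.1 s t))) ||
    decide ((s - c.2.1 + (c.2.1 - s) + (t - c.2.2 + (c.2.2 - t))) * 2 ^ (n + 1) ≤ 2 ^ c.1)

def gridSize (r : AlgebraicCode) (k : ℕ) : ℕ := 2 * r.radius * 2 ^ k + 1

/-- All approximate roots of fineness `c.1` are close to the grid point `c.2`. -/
def certifies (r : AlgebraicCode) (n : ℕ) (c : ℕ × ℕ × ℕ) : Bool :=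
  decide (n + 2 ≤ c.1) &&
  decide (∀ i, i < r.gridSize c.1 * r.gridSize c.1 →
    r.isHarmless n c (i / r.gridSize c.1) (i % r.gridSize c.1) = true)

section
variable {α : Type*} [Primcodable α] {r : α → AlgebraicCode}

@[fun_prop] theorem computable_radius (hr : Computable r) : Computable (fun a => (r a).radius) := by
  unfold radius; fun_prop

@[fun_prop] theorem computable_gridPoint (hr : Computable r) {k s t : α → ℕ} (hk : Computable k)
    (hs : Computable s) (ht : Computable t) :
    Computable (fun a => (r a).gridPoint (k a) (s a) (t a)) := by
  unfold gridPoint; fun_prop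

@[fun_prop] theorem computable_isNear (hr : Computable r) {u : α → GaussDyadic}
    (hu : Computable u) : Computable (fun a => (r a).isNear (u a)) := by
  unfold isNear; fun_prop

@[fun_prop] theorem computable_lipschitz (hr : Computable r) :
    Computable (fun a => (r a).lipschitz) := by
  unfold lipschitz boundAndLipschitz; fun_prop

@[fun_prop] theorem computable_isSmall (hr : Computable r) {u : α → GaussDyadic}
    (hu : Computable u) : Computable (fun a => (r a).isSmall (u a)) := by
  unfold isSmall evalDyadic; fun_prop

@[fun_prop] theorem computable_gridSize (hr : Computable r) {k : α → ℕ} (hk : Computable k) :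
    Computable (fun a => (r a).gridSize (k a)) := by
  unfold gridSize; fun_prop

@[fun_prop] theorem computable_isHarmless (hr : Computable r) {n : α → ℕ} (hn : Computable n)
    {c : α → ℕ × ℕ × ℕ} (hc : Computable c) {s t : α → ℕ} (hs : Computable s)
    (ht : Computable t) : Computable (fun a => (r a).isHarmless (n a) (c a) (s a) (t a)) := by
  unfold isHarmless; fun_prop

@[fun_prop] theorem computable_certifies (hr : Computable r) {n : α → ℕ} (hn : Computable n)
    {c : α → ℕ × ℕ × ℕ} (hc : Computable c) :
    Computable (fun a => (r a).certifies (n a) (c a)) := by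
  unfold certifies
  refine computable_and (by fun_prop) (computable_decide_forall_lt
    (p := fun a i => (r a).isHarmless (n a) (c a) (i / (r a).gridSize (c a).1)
      (i % (r a).gridSize (c a).1) = true) (by fun_prop) ?_)
  exact computable_decide_eq (computable_isHarmless (by fun_prop) (by fun_prop) (by fun_prop)
    (by fun_prop) (by fun_prop)) (by fun_prop)

end

theorem certifies_iff (r : AlgebraicCode) (n : ℕ) (c : ℕ × ℕ × ℕ) :
    r.certifies n c = true ↔ n + 2 ≤ c.1 ∧ ∀ s < r.gridSize c.1, ∀ t < r.gridSize c.1,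
      r.isHarmless n c s t = true := by
  simp only [certifies, Bool.and_eq_true, decide_eq_true_eq]
  refine and_congr_right fun _ => ⟨fun h s hs t ht => ?_, fun h i hi => ?_⟩
  · have := h (s * r.gridSize c.1 + t) (by nlinarith)
    have hpos : 0 < r.gridSize c.1 := by omega
    rwa [mul_comm, Nat.mul_add_div hpos, Nat.mul_add_mod, Nat.div_eq_of_lt ht, Nat.mod_eq_of_lt ht,
      add_zero] at this
  · have hpos : 0 < r.gridSize c.1 := Nat.pos_of_ne_zero fun h0 => by simp [h0] at hi
    exact h _ (Nat.div_lt_of_lt_mul hi) _ (Nat.mod_lt _ hpos)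

theorem isNear_iff (r : AlgebraicCode) (u : GaussDyadic) : r.isNear u = true ↔
    ((r.2.1.1 : ℝ) / (r.2.2.2 + 1) ≤ u.val.re + (1 / 2) ^ u.2 ∧
      u.val.re - (1 / 2) ^ u.2 ≤ (r.2.1.2 : ℝ) / (r.2.2.2 + 1)) ∧
    ((r.2.2.1.1 : ℝ) / (r.2.2.2 + 1) ≤ u.val.im + (1 / 2) ^ u.2 ∧
      u.val.im - (1 / 2) ^ u.2 ≤ (r.2.2.1.2 : ℝ) / (r.2.2.2 + 1)) := by
  have key1 : ∀ a x : ℤ, (a * ((2 ^ u.2 : ℕ) : ℤ) ≤ (x + 1) * ((r.2.2.2 + 1 : ℕ) : ℤ)) ↔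
      ((a : ℝ) / (r.2.2.2 + 1) ≤ x / 2 ^ u.2 + (1 / 2) ^ u.2) := by
    intro a x
    rw [one_div, inv_pow, ← one_div, ← add_div, div_le_div_iff₀ (by positivity) (by positivity),
      ← Int.cast_le (R := ℝ)]
    push_cast
    rfl
  have key2 : ∀ a x : ℤ, ((x - 1) * ((r.2.2.2 + 1 : ℕ) : ℤ) ≤ a * ((2 ^ u.2 : ℕ) : ℤ)) ↔
      ((x : ℝ) / 2 ^ u.2 - (1 / 2) ^ u.2 ≤ (a : ℝ) / (r.2.2.2 + 1)) := by
    intro a x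
    rw [one_div, inv_pow, ← one_div, ← sub_div, div_le_div_iff₀ (by positivity) (by positivity),
      ← Int.cast_le (R := ℝ)]
    push_cast
    rfl
  simp only [isNear, Bool.and_eq_true, decide_eq_true_eq, key1, key2, GaussDyadic.val_re,
    GaussDyadic.val_im]
  tauto

/-- The threshold is the Lipschitz constant times two mesh widths, so the grid point next to a root
always passes (`isSmall_nextPoint`). Squares and cleared denominators keep the test within the
integers. -/
theorem isSmall_iff (r : AlgebraicCode) (u : GaussDyadic) : r.isSmall u = true ↔
    ‖r.evalPoly u.val‖ ≤ 2 * r.lipschitz * (1 / 2) ^ u.2 := by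
  rw [← val_evalDyadic]
  generalize hd : evalDyadic r.1 u = d
  simp only [isSmall, decide_eq_true_eq, hd]
  have h1 : ‖d.val‖ ^ 2 = ((d.1.1 : ℝ) ^ 2 + (d.1.2 : ℝ) ^ 2) / 4 ^ d.2 := by
    rw [← Complex.normSq_eq_norm_sq, Complex.normSq_apply, GaussDyadic.val_re, GaussDyadic.val_im,
      show (4 : ℝ) = 2 ^ 2 by norm_num, ← pow_mul, mul_comm 2, pow_mul]
    ring
  have h2 : (2 * (r.lipschitz : ℝ) * (1 / 2) ^ u.2) ^ 2 = (2 * r.lipschitz) ^ 2 / 4 ^ u.2 := by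
    rw [mul_pow _ _ 2, ← pow_mul, mul_comm u.2 2, pow_mul,
      show ((1 : ℝ) / 2) ^ 2 = 1 / 4 by norm_num, one_div, inv_pow, ← div_eq_mul_inv]
  rw [← sq_le_sq₀ (norm_nonneg _) (by positivity), h1, h2,
    div_le_div_iff₀ (by positivity) (by positivity), ← Nat.cast_le (α := ℝ)]
  push_cast [Nat.cast_natAbs, sq_abs]
  rfl

/-- The grid point next to a point of the rectangle. -/
noncomputable def nextIndex (r : AlgebraicCode) (k : ℕ) (x : ℝ) : ℕ := (⌊x * 2 ^ k⌋ + ((r.radius * 2 ^ k : ℕ) : ℤ)).toNat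

theorem nextIndex_spec (r : AlgebraicCode) (k : ℕ) {x : ℝ} (hx : |x| ≤ r.radius) :
    r.nextIndex k x < r.gridSize k ∧
    (((r.nextIndex k x : ℤ) - ((r.radius * 2 ^ k : ℕ) : ℤ) : ℤ) : ℝ) / 2 ^ k ≤ x ∧
    x ≤ (((r.nextIndex k x : ℤ) - ((r.radius * 2 ^ k : ℕ) : ℤ) : ℤ) : ℝ) / 2 ^ k + (1 / 2) ^ k := by
  have hp : (0 : ℝ) < 2 ^ k := by positivity
  rw [abs_le] at hx
  have h1 : -((r.radius * 2 ^ k : ℕ) : ℤ) ≤ ⌊x * 2 ^ k⌋ := by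
    rw [Int.le_floor]; push_cast; nlinarith
  have h2 : ⌊x * 2 ^ k⌋ ≤ ((r.radius * 2 ^ k : ℕ) : ℤ) := by
    have : (⌊x * 2 ^ k⌋ : ℝ) ≤ ((r.radius * 2 ^ k : ℕ) : ℤ) := by
      refine (Int.floor_le _).trans ?_
      push_cast; nlinarith
    exact_mod_cast this
  have h3 : (r.nextIndex k x : ℤ) - ((r.radius * 2 ^ k : ℕ) : ℤ) = ⌊x * 2 ^ k⌋ := by
    unfold nextIndex; omega
  refine ⟨?_, ?_, ?_⟩
  · have : r.gridSize k = 2 * (r.radius * 2 ^ k) + 1 := by unfold gridSize; ring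
    omega
  · rw [h3, div_le_iff₀ hp]
    exact Int.floor_le _
  · rw [h3, one_div, inv_pow, ← one_div, ← add_div, le_div_iff₀ hp]
    exact (Int.lt_floor_add_one _).le

theorem abs_le_radius (r : AlgebraicCode) {z : ℂ} (hz : r.InRectangle z) :
    |z.re| ≤ r.radius ∧ |z.im| ≤ r.radius := by
  obtain ⟨h1, h2, h3, h4⟩ := hz
  have key : ∀ a : ℤ, |(a : ℝ) / (r.2.2.2 + 1)| ≤ a.natAbs := by
    intro a
    rw [abs_div, abs_of_pos (by positivity : (0 : ℝ) < r.2.2.2 + 1), Nat.cast_natAbs, Int.cast_abs]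
    exact div_le_self (abs_nonneg _) (by simp)
  have k1 := abs_le.1 (key r.2.1.1)
  have k2 := abs_le.1 (key r.2.1.2)
  have k3 := abs_le.1 (key r.2.2.1.1)
  have k4 := abs_le.1 (key r.2.2.1.2)
  have p : ∀ a : ℤ, (0 : ℝ) ≤ a.natAbs := fun a => by positivity
  have p1 := p r.2.1.1
  have p2 := p r.2.1.2
  have p3 := p r.2.2.1.1
  have p4 := p r.2.2.1.2
  unfold radius
  push_cast only [Nat.cast_add, Nat.cast_one]
  constructor <;> rw [abs_le] <;> constructor <;> linarith

noncomputable def nextPoint (r : AlgebraicCode) (k : ℕ) (z : ℂ) : GaussDyadic :=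
  r.gridPoint k (r.nextIndex k z.re) (r.nextIndex k z.im)

theorem norm_nextPoint_sub_le (r : AlgebraicCode) (k : ℕ) {z : ℂ} (hz : r.InRectangle z) :
    ‖(r.nextPoint k z).val - z‖ ≤ 2 * (1 / 2) ^ k := by
  obtain ⟨h1, h2⟩ := r.abs_le_radius hz
  obtain ⟨-, a1, a2⟩ := r.nextIndex_spec k h1
  obtain ⟨-, b1, b2⟩ := r.nextIndex_spec k h2
  refine (Complex.norm_le_abs_re_add_abs_im _).trans ?_
  rw [Complex.sub_re, Complex.sub_im, GaussDyadic.val_re, GaussDyadic.val_im, two_mul]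
  refine add_le_add ?_ ?_
  · rw [abs_le]; simp only [nextPoint, gridPoint]; constructor <;> linarith
  · rw [abs_le]; simp only [nextPoint, gridPoint]; constructor <;> linarith

theorem isNear_nextPoint (r : AlgebraicCode) (k : ℕ) {z : ℂ} (hz : r.InRectangle z) :
    r.isNear (r.nextPoint k z) = true := by
  obtain ⟨h1, h2⟩ := r.abs_le_radius hz
  obtain ⟨-, a1, a2⟩ := r.nextIndex_spec k h1
  obtain ⟨-, b1, b2⟩ := r.nextIndex_spec k h2
  obtain ⟨c1, c2, c3, c4⟩ := hz
  rw [isNear_iff, GaussDyadic.val_re, GaussDyadic.val_im]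
  have : (0 : ℝ) < (1 / 2) ^ k := by positivity
  simp only [nextPoint, gridPoint]
  exact ⟨⟨by linarith, by linarith⟩, by linarith, by linarith⟩

theorem norm_le_of_mem_grid (r : AlgebraicCode) {k s t : ℕ} (hs : s < r.gridSize k)
    (ht : t < r.gridSize k) : ‖(r.gridPoint k s t).val‖ ≤ 2 * r.radius := by
  have key : ∀ s : ℕ, s < r.gridSize k →
      |(((s : ℤ) - ((r.radius * 2 ^ k : ℕ) : ℤ) : ℤ) : ℝ) / 2 ^ k| ≤ r.radius := by
    intro s hs
    have h : s ≤ 2 * (r.radius * 2 ^ k) := by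
      have : r.gridSize k = 2 * (r.radius * 2 ^ k) + 1 := by unfold gridSize; ring
      omega
    have h' : (s : ℝ) ≤ 2 * (r.radius * 2 ^ k) := by exact_mod_cast h
    rw [abs_div, abs_of_pos (by positivity : (0 : ℝ) < 2 ^ k), div_le_iff₀ (by positivity), abs_le]
    push_cast
    have : (0 : ℝ) ≤ s := by positivity
    constructor <;> linarith
  refine (Complex.norm_le_abs_re_add_abs_im _).trans ?_
  rw [GaussDyadic.val_re, GaussDyadic.val_im, two_mul]
  exact add_le_add (key s hs) (key t ht)

theorem isSmall_nextPoint (r : AlgebraicCode) (k : ℕ) {z : ℂ} (hz : r.Represents z) :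
    r.isSmall (r.nextPoint k z) = true := by
  obtain ⟨-, h0, h1, -⟩ := hz
  obtain ⟨a1, a2⟩ := r.abs_le_radius h1
  rw [isSmall_iff]
  have hz' : ‖z‖ ≤ ((2 * r.radius : ℕ) : ℝ) := by
    refine (Complex.norm_le_abs_re_add_abs_im _).trans ?_
    push_cast; linarith
  have hu : ‖(r.nextPoint k z).val‖ ≤ ((2 * r.radius : ℕ) : ℝ) := by
    push_cast
    exact r.norm_le_of_mem_grid (r.nextIndex_spec k a1).1 (r.nextIndex_spec k a2).1
  have := norm_evalPoly_sub_le r _ hu hz'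
  rw [h0, sub_zero] at this
  refine this.trans ?_
  calc _ ≤ (r.lipschitz : ℝ) * (2 * (1 / 2) ^ k) :=
        mul_le_mul_of_nonneg_left (r.norm_nextPoint_sub_le k h1) (Nat.cast_nonneg _)
    _ = _ := by simp only [nextPoint, gridPoint]; ring

theorem abs_gridPoint_sub (r : AlgebraicCode) (k s t s' t' : ℕ) :
    |(r.gridPoint k s t).val.re - (r.gridPoint k s' t').val.re| +
      |(r.gridPoint k s t).val.im - (r.gridPoint k s' t').val.im| =
      ((s - s' + (s' - s) + (t - t' + (t' - t)) : ℕ) : ℝ) * (1 / 2) ^ k := by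
  have key : ∀ s s' : ℕ, |(s : ℝ) - s'| = ((s - s' + (s' - s) : ℕ) : ℝ) := by
    intro s s'
    rcases le_total s s' with h | h
    · rw [abs_of_nonpos (by simpa using h)]
      push_cast [h, Nat.sub_eq_zero_of_le h]; ring
    · rw [abs_of_nonneg (by simpa using h)]
      push_cast [h, Nat.sub_eq_zero_of_le h]; ring
  have e : ∀ s s' : ℕ, (((s : ℤ) - ((r.radius * 2 ^ k : ℕ) : ℤ) : ℤ) : ℝ) / 2 ^ k -
      (((s' : ℤ) - ((r.radius * 2 ^ k : ℕ) : ℤ) : ℤ) : ℝ) / 2 ^ k =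
      ((s : ℝ) - s') * (1 / 2) ^ k := by
    intro s s'
    rw [one_div, inv_pow]; push_cast; ring
  rw [GaussDyadic.val_re, GaussDyadic.val_im, GaussDyadic.val_re, GaussDyadic.val_im]
  simp only [gridPoint]
  rw [e, e, abs_mul, abs_mul, key, key, abs_of_pos (by positivity : (0 : ℝ) < (1 / 2) ^ k),
    ← add_mul]
  push_cast
  rfl

theorem norm_gridPoint_sub (r : AlgebraicCode) (k s t s' t' : ℕ) :
    ‖(r.gridPoint k s t).val - (r.gridPoint k s' t').val‖ ≤
      ((s - s' + (s' - s) + (t - t' + (t' - t)) : ℕ) : ℝ) * (1 / 2) ^ k := by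
  rw [← abs_gridPoint_sub]
  exact Complex.norm_le_abs_re_add_abs_im _

/-- Soundness of certificates: the grid point next to z passes both tests, so it lies within
2^-(n+1) of the certified point. As `n + 2 ≤ c.1`, its distance of at most two mesh widths from z is
again at most 2^-(n+1). -/
theorem norm_sub_le_of_certifies (r : AlgebraicCode) {z : ℂ} (hz : r.Represents z) {n : ℕ}
    {c : ℕ × ℕ × ℕ} (hc : r.certifies n c = true) :
    ‖z - (r.gridPoint c.1 c.2.1 c.2.2).val‖ ≤ (1 / 2) ^ n := by
  obtain ⟨h1, h2⟩ := (r.certifies_iff n c).1 hc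
  obtain ⟨a1, a2⟩ := r.abs_le_radius hz.2.2.1
  have h3 := h2 _ (r.nextIndex_spec c.1 a1).1 _ (r.nextIndex_spec c.1 a2).1
  have h4 := r.isNear_nextPoint c.1 hz.2.2.1
  have h5 := r.isSmall_nextPoint c.1 hz
  have h6 := r.norm_nextPoint_sub_le c.1 hz.2.2.1
  unfold nextPoint at h4 h5 h6
  simp only [isHarmless, h4, h5, Bool.and_self, Bool.not_true, Bool.false_or,
    decide_eq_true_eq] at h3
  have h7 := r.norm_gridPoint_sub c.1 (r.nextIndex c.1 z.re) (r.nextIndex c.1 z.im) c.2.1 c.2.2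
  generalize r.nextIndex c.1 z.re - c.2.1 + (c.2.1 - r.nextIndex c.1 z.re) +
    (r.nextIndex c.1 z.im - c.2.2 + (c.2.2 - r.nextIndex c.1 z.im)) = d at *
  have h8 : (d : ℝ) * (1 / 2) ^ c.1 ≤ (1 / 2) ^ (n + 1) := by
    have : (d : ℝ) * 2 ^ (n + 1) ≤ 2 ^ c.1 := by exact_mod_cast h3
    rw [one_div, inv_pow, inv_pow, ← div_eq_mul_inv, div_le_iff₀ (by positivity),
      inv_mul_eq_div, le_div_iff₀ (by positivity)]
    exact this
  have h9 : 2 * ((1 : ℝ) / 2) ^ c.1 ≤ (1 / 2) ^ (n + 1) := by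
    calc 2 * ((1 : ℝ) / 2) ^ c.1 ≤ 2 * (1 / 2) ^ (n + 2) := by
          gcongr 2 * ?_
          exact pow_le_pow_of_le_one (by norm_num) (by norm_num) h1
      _ = (1 / 2) ^ (n + 1) := by ring
  rw [norm_sub_rev] at h6
  calc _ ≤ _ := norm_sub_le_norm_sub_add_norm_sub _
        (r.gridPoint c.1 (r.nextIndex c.1 z.re) (r.nextIndex c.1 z.im)).val _
    _ ≤ (1 / 2) ^ (n + 1) + (1 / 2) ^ (n + 1) := by linarith
    _ = _ := by ring

open Filter Topology in
-- The search ends, by compactness. If every fineness failed, there would be approximate roots that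
-- stay away from z. A limit of a subsequence would be a root in the rectangle, hence equal to z by
-- uniqueness.
theorem exists_certifies (r : AlgebraicCode) {z : ℂ} (hz : r.Represents z) (n : ℕ) :
    ∃ c, r.certifies n c = true := by
  by_contra! hcon
  have hex : ∀ k, ∃ u : GaussDyadic, u.2 = n + 2 + k ∧ ‖u.val‖ ≤ 2 * r.radius ∧
      r.isNear u = true ∧ r.isSmall u = true ∧ (1 / 2) ^ (n + 1) <
        |u.val.re - (r.nextPoint (n + 2 + k) z).val.re| +
        |u.val.im - (r.nextPoint (n + 2 + k) z).val.im| := by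
    intro k
    -- The candidate certificate is centred at the grid point next to z; its failure yields an
    -- approximate root far from that point.
    have hk := hcon (n + 2 + k, r.nextIndex (n + 2 + k) z.re, r.nextIndex (n + 2 + k) z.im)
    rw [ne_eq, certifies_iff] at hk
    push Not at hk
    obtain ⟨s, hs, t, ht, hst⟩ := hk (by simp)
    refine ⟨r.gridPoint (n + 2 + k) s t, rfl, r.norm_le_of_mem_grid hs ht, ?_⟩
    simp only [isHarmless, ne_eq, Bool.or_eq_true, not_or, Bool.not_eq_true', Bool.not_eq_false,
      Bool.and_eq_true, decide_eq_true_eq, not_le] at hst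
    refine ⟨hst.1.1, hst.1.2, ?_⟩
    rw [nextPoint, abs_gridPoint_sub]
    generalize (s - r.nextIndex (n + 2 + k) z.re + (r.nextIndex (n + 2 + k) z.re - s) +
      (t - r.nextIndex (n + 2 + k) z.im + (r.nextIndex (n + 2 + k) z.im - t))) = d at *
    have h : (2 : ℝ) ^ (n + 2 + k) < d * 2 ^ (n + 1) := by exact_mod_cast hst.2
    rw [one_div, inv_pow, inv_pow, ← div_eq_mul_inv, lt_div_iff₀ (by positivity),
      inv_mul_eq_div, div_lt_iff₀ (by positivity)]
    exact h
  choose u hu1 hu2 hu3 hu4 hu5 using hex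
  obtain ⟨w, -, φ, hφ, hw⟩ := (isCompact_closedBall (0 : ℂ) (2 * r.radius)).tendsto_subseq
    (x := fun k => (u k).val) fun k => by simpa using hu2 k
  have hε : Tendsto (fun k => ((1 : ℝ) / 2) ^ (n + 2 + φ k)) atTop (𝓝 0) :=
    (tendsto_pow_atTop_nhds_zero_of_lt_one (by norm_num) (by norm_num)).comp
      (tendsto_atTop_mono (fun k => Nat.le_add_left _ _) hφ.tendsto_atTop)
  have hnext : Tendsto (fun k => (r.nextPoint (n + 2 + φ k) z).val) atTop (𝓝 z) := by
    rw [tendsto_iff_norm_sub_tendsto_zero]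
    refine squeeze_zero (fun _ => norm_nonneg _)
      (fun k => r.norm_nextPoint_sub_le _ hz.2.2.1) ?_
    simpa using hε.const_mul 2
  have hwre : Tendsto (fun k => (u (φ k)).val.re) atTop (𝓝 w.re) :=
    (Complex.continuous_re.tendsto w).comp hw
  have hwim : Tendsto (fun k => (u (φ k)).val.im) atTop (𝓝 w.im) :=
    (Complex.continuous_im.tendsto w).comp hw
  have hrect : r.InRectangle w := by
    have h := fun k => (r.isNear_iff _).1 (hu3 (φ k))
    simp only [hu1] at h
    refine ⟨?_, ?_, ?_, ?_⟩
    · exact ge_of_tendsto' (by simpa using hwre.add hε) fun k => (h k).1.1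
    · exact le_of_tendsto' (by simpa using hwre.sub hε) fun k => (h k).1.2
    · exact ge_of_tendsto' (by simpa using hwim.add hε) fun k => (h k).2.1
    · exact le_of_tendsto' (by simpa using hwim.sub hε) fun k => (h k).2.2
  have hroot : r.evalPoly w = 0 := by
    have h := fun k => (r.isSmall_iff _).1 (hu4 (φ k))
    simp only [hu1] at h
    have h1 : Tendsto (fun k => ‖r.evalPoly (u (φ k)).val‖) atTop (𝓝 ‖r.evalPoly w‖) :=
      (((continuous_evalPoly r).tendsto w).comp hw).norm
    have h2 := le_of_tendsto_of_tendsto' h1 (hε.const_mul (2 * (r.lipschitz : ℝ))) h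
    rw [mul_zero] at h2
    exact norm_le_zero_iff.1 h2
  obtain rfl := hz.2.2.2 w hroot hrect
  have h1 := (hwre.sub ((Complex.continuous_re.tendsto w).comp hnext)).abs.add
    (hwim.sub ((Complex.continuous_im.tendsto w).comp hnext)).abs
  have h2 := ge_of_tendsto' h1 fun k => (hu5 (φ k)).le
  simp only [sub_self, abs_zero, add_zero] at h2
  have : (0 : ℝ) < (1 / 2) ^ (n + 1) := by positivity
  linarith

end AlgebraicCode

open AlgebraicCode in
theorem compC_of_represents {α : Type*} [Primcodable α] {r : α → AlgebraicCode}
    (hr : Computable r) {z : α → ℂ} (h : ∀ a, (r a).Represents (z a)) : CompC z := by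
  obtain ⟨c, hc, hcr⟩ := exists_computable_search (α := α × ℕ) (β := ℕ × ℕ × ℕ)
    (p := fun p c => (r p.1).certifies p.2 c = true)
    (computable_decide_eq (computable_certifies (by fun_prop) (by fun_prop) (by fun_prop))
      (by fun_prop)) fun p => (r p.1).exists_certifies (h p.1) p.2
  refine ⟨fun a n => (r a).gridPoint (c (a, n)).1 (c (a, n)).2.1 (c (a, n)).2.2, ?_,
    fun a n => norm_sub_le_of_certifies (r a) (h a) (hcr (a, n))⟩
  exact computable_gridPoint (by fun_prop) (by fun_prop) (by fun_prop) (by fun_prop)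

end NoisyQMA

namespace NoisyQMA

/-! ## Computable families of matrices -/

/-- The binary digits of a number. -/
def bitsOf (n s : ℕ) : Bits n := fun j => s.testBit j

theorem sum_bits {M : Type*} [AddCommMonoid M] (n : ℕ) (f : Bits n → M) :
    ∑ b, f b = ∑ u ∈ Finset.range (2 ^ n), f (bitsOf n u) := by
  rw [Finset.sum_range]
  have hb : Function.Bijective (fun u : Fin (2 ^ n) => bitsOf n u) := by
    rw [Fintype.bijective_iff_injective_and_card]
    refine ⟨fun u v h => Fin.ext (Nat.eq_of_testBit_eq fun i => ?_), by simp⟩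
    by_cases hi : i < n
    · exact congrFun h ⟨i, hi⟩
    · have h2 : 2 ^ n ≤ 2 ^ i := Nat.pow_le_pow_right (by norm_num) (not_lt.1 hi)
      rw [Nat.testBit_lt_two_pow (u.2.trans_le h2), Nat.testBit_lt_two_pow (v.2.trans_le h2)]
  exact (hb.sum_comp f).symm

theorem ofFn_bitsOf (n s : ℕ) : List.ofFn (bitsOf n s) = (List.range n).map s.testBit := by
  apply List.ext_getElem <;> simp [bitsOf]

/-- The restriction to the subspace in which the last `k` qubits are `0`. -/
def compress {m : ℕ} (k : ℕ) (X : Op (m + k)) : Op m := fun s t =>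
  X (Fin.append s fun _ => false) (Fin.append t fun _ => false)

/-- `Q ⊗ 1`, with `l` further qubits. -/
def ampliation {m : ℕ} (l : ℕ) (Q : Op m) : Op (m + l) := fun s t =>
  if ∀ j, s (Fin.natAdd m j) = t (Fin.natAdd m j) then
    Q (fun i => s (Fin.castAdd l i)) (fun i => t (Fin.castAdd l i)) else 0

/-- Digits are listed from the least significant one, so appended zeros are leading zeros; the
reduction discards the digits of s beyond the first m. -/
theorem append_bitsOf (m k s : ℕ) :
    Fin.append (bitsOf m s) (fun _ : Fin k => false) = bitsOf (m + k) (s % 2 ^ m) := by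
  funext j
  refine Fin.addCases (fun i => ?_) (fun i => ?_) j
  · simp [bitsOf, Nat.testBit_mod_two_pow]
  · simp [bitsOf, Nat.testBit_mod_two_pow]

/-! ### Matrix products as sums over paths -/

/-- The product `X (L - 1) * ... * X 0`. -/
def productUpTo {n : ℕ} (X : ℕ → Op n) : ℕ → Op n
  | 0 => 1
  | L + 1 => X L * productUpTo X L

theorem productUpTo_const {n : ℕ} (X : Op n) (L : ℕ) : productUpTo (fun _ => X) L = X ^ L := by
  induction L with
  | zero => simp [productUpTo]
  | succ L ih => rw [productUpTo, ih, pow_succ']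

theorem sum_range_mul {M : Type*} [AddCommMonoid M] (A B : ℕ) (f : ℕ → M) :
    ∑ t ∈ Finset.range (A * B), f t =
      ∑ d ∈ Finset.range B, ∑ t ∈ Finset.range A, f (t + A * d) := by
  induction B with
  | zero => simp
  | succ B ih =>
    rw [Finset.sum_range_succ, ← ih, Nat.mul_succ, Finset.sum_range_add]
    simp [add_comm]

/-- The entry of a product of matrices as a sum over paths; a path is the list of the digits of `t`
in base `N`. -/
noncomputable def pathSum (N : ℕ) (G : ℕ → ℕ → ℕ → ℂ) (L x y : ℕ) : ℂ :=
  ∑ t ∈ Finset.range (N ^ (L + 1)), if t / N ^ L % N = x ∧ t % N = y then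
    ∏ l ∈ Finset.range L, G l (t / N ^ (l + 1) % N) (t / N ^ l % N) else 0

theorem pathSum_zero (N : ℕ) (G : ℕ → ℕ → ℕ → ℂ) {x y : ℕ} (hx : x < N) :
    pathSum N G 0 x y = if x = y then 1 else 0 := by
  simp only [pathSum, zero_add, pow_one, pow_zero, Nat.div_one, Finset.range_zero,
    Finset.prod_empty]
  rw [Finset.sum_eq_single x]
  · simp [Nat.mod_eq_of_lt hx]
  · intro t ht htx
    rw [Nat.mod_eq_of_lt (Finset.mem_range.1 ht)]
    simp [htx]
  · intro h; exact absurd (Finset.mem_range.2 hx) h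

/-- Splitting off the leading digit of the path index fixes the endpoint x of the path; the digit
below it is the summation index u. -/
theorem pathSum_succ (N : ℕ) (G : ℕ → ℕ → ℕ → ℂ) (L : ℕ) {x y : ℕ} (hx : x < N) :
    pathSum N G (L + 1) x y = ∑ u ∈ Finset.range N, G L x u * pathSum N G L u y := by
  have hN : 0 < N := by omega
  -- A new leading digit does not change the lower ones.
  have hd : ∀ t d l, l ≤ L → (t + N ^ (L + 1) * d) / N ^ l % N = t / N ^ l % N := by
    intro t d l hl
    have : N ^ (L + 1) * d = N ^ l * (N * (N ^ (L - l) * d)) := by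
      rw [← mul_assoc, ← mul_assoc, ← pow_succ, ← pow_add]
      congr 2; omega
    rw [this, Nat.add_mul_div_left _ _ (by positivity), Nat.add_mul_mod_self_left]
  have h1 : pathSum N G (L + 1) x y = ∑ d ∈ Finset.range N, ∑ t ∈ Finset.range (N ^ (L + 1)),
      if d = x ∧ t % N = y then (∏ l ∈ Finset.range L, G l (t / N ^ (l + 1) % N) (t / N ^ l % N)) *
        G L d (t / N ^ L % N) else 0 := by
    rw [pathSum, pow_succ N (L + 1), sum_range_mul]
    refine Finset.sum_congr rfl fun d hdN => Finset.sum_congr rfl fun t ht => ?_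
    have e1 : (t + N ^ (L + 1) * d) / N ^ (L + 1) % N = d := by
      rw [Nat.add_mul_div_left _ _ (by positivity), Nat.div_eq_of_lt (Finset.mem_range.1 ht),
        zero_add, Nat.mod_eq_of_lt (Finset.mem_range.1 hdN)]
    have e2 : (t + N ^ (L + 1) * d) % N = t % N := by simpa using hd t d 0 (Nat.zero_le _)
    rw [e1, e2, Finset.prod_range_succ, e1, hd t d L le_rfl]
    refine if_congr Iff.rfl ?_ rfl
    congr 1
    refine Finset.prod_congr rfl fun l hl => ?_
    rw [hd _ _ _ (Finset.mem_range.1 hl), hd _ _ _ (Finset.mem_range.1 hl).le]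
  rw [h1, Finset.sum_eq_single x]
  · simp only [pathSum, Finset.mul_sum]
    rw [Finset.sum_comm]
    refine Finset.sum_congr rfl fun t _ => ?_
    rw [Finset.sum_eq_single (t / N ^ L % N)]
    · simp [mul_comm]
    · intro u _ hu
      simp [Ne.symm hu]
    · intro h; exact absurd (Finset.mem_range.2 (Nat.mod_lt _ hN)) h
  · intro d _ hdx
    simp [hdx]
  · intro h; exact absurd (Finset.mem_range.2 hx) h

theorem bitsOf_mod (n s : ℕ) : bitsOf n (s % 2 ^ n) = bitsOf n s := by
  funext j
  simp [bitsOf, Nat.testBit_mod_two_pow]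

theorem bitsOf_eq_iff (n s t : ℕ) : bitsOf n s = bitsOf n t ↔ s % 2 ^ n = t % 2 ^ n := by
  constructor
  · intro h
    refine Nat.eq_of_testBit_eq fun i => ?_
    rw [Nat.testBit_mod_two_pow, Nat.testBit_mod_two_pow]
    by_cases hi : i < n
    · simpa [hi, bitsOf] using congrFun h ⟨i, hi⟩
    · simp [hi]
  · intro h
    rw [← bitsOf_mod n s, h, bitsOf_mod]

/-- An entry of a product of variable length becomes one finite sum of finite products of numbers,
so `CompC.sum_range` and `CompC.prod_range` do the error analysis, and none is needed for a
recursion on matrices. -/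
theorem productUpTo_apply {n : ℕ} (X : ℕ → Op n) (L s t : ℕ) :
    productUpTo X L (bitsOf n s) (bitsOf n t) =
      pathSum (2 ^ n) (fun l u v => X l (bitsOf n u) (bitsOf n v)) L (s % 2 ^ n) (t % 2 ^ n) := by
  induction L generalizing s with
  | zero =>
    rw [pathSum_zero _ _ (Nat.mod_lt _ (by positivity)), productUpTo, Matrix.one_apply]
    exact if_congr (bitsOf_eq_iff n s t) rfl rfl
  | succ L ih =>
    rw [pathSum_succ _ _ _ (Nat.mod_lt _ (by positivity)), productUpTo, Matrix.mul_apply, sum_bits]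
    refine Finset.sum_congr rfl fun u hu => ?_
    rw [ih, bitsOf_mod, Nat.mod_eq_of_lt (Finset.mem_range.1 hu)]

section
variable {α β : Type*} [Primcodable α] [Primcodable β]

def digit (N l t : ℕ) : ℕ := t / N ^ l % N

@[fun_prop] theorem computable_digit {N l t : α → ℕ} (hN : Computable N) (hl : Computable l)
    (ht : Computable t) : Computable (fun a => digit (N a) (l a) (t a)) := by
  unfold digit; fun_prop

/-- The entries of `X a` are computable from `a` and the indices of row and column. -/
def CompMat {n : α → ℕ} (X : ∀ a, Op (n a)) : Prop :=
  CompC (fun p : α × ℕ × ℕ => X p.1 (bitsOf (n p.1) p.2.1) (bitsOf (n p.1) p.2.2))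

variable {n : α → ℕ} {X Y : ∀ a, Op (n a)}

theorem CompMat.comp (hX : CompMat X) {h : β → α} (hh : Computable h) :
    CompMat (fun b => X (h b)) :=
  CompC.comp hX (h := fun p : β × ℕ × ℕ => (h p.1, p.2.1, p.2.2)) (by fun_prop)

theorem CompMat.of_eq (hX : CompMat X) (h : ∀ a, X a = Y a) : CompMat Y := by
  rwa [← funext h]

theorem CompMat.mul (hn : Computable n) (hX : CompMat X) (hY : CompMat Y) :
    CompMat (fun a => X a * Y a) := by
  have h1 : CompC (fun q : (α × ℕ × ℕ) × ℕ =>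
      X q.1.1 (bitsOf (n q.1.1) q.1.2.1) (bitsOf (n q.1.1) q.2) *
      Y q.1.1 (bitsOf (n q.1.1) q.2) (bitsOf (n q.1.1) q.1.2.2)) :=
    CompC.mul (CompC.comp hX (h := fun q : (α × ℕ × ℕ) × ℕ => (q.1.1, q.1.2.1, q.2)) (by fun_prop))
      (CompC.comp hY (h := fun q : (α × ℕ × ℕ) × ℕ => (q.1.1, q.2, q.1.2.2)) (by fun_prop))
  refine (CompC.sum_range (f := fun (p : α × ℕ × ℕ) u =>
    X p.1 (bitsOf (n p.1) p.2.1) (bitsOf (n p.1) u) *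
      Y p.1 (bitsOf (n p.1) u) (bitsOf (n p.1) p.2.2)) h1
      (N := fun p => 2 ^ n p.1) (by fun_prop)).of_eq fun p => ?_
  change _ = (X p.1 * Y p.1) _ _
  rw [Matrix.mul_apply, sum_bits]

theorem CompMat.conjTranspose (hX : CompMat X) : CompMat (fun a => (X a)ᴴ) :=
  CompC.star (CompC.comp hX (h := fun p : α × ℕ × ℕ => (p.1, p.2.2, p.2.1)) (by fun_prop))

theorem CompMat.trace (hn : Computable n) (hX : CompMat X) : CompC (fun a => (X a).trace) := by
  refine (CompC.sum_range (f := fun a u => X a (bitsOf (n a) u) (bitsOf (n a) u))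
    (CompC.comp hX (h := fun q : α × ℕ => (q.1, q.2, q.2)) (by fun_prop))
      (N := fun a => 2 ^ n a) (by fun_prop)).of_eq fun a => ?_
  rw [Matrix.trace, sum_bits]
  rfl

theorem CompMat.productUpTo (hn : Computable n) {X : ∀ p : α × ℕ, Op (n p.1)} (hX : CompMat X)
    {L : α → ℕ} (hL : Computable L) :
    CompMat (fun a => productUpTo (fun l => X (a, l)) (L a)) := by
  have h1 : CompC (fun q : ((α × ℕ × ℕ) × ℕ) × ℕ =>
      X (q.1.1.1, q.2) (bitsOf (n q.1.1.1) (digit (2 ^ n q.1.1.1) (q.2 + 1) q.1.2))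
        (bitsOf (n q.1.1.1) (digit (2 ^ n q.1.1.1) q.2 q.1.2))) :=
    CompC.comp hX (h := fun q : ((α × ℕ × ℕ) × ℕ) × ℕ =>
      ((q.1.1.1, q.2), digit (2 ^ n q.1.1.1) (q.2 + 1) q.1.2, digit (2 ^ n q.1.1.1) q.2 q.1.2))
      (by fun_prop)
  have h2 := CompC.prod_range (f := fun (q : (α × ℕ × ℕ) × ℕ) l =>
      X (q.1.1, l) (bitsOf (n q.1.1) (digit (2 ^ n q.1.1) (l + 1) q.2))
        (bitsOf (n q.1.1) (digit (2 ^ n q.1.1) l q.2))) h1 (N := fun q => L q.1.1) (by fun_prop)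
  have c1 : Computable (fun q : (α × ℕ × ℕ) × ℕ =>
      decide (digit (2 ^ n q.1.1) (L q.1.1) q.2 = q.1.2.1 % 2 ^ n q.1.1)) :=
    computable_decide_eq (by fun_prop) (by fun_prop)
  have c2 : Computable (fun q : (α × ℕ × ℕ) × ℕ =>
      decide (q.2 % 2 ^ n q.1.1 = q.1.2.2 % 2 ^ n q.1.1)) :=
    computable_decide_eq (by fun_prop) (by fun_prop)
  have h3 := CompC.ite (computable_decide_and c1 c2) h2 (compC_natCast (computable_const 0))
  refine (CompC.sum_range (f := fun (p : α × ℕ × ℕ) t => if digit (2 ^ n p.1) (L p.1) t =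
      p.2.1 % 2 ^ n p.1 ∧ t % 2 ^ n p.1 = p.2.2 % 2 ^ n p.1 then
        ∏ l ∈ Finset.range (L p.1), X (p.1, l) (bitsOf (n p.1) (digit (2 ^ n p.1) (l + 1) t))
          (bitsOf (n p.1) (digit (2 ^ n p.1) l t)) else ((0 : ℕ) : ℂ)) h3
      (N := fun p => (2 ^ n p.1) ^ (L p.1 + 1)) (by fun_prop)).of_eq fun p => ?_
  refine Eq.trans ?_ (productUpTo_apply (n := n p.1) (fun l => X (p.1, l)) (L p.1) p.2.1 p.2.2).symm
  simp only [pathSum, digit, Nat.cast_zero]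

theorem CompMat.pow (hn : Computable n) (hX : CompMat X) {L : α → ℕ} (hL : Computable L) :
    CompMat (fun a => X a ^ L a) :=
  (CompMat.productUpTo hn (X := fun p => X p.1) (hX.comp Computable.fst) hL).of_eq fun a =>
    productUpTo_const (X a) (L a)

theorem CompMat.compress {m k : α → ℕ} (hm : Computable m) {X : ∀ a, Op (m a + k a)}
    (hX : CompMat (n := fun a => m a + k a) X) : CompMat (fun a => compress (k a) (X a)) := by
  refine (CompC.comp hX (h := fun p : α × ℕ × ℕ => (p.1, p.2.1 % 2 ^ m p.1, p.2.2 % 2 ^ m p.1))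
    (by fun_prop)).of_eq fun p => ?_
  simp only [NoisyQMA.compress, append_bitsOf]

theorem CompMat.ampliation {m l : α → ℕ} (hm : Computable m) (hl : Computable l)
    {X : ∀ a, Op (m a)} (hX : CompMat X) :
    CompMat (n := fun a => m a + l a) (fun a => ampliation (l a) (X a)) := by
  refine (CompC.ite (p := fun q : α × ℕ × ℕ => ∀ j, j < l q.1 →
    q.2.1.testBit (m q.1 + j) = q.2.2.testBit (m q.1 + j)) ?_ hX
    (compC_natCast (computable_const 0))).of_eq fun p => ?_
  · exact computable_decide_forall_lt (by fun_prop) (by fun_prop)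
  · unfold NoisyQMA.ampliation
    refine if_congr ?_ rfl (by simp)
    simp only [bitsOf, Fin.val_natAdd, Fin.forall_iff]

end

end NoisyQMA

namespace NoisyQMA

/-! ## Decoding circuits -/

/-- The lengths of the runs of `true` between the symbols `false`. -/
def runs (w : List Bool) : ℕ × List ℕ :=
  w.foldr (fun b s => if b = true then (s.1 + 1, s.2) else (0, s.1 :: s.2)) (0, [])

def ofRuns (s : ℕ × List ℕ) : List Bool :=
  List.replicate s.1 true ++ s.2.flatMap fun r => false :: List.replicate r true

theorem runs_true (w : List Bool) : runs (true :: w) = ((runs w).1 + 1, (runs w).2) := rfl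

theorem runs_false (w : List Bool) : runs (false :: w) = (0, (runs w).1 :: (runs w).2) := rfl

theorem ofRuns_runs (w : List Bool) : ofRuns (runs w) = w := by
  induction w with
  | nil => rfl
  | cons b w ih =>
    cases b
    · rw [runs_false]
      simpa [ofRuns] using ih
    · rw [runs_true]
      simpa [ofRuns, List.replicate_succ] using ih

theorem runs_replicate_append (a : ℕ) (w : List Bool) :
    runs (List.replicate a true ++ w) = ((runs w).1 + a, (runs w).2) := by
  induction a with
  | zero => rfl
  | succ a ih => rw [List.replicate_succ, List.cons_append, runs_true, ih]; rfl

/-- The three run lengths that describe a gate. -/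
def Gate.triple {n : ℕ} : Gate n → ℕ × ℕ × ℕ
  | .H q => (0, 1, q + 1)
  | .T q => (1, 0, q + 1)
  | .CNOT c t _ => (2, c + 1, t + 1)

def flattenTriples (l : List (ℕ × ℕ × ℕ)) : List ℕ := l.flatMap fun t => [t.1, t.2.1, t.2.2]

/-- Each gate contributes exactly three runs, so the gates are recovered by cutting the list of runs
into triples. The initial block of length a stands for the last run before the gates. -/
theorem runs_gates {n : ℕ} (a : ℕ) (gs : List (Gate n)) :
    runs (List.replicate a true ++ gs.flatMap fun g => false :: g.encode) =
      (a, flattenTriples (gs.map Gate.triple)) := by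
  induction gs generalizing a with
  | nil => rw [runs_replicate_append]; simp [runs, flattenTriples]
  | cons g gs ih =>
    rw [runs_replicate_append, List.flatMap_cons]
    have h0 := ih 0
    rw [List.replicate_zero, List.nil_append] at h0
    generalize gs.flatMap (fun g => false :: g.encode) = R at *
    cases g <;> simp only [Gate.encode, List.cons_append, List.nil_append, runs_false, runs_true,
      List.append_assoc, runs_replicate_append, h0] <;> simp [flattenTriples, Gate.triple]

theorem Circuit.runs_encode (C : Circuit) :
    runs C.encode = (C.witness, C.ancilla :: flattenTriples (C.gates.map Gate.triple)) := by
  rw [Circuit.encode, runs_replicate_append, runs_false, runs_gates]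
  simp

/-- `t` describes a gate on `n` qubits. -/
def isGateTriple (n : ℕ) (t : ℕ × ℕ × ℕ) : Bool :=
  (decide (t.1 = 0) && decide (t.2.1 = 1) && decide (1 ≤ t.2.2) && decide (t.2.2 ≤ n)) ||
  ((decide (t.1 = 1) && decide (t.2.1 = 0) && decide (1 ≤ t.2.2) && decide (t.2.2 ≤ n)) ||
  (decide (t.1 = 2) && decide (1 ≤ t.2.1) && decide (t.2.1 ≤ n) && decide (1 ≤ t.2.2) &&
    decide (t.2.2 ≤ n) && decide (¬ t.2.1 = t.2.2)))

theorem isGateTriple_triple {n : ℕ} (g : Gate n) : isGateTriple n g.triple = true := by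
  cases g with
  | H q => simp [isGateTriple, Gate.triple]
  | T q => simp [isGateTriple, Gate.triple]
  | CNOT c t h =>
    have : (c : ℕ) ≠ t := fun e => h (Fin.ext e)
    simp [isGateTriple, Gate.triple]; omega

theorem exists_gate_of_isGateTriple {n : ℕ} {t : ℕ × ℕ × ℕ} (h : isGateTriple n t = true) :
    ∃ g : Gate n, g.triple = t := by
  obtain ⟨a, b, c⟩ := t
  simp only [isGateTriple, Bool.or_eq_true, Bool.and_eq_true, decide_eq_true_eq] at h
  rcases h with ⟨⟨⟨rfl, rfl⟩, h1⟩, h2⟩ | ⟨⟨⟨rfl, rfl⟩, h1⟩, h2⟩ | ⟨⟨⟨⟨⟨rfl, h1⟩, h2⟩, h3⟩, h4⟩, h5⟩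
  · exact ⟨.H ⟨c - 1, by omega⟩, by simp [Gate.triple]; omega⟩
  · exact ⟨.T ⟨c - 1, by omega⟩, by simp [Gate.triple]; omega⟩
  · exact ⟨.CNOT ⟨b - 1, by omega⟩ ⟨c - 1, by omega⟩ (by simp; omega), by
      simp [Gate.triple]; omega⟩

def tripleAt (l : List ℕ) (j : ℕ) : ℕ × ℕ × ℕ :=
  (l.getD (3 * j) 0, l.getD (3 * j + 1) 0, l.getD (3 * j + 2) 0)

theorem tripleAt_flattenTriples (l : List (ℕ × ℕ × ℕ)) (j : ℕ) (hj : j < l.length) :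
    tripleAt (flattenTriples l) j = l[j] := by
  induction l generalizing j with
  | nil => simp at hj
  | cons t l ih =>
    cases j with
    | zero => simp [tripleAt, flattenTriples]
    | succ j =>
      have := ih j (by simpa using hj)
      simp only [List.getElem_cons_succ, ← this]
      simp [tripleAt, flattenTriples, mul_add, add_assoc]

theorem length_flattenTriples (l : List (ℕ × ℕ × ℕ)) :
    (flattenTriples l).length = 3 * l.length := by
  induction l with
  | nil => rfl
  | cons t l ih =>
    simp only [flattenTriples, List.flatMap_cons, List.length_append, List.length_cons,
      List.length_nil] at ih ⊢
    omega

theorem exists_gates {n : ℕ} (r : ℕ) (l : List ℕ) (hl : l.length = 3 * r)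
    (h : ∀ j < r, isGateTriple n (tripleAt l j) = true) :
    ∃ gs : List (Gate n), flattenTriples (gs.map Gate.triple) = l := by
  induction r generalizing l with
  | zero => exact ⟨[], by simpa [flattenTriples, eq_comm] using hl⟩
  | succ r ih =>
    match l, hl, h with
    | [], hl, _ => simp at hl
    | [_], hl, _ => simp at hl; omega
    | [_, _], hl, _ => simp at hl; omega
    | a :: b :: c :: l, hl, h =>
      obtain ⟨gs, hgs⟩ := ih l (by simp at hl; omega) fun j hj => by
        have := h (j + 1) (by omega)
        rw [show tripleAt (a :: b :: c :: l) (j + 1) = tripleAt l j by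
          simp [tripleAt, mul_add, add_assoc]] at this
        exact this
      obtain ⟨g, hg⟩ := exists_gate_of_isGateTriple (h 0 (by omega))
      refine ⟨g :: gs, ?_⟩
      simp only [flattenTriples] at hgs
      simp [flattenTriples, hgs, hg, tripleAt]

/-- The run lengths are those of the encoding of a circuit. -/
def isCircuitRuns (s : ℕ × List ℕ) : Bool :=
  decide (1 ≤ s.2.length) && decide (1 ≤ s.1 + s.2.getD 0 0) &&
  decide (s.2.tail.length % 3 = 0) &&
  decide (∀ j, j < s.2.tail.length / 3 →
    isGateTriple (s.1 + s.2.getD 0 0) (tripleAt s.2.tail j) = true)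

/-- A string is determined by its runs (`ofRuns_runs`), so it suffices to compare runs. This makes
the classical case distinction in `Circuit.ofString` computable. -/
theorem isCircuitRuns_iff (w : List Bool) :
    isCircuitRuns (runs w) = true ↔ ∃ C : Circuit, C.encode = w := by
  constructor
  · intro h
    have hw := ofRuns_runs w
    generalize runs w = s at *
    obtain ⟨m, l⟩ := s
    simp only [isCircuitRuns, Bool.and_eq_true, decide_eq_true_eq] at h
    obtain ⟨⟨⟨h1, h2⟩, h3⟩, h4⟩ := h
    match l, h1 with
    | k :: l, _ =>
      obtain ⟨gs, hgs⟩ := exists_gates (n := m + k) (l.length / 3) l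
        (by simp only [List.tail_cons] at h3; omega) h4
      refine ⟨⟨m, k, h2, gs⟩, ?_⟩
      rw [← hw, ← ofRuns_runs (Circuit.encode _), Circuit.runs_encode]
      simp [hgs]
  · rintro ⟨C, rfl⟩
    rw [Circuit.runs_encode]
    have hlen := length_flattenTriples (C.gates.map Gate.triple)
    simp only [isCircuitRuns, Bool.and_eq_true, decide_eq_true_eq]
    refine ⟨⟨⟨by simp, C.pos⟩, by simp [hlen]⟩, fun j hj => ?_⟩
    have hj' : j < (C.gates.map Gate.triple).length := by
      simp only [List.tail_cons] at hj; omega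
    simp only [List.tail_cons]
    rw [tripleAt_flattenTriples _ _ hj']
    simpa using isGateTriple_triple _

/-- The run lengths of the encoding of the circuit described by `w`. -/
def circuitData (w : List Bool) : ℕ × List ℕ :=
  -- The default consists of the runs of `trivialCircuit`: no witness qubit, one ancilla, no gates.
  if isCircuitRuns (runs w) = true then runs w else (0, [1])

theorem Circuit.ofString_encode (C : Circuit) : Circuit.ofString C.encode = C := by
  have h : ∃ C' : Circuit, C'.encode = C.encode := ⟨C, rfl⟩
  rw [Circuit.ofString, dif_pos h]
  exact Circuit.encode_injective h.choose_spec

theorem circuitData_eq (w : List Bool) : circuitData w = ((Circuit.ofString w).witness,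
    (Circuit.ofString w).ancilla :: flattenTriples ((Circuit.ofString w).gates.map Gate.triple)) := by
  unfold circuitData
  split_ifs with h
  · obtain ⟨C, rfl⟩ := (isCircuitRuns_iff w).1 h
    rw [Circuit.ofString_encode, Circuit.runs_encode]
  · rw [Circuit.ofString, dif_neg fun hC => h ((isCircuitRuns_iff w).2 hC)]
    rfl

section
variable {α : Type*} [Primcodable α]

@[fun_prop] theorem computable_runs {w : α → List Bool} (hw : Computable w) :
    Computable (fun a => runs (w a)) := by
  unfold runs; fun_prop

@[fun_prop] theorem computable_isGateTriple {n : α → ℕ} {t : α → ℕ × ℕ × ℕ} (hn : Computable n)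
    (ht : Computable t) : Computable (fun a => isGateTriple (n a) (t a)) := by
  unfold isGateTriple; fun_prop

@[fun_prop] theorem computable_tripleAt {l : α → List ℕ} {j : α → ℕ} (hl : Computable l)
    (hj : Computable j) : Computable (fun a => tripleAt (l a) (j a)) := by
  unfold tripleAt; fun_prop

@[fun_prop] theorem computable_isCircuitRuns {s : α → ℕ × List ℕ} (hs : Computable s) :
    Computable (fun a => isCircuitRuns (s a)) := by
  unfold isCircuitRuns
  refine computable_and (by fun_prop) (computable_decide_forall_lt (by fun_prop) ?_)
  exact computable_decide_eq (by fun_prop) (by fun_prop)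

@[fun_prop] theorem computable_circuitData {w : α → List Bool} (hw : Computable w) :
    Computable (fun a => circuitData (w a)) := by
  unfold circuitData; fun_prop

@[fun_prop] theorem computable_witness {w : α → List Bool} (hw : Computable w) :
    Computable (fun a => (Circuit.ofString (w a)).witness) := by
  have h : Computable (fun a => (circuitData (w a)).1) := by fun_prop
  exact h.of_eq fun a => by rw [circuitData_eq]

@[fun_prop] theorem computable_ancilla {w : α → List Bool} (hw : Computable w) :
    Computable (fun a => (Circuit.ofString (w a)).ancilla) := by
  have h : Computable (fun a => (circuitData (w a)).2.getD 0 0) := by fun_prop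
  exact h.of_eq fun a => by rw [circuitData_eq]; rfl

theorem computable_length_gates {w : α → List Bool} (hw : Computable w) :
    Computable (fun a => (Circuit.ofString (w a)).gates.length) := by
  have h : Computable (fun a => (circuitData (w a)).2.tail.length / 3) := by fun_prop
  refine h.of_eq fun a => ?_
  rw [circuitData_eq, List.tail_cons, length_flattenTriples, List.length_map]
  omega

end

/-! ### The matrices of the gates -/

/-- Constants are written as dyadic values so that `compC_val` applies. As exp(iπ/4) = (1 + i)/√2,
the only irrational constant needed for the gates is 1/√2. -/
noncomputable def hEntry (p : ℕ × ℕ × ℕ) : ℂ :=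
  ((1 / Real.sqrt 2 : ℝ) : ℂ) *
    (if p.2.1.testBit p.1 = true ∧ p.2.2.testBit p.1 = true then GaussDyadic.val ((-1, 0), 0)
      else GaussDyadic.val ((1, 0), 0))

noncomputable def tEntry (p : ℕ × ℕ × ℕ) : ℂ :=
  if p.2.1.testBit p.1 = p.2.2.testBit p.1 then
    (if p.2.1.testBit p.1 = true then
      ((1 / Real.sqrt 2 : ℝ) : ℂ) * GaussDyadic.val ((1, 1), 0) else GaussDyadic.val ((1, 0), 0))
  else GaussDyadic.val ((0, 0), 0)

def agreesOff (n q s t : ℕ) : Bool :=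
  decide (∀ j, j < n → (j = q ∨ s.testBit j = t.testBit j))

def cnotCondition (n c q s t : ℕ) : Bool :=
  decide (∀ j, j < n →
    s.testBit j = cond (decide (j = q)) (xor (t.testBit q) (t.testBit c)) (t.testBit j))

/-- The entries of the gate that is described by a triple. -/
noncomputable def gateEntry (n : ℕ) (r : ℕ × ℕ × ℕ) (s t : ℕ) : ℂ :=
  if r.1 = 2 then
    (if cnotCondition n (r.2.1 - 1) (r.2.2 - 1) s t = true then GaussDyadic.val ((1, 0), 0)
      else GaussDyadic.val ((0, 0), 0))
  else if agreesOff n (r.2.2 - 1) s t = true then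
    (if r.1 = 0 then hEntry (r.2.2 - 1, s, t) else tEntry (r.2.2 - 1, s, t))
  else GaussDyadic.val ((0, 0), 0)

theorem exp_pi_div_four : Complex.exp (Complex.I * (Real.pi / 4)) =
    ((1 / Real.sqrt 2 : ℝ) : ℂ) * GaussDyadic.val ((1, 1), 0) := by
  have h2 : (Real.sqrt 2 / 2 : ℝ) = 1 / Real.sqrt 2 := by
    rw [div_eq_div_iff (by norm_num) (by positivity)]
    simp
  rw [mul_comm, show ((Real.pi : ℂ) / 4) = ((Real.pi / 4 : ℝ) : ℂ) by push_cast; rfl,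
    Complex.exp_mul_I, ← Complex.ofReal_cos, ← Complex.ofReal_sin, Real.cos_pi_div_four,
    Real.sin_pi_div_four, h2]
  simp [GaussDyadic.val]
  ring

theorem Gate.matrix_bitsOf {n : ℕ} (g : Gate n) (s t : ℕ) :
    g.matrix (bitsOf n s) (bitsOf n t) = gateEntry n g.triple s t := by
  have hagree : ∀ q : Fin n, (∀ j, j ≠ q → bitsOf n s j = bitsOf n t j) ↔
      agreesOff n (q + 1 - 1) s t = true := by
    intro q
    simp only [agreesOff, decide_eq_true_eq, Fin.forall_iff, bitsOf, ne_eq, Fin.ext_iff,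
      Nat.add_sub_cancel]
    exact forall₂_congr fun j hj => by tauto
  cases g with
  | H q =>
    have h1 : gateEntry n (0, 1, (q : ℕ) + 1) s t = if agreesOff n (q + 1 - 1) s t = true then
        hEntry (q, s, t) else 0 := by simp [gateEntry, GaussDyadic.val]
    simp only [Gate.matrix, onQubit, Gate.triple]
    rw [h1]
    refine if_congr (hagree q) ?_ rfl
    simp only [hadamard, hEntry, bitsOf]
    congr 1
    · simp
    · exact if_congr Iff.rfl (by simp [GaussDyadic.val]) (by simp [GaussDyadic.val])
  | T q =>
    have h1 : gateEntry n (1, 0, (q : ℕ) + 1) s t = if agreesOff n (q + 1 - 1) s t = true then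
        tEntry (q, s, t) else 0 := by simp [gateEntry, GaussDyadic.val]
    simp only [Gate.matrix, onQubit, Gate.triple]
    rw [h1]
    refine if_congr (hagree q) ?_ rfl
    simp only [tGate, tEntry, bitsOf, Matrix.diagonal_apply]
    rw [exp_pi_div_four]
    refine if_congr Iff.rfl (if_congr Iff.rfl rfl ?_) ?_ <;> simp [GaussDyadic.val]
  | CNOT c q h =>
    simp only [Gate.matrix, cnot, Gate.triple, gateEntry, if_true, Nat.add_sub_cancel]
    refine if_congr ?_ (by simp [GaussDyadic.val]) (by simp [GaussDyadic.val])
    simp only [cnotCondition, decide_eq_true_eq, funext_iff, Fin.forall_iff]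
    refine forall₂_congr fun j hj => ?_
    simp only [bitsOf, Function.update_apply, Fin.ext_iff]
    by_cases hjq : j = q <;> simp [hjq]

section
variable {α : Type*} [Primcodable α]

theorem compC_inv_sqrt_two : CompC (fun _ : α => ((1 / Real.sqrt 2 : ℝ) : ℂ)) := by
  -- The number is the only root of 2x² - 1 in the degenerate rectangle [0, 1] × {0}.
  refine compC_of_represents (r := fun _ => ([-1, 0, 2], (0, 1), (0, 0), 0))
    (computable_const _) fun _ => ?_
  have hpos : (0 : ℝ) < 1 / Real.sqrt 2 := by positivity
  have hsq : (1 / Real.sqrt 2) * (1 / Real.sqrt 2) = 1 / 2 := by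
    rw [div_mul_div_comm, Real.mul_self_sqrt (by norm_num)]; norm_num
  have hle : 1 / Real.sqrt 2 ≤ 1 := by nlinarith
  refine ⟨⟨-1, by simp, by norm_num⟩, ?_, ?_, ?_⟩
  · simp only [AlgebraicCode.evalPoly, List.foldr]
    have : (((1 / Real.sqrt 2 : ℝ) : ℂ)) * ((1 / Real.sqrt 2 : ℝ) : ℂ) = ((1 / 2 : ℝ) : ℂ) := by
      rw [← Complex.ofReal_mul, hsq]
    push_cast at this ⊢
    linear_combination 2 * this
  · simp only [AlgebraicCode.InRectangle, Complex.ofReal_re, Complex.ofReal_im]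
    refine ⟨?_, ?_, ?_, ?_⟩ <;> norm_num
    simpa using hle
  · intro y hy hr
    obtain ⟨h1, h2, h3, h4⟩ := hr
    norm_num at h1 h2 h3 h4
    have him : y.im = 0 := le_antisymm h4 h3
    have hy' : y = (y.re : ℂ) := Complex.ext (by simp) (by simpa using him)
    rw [hy'] at hy ⊢
    simp only [AlgebraicCode.evalPoly, List.foldr] at hy
    have h5 : y.re * y.re = 1 / 2 := by
      have : (((y.re * y.re : ℝ)) : ℂ) = ((1 / 2 : ℝ) : ℂ) := by
        push_cast at hy ⊢; linear_combination hy / 2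
      exact_mod_cast this
    have : y.re = 1 / Real.sqrt 2 := by nlinarith
    rw [this]

theorem compC_hEntry : CompC hEntry := by
  refine CompC.mul compC_inv_sqrt_two (CompC.ite (by fun_prop) (compC_val (by fun_prop))
    (compC_val (by fun_prop)))

theorem compC_tEntry : CompC tEntry := by
  refine CompC.ite (by fun_prop) (CompC.ite (by fun_prop) (CompC.mul compC_inv_sqrt_two
    (compC_val (by fun_prop))) (compC_val (by fun_prop))) (compC_val (by fun_prop))

@[fun_prop] theorem computable_agreesOff {n q s t : α → ℕ} (hn : Computable n) (hq : Computable q)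
    (hs : Computable s) (ht : Computable t) :
    Computable (fun a => agreesOff (n a) (q a) (s a) (t a)) := by
  unfold agreesOff; fun_prop

@[fun_prop] theorem computable_xor {f g : α → Bool} (hf : Computable f) (hg : Computable g) :
    Computable (fun a => xor (f a) (g a)) := (Primrec.dom_bool₂ _).to_comp.comp hf hg

@[fun_prop] theorem computable_cnotCondition {n c q s t : α → ℕ} (hn : Computable n)
    (hc : Computable c) (hq : Computable q) (hs : Computable s) (ht : Computable t) :
    Computable (fun a => cnotCondition (n a) (c a) (q a) (s a) (t a)) := by
  unfold cnotCondition; fun_prop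

theorem compC_gateEntry : CompC (fun p : ℕ × (ℕ × ℕ × ℕ) × ℕ × ℕ =>
    gateEntry p.1 p.2.1 p.2.2.1 p.2.2.2) := by
  have c0 : CompC (fun _ : ℕ × (ℕ × ℕ × ℕ) × ℕ × ℕ => GaussDyadic.val ((0, 0), 0)) :=
    compC_val (computable_const _)
  have c1 : CompC (fun _ : ℕ × (ℕ × ℕ × ℕ) × ℕ × ℕ => GaussDyadic.val ((1, 0), 0)) :=
    compC_val (computable_const _)
  have hr : Computable (fun p : ℕ × (ℕ × ℕ × ℕ) × ℕ × ℕ => p.2.1.1) := by fun_prop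
  have hs : Computable (fun p : ℕ × (ℕ × ℕ × ℕ) × ℕ × ℕ => p.2.2.1) := by fun_prop
  have ht : Computable (fun p : ℕ × (ℕ × ℕ × ℕ) × ℕ × ℕ => p.2.2.2) := by fun_prop
  have hb : Computable (fun p : ℕ × (ℕ × ℕ × ℕ) × ℕ × ℕ => p.2.1.2.1 - 1) :=
    computable_nat_sub (f := fun p : ℕ × (ℕ × ℕ × ℕ) × ℕ × ℕ => p.2.1.2.1) (g := fun _ => 1)
      (by fun_prop) (by fun_prop)
  have hc : Computable (fun p : ℕ × (ℕ × ℕ × ℕ) × ℕ × ℕ => p.2.1.2.2 - 1) :=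
    computable_nat_sub (f := fun p : ℕ × (ℕ × ℕ × ℕ) × ℕ × ℕ => p.2.1.2.2) (g := fun _ => 1)
      (by fun_prop) (by fun_prop)
  have h3 : CompC (fun p : ℕ × (ℕ × ℕ × ℕ) × ℕ × ℕ => hEntry (p.2.1.2.2 - 1, p.2.2.1, p.2.2.2)) :=
    compC_hEntry.comp (hc.pair (hs.pair ht))
  have h4 : CompC (fun p : ℕ × (ℕ × ℕ × ℕ) × ℕ × ℕ => tEntry (p.2.1.2.2 - 1, p.2.2.1, p.2.2.2)) :=
    compC_tEntry.comp (hc.pair (hs.pair ht))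
  have h5 := computable_decide_eq (computable_cnotCondition Computable.fst hb hc hs ht)
    (computable_const true)
  have h6 := computable_decide_eq (computable_agreesOff Computable.fst hc hs ht)
    (computable_const true)
  exact CompC.ite (computable_decide_eq hr (computable_const 2)) (CompC.ite h5 c1 c0)
    (CompC.ite h6 (CompC.ite (computable_decide_eq hr (computable_const 0)) h3 h4) c0)

end

/-! ### The unitary of a circuit -/

theorem productUpTo_congr {n : ℕ} {X Y : ℕ → Op n} {L : ℕ} (h : ∀ l < L, X l = Y l) :
    productUpTo X L = productUpTo Y L := by
  induction L with
  | zero => rfl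
  | succ L ih => rw [productUpTo, productUpTo, h L (by omega), ih fun l hl => h l (by omega)]

theorem foldl_gates {n : ℕ} (gs : List (Gate n)) :
    gs.foldl (fun U g => g.matrix * U) 1 =
      productUpTo (fun j => (gs[j]?.map Gate.matrix).getD 1) gs.length := by
  induction gs using List.reverseRecOn with
  | nil => rfl
  | append_singleton gs g ih =>
    rw [List.foldl_append, List.foldl_cons, List.foldl_nil, ih, List.length_append,
      List.length_singleton, productUpTo]
    congr 1
    · simp
    · exact productUpTo_congr fun l hl => by rw [List.getElem?_append_left hl]

theorem compMat_unitary :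
    CompMat (fun w : List Bool => (Circuit.ofString w).unitary) := by
  have hlen := computable_length_gates (α := List Bool × ℕ) (w := fun p => p.1) (by fun_prop)
  have h1 : CompMat (n := fun p : List Bool × ℕ =>
      (Circuit.ofString p.1).witness + (Circuit.ofString p.1).ancilla)
      (fun p => ((Circuit.ofString p.1).gates[p.2]?.map Gate.matrix).getD 1) := by
    have hlen' : Computable (fun q : (List Bool × ℕ) × ℕ × ℕ =>
      (Circuit.ofString q.1.1).gates.length) := hlen.comp Computable.fst
    refine (CompC.ite (p := fun q : (List Bool × ℕ) × ℕ × ℕ =>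
      q.1.2 < (Circuit.ofString q.1.1).gates.length) (by fun_prop)
      (compC_gateEntry.comp (h := fun q : (List Bool × ℕ) × ℕ × ℕ =>
        ((Circuit.ofString q.1.1).witness + (Circuit.ofString q.1.1).ancilla,
          tripleAt (circuitData q.1.1).2.tail q.1.2, q.2)) (by fun_prop))
      (CompC.ite (p := fun q : (List Bool × ℕ) × ℕ × ℕ =>
        q.2.1 % 2 ^ ((Circuit.ofString q.1.1).witness + (Circuit.ofString q.1.1).ancilla) =
        q.2.2 % 2 ^ ((Circuit.ofString q.1.1).witness + (Circuit.ofString q.1.1).ancilla))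
        (by fun_prop)
        (compC_val (g := fun _ => ((1, 0), 0)) (by fun_prop))
        (compC_val (g := fun _ => ((0, 0), 0)) (by fun_prop)))).of_eq fun q => ?_
    change _ = (Option.map Gate.matrix (Circuit.ofString q.1.1).gates[q.1.2]?).getD 1
      (bitsOf _ q.2.1) (bitsOf _ q.2.2)
    split_ifs with hj h2
    · rw [List.getElem?_eq_getElem hj, Option.map_some, Option.getD_some, Gate.matrix_bitsOf,
        circuitData_eq, List.tail_cons, tripleAt_flattenTriples _ _ (by simpa using hj)]
      simp
    · rw [List.getElem?_eq_none (not_lt.1 hj), Option.map_none, Option.getD_none,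
        Matrix.one_apply, if_pos ((bitsOf_eq_iff _ _ _).2 h2)]
      simp [GaussDyadic.val]
    · rw [List.getElem?_eq_none (not_lt.1 hj), Option.map_none, Option.getD_none,
        Matrix.one_apply, if_neg fun h => h2 ((bitsOf_eq_iff _ _ _).1 h)]
      simp [GaussDyadic.val]
  refine (CompMat.productUpTo (n := fun w : List Bool =>
    (Circuit.ofString w).witness + (Circuit.ofString w).ancilla) (by fun_prop) h1
    (computable_length_gates computable_id)).of_eq fun w => ?_
  rw [Circuit.unitary, foldl_gates]

theorem compMat_acceptProjector :
    CompMat (fun w : List Bool => (Circuit.ofString w).acceptProjector) := by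
  refine (CompC.ite (p := fun q : List Bool × ℕ × ℕ => q.2.1 %
      2 ^ ((Circuit.ofString q.1).witness + (Circuit.ofString q.1).ancilla) =
    q.2.2 % 2 ^ ((Circuit.ofString q.1).witness + (Circuit.ofString q.1).ancilla) ∧
    q.2.1.testBit 0 = true) (by fun_prop)
    (compC_val (g := fun _ => ((1, 0), 0)) (by fun_prop))
    (compC_val (g := fun _ => ((0, 0), 0)) (by fun_prop))).of_eq fun q => ?_
  change _ = (Circuit.ofString q.1).acceptProjector (bitsOf _ q.2.1) (bitsOf _ q.2.2)
  rw [Circuit.acceptProjector, Matrix.diagonal_apply, ite_and]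
  refine if_congr (bitsOf_eq_iff _ _ _).symm (if_congr Iff.rfl ?_ ?_) ?_ <;> simp [GaussDyadic.val]

/-- The positive operator whose expectation value is the acceptance probability. -/
noncomputable def Circuit.acceptOp (C : Circuit) : Op C.witness :=
  compress C.ancilla (C.unitaryᴴ * C.acceptProjector * C.unitary)

theorem compMat_acceptOp : CompMat (fun w : List Bool => (Circuit.ofString w).acceptOp) := by
  have hn : Computable (fun w : List Bool =>
    (Circuit.ofString w).witness + (Circuit.ofString w).ancilla) := by fun_prop
  exact CompMat.compress (by fun_prop) (CompMat.mul hn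
    (CompMat.mul hn compMat_unitary.conjTranspose compMat_acceptProjector) compMat_unitary)

end NoisyQMA

namespace NoisyQMA

/-! ## Acceptance operators -/

/-- The isometry that appends `k` qubits in the state `0`. -/
def appendZeros (m k : ℕ) : Matrix (Bits (m + k)) (Bits m) ℂ := fun s i =>
  if s = Fin.append i (fun _ => false) then 1 else 0

theorem mul_appendZeros {m k : ℕ} {ι : Type*} (X : Matrix ι (Bits (m + k)) ℂ) (i : ι)
    (j : Bits m) : (X * appendZeros m k) i j = X i (Fin.append j fun _ => false) := by
  simp [Matrix.mul_apply, appendZeros]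

theorem conjTranspose_appendZeros_mul {m k : ℕ} {ι : Type*} (X : Matrix (Bits (m + k)) ι ℂ)
    (i : Bits m) (j : ι) :
    ((appendZeros m k)ᴴ * X) i j = X (Fin.append i fun _ => false) j := by
  simp [Matrix.mul_apply, appendZeros, Matrix.conjTranspose_apply, apply_ite]

theorem compress_eq {m k : ℕ} (X : Op (m + k)) :
    compress k X = (appendZeros m k)ᴴ * X * appendZeros m k := by
  ext i j
  rw [mul_appendZeros, conjTranspose_appendZeros_mul]
  rfl

theorem append_left_injective {m k : ℕ} (z : Bits k) :
    Function.Injective fun i : Bits m => Fin.append i z := fun i j h => by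
  funext a
  simpa using congrFun h (Fin.castAdd k a)

theorem compress_one (m k : ℕ) : compress k (1 : Op (m + k)) = 1 := by
  ext i j
  rw [compress, Matrix.one_apply, Matrix.one_apply]
  exact if_congr (append_left_injective _).eq_iff rfl rfl

theorem eq_append_zeros_iff {m k : ℕ} (s : Bits (m + k)) (i : Bits m) :
    s = Fin.append i (fun _ => false) ↔
      (∀ j, s (Fin.natAdd m j) = false) ∧ (fun a => s (Fin.castAdd k a)) = i := by
  constructor
  · rintro rfl
    simp
  · rintro ⟨h1, rfl⟩
    funext j
    refine Fin.addCases (fun a => ?_) (fun a => ?_) j <;> simp [h1]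

/-- Adjoining ancillas is conjugation by an isometry, dual to `compress`. With cyclicity of the
trace, circuit and ancillas move from the state to the measured operator. -/
theorem withAncillas_eq {m : ℕ} (k : ℕ) (ρ : Op m) :
    withAncillas k ρ = appendZeros m k * ρ * (appendZeros m k)ᴴ := by
  ext s t
  have h1 : ∀ s : Bits (m + k), ∀ f : Bits m → ℂ, (∑ i, appendZeros m k s i * f i) =
      if ∀ j, s (Fin.natAdd m j) = false then f (fun a => s (Fin.castAdd k a)) else 0 := by
    intro s f
    simp only [appendZeros, eq_append_zeros_iff, ite_and, ite_mul, one_mul, zero_mul]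
    split_ifs with h
    · simp
    · simp
  have h2 : (appendZeros m k * ρ * (appendZeros m k)ᴴ) s t =
      star (∑ j, appendZeros m k t j * star (∑ i, appendZeros m k s i * ρ i j)) := by
    rw [Matrix.mul_apply]
    simp only [Matrix.mul_apply, Matrix.conjTranspose_apply, star_sum, star_mul', star_star]
    exact Finset.sum_congr rfl fun j _ => by rw [mul_comm]
  rw [h2, h1, h1]
  simp only [withAncillas]
  by_cases h3 : ∀ j, t (Fin.natAdd m j) = false <;>
    by_cases h4 : ∀ j, s (Fin.natAdd m j) = false <;> simp [h3, h4]

theorem sum_append {m k : ℕ} (f : Bits (m + k) → ℂ) :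
    ∑ s, f s = ∑ i : Bits m, ∑ z : Bits k, f (Fin.append i z) := by
  rw [← Fintype.sum_prod_type', ← (Fin.appendEquiv m k).sum_comp]
  rfl

theorem ampliation_append {m l : ℕ} (Q : Op m) (i j : Bits m) (z z' : Bits l) :
    ampliation l Q (Fin.append i z) (Fin.append j z') = if z = z' then Q i j else 0 := by
  simp only [ampliation, Fin.append_right, Fin.append_left]
  exact if_congr funext_iff.symm rfl rfl

/-- This duality of partial trace and ampliation moves the channel to the measured operator
(Heisenberg picture). -/
theorem trace_mul_partialTrace {m : ℕ} (l : ℕ) (Q : Op m) (X : Op (m + l)) :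
    (Q * partialTrace l X).trace = (ampliation l Q * X).trace := by
  have h1 : (Q * partialTrace l X).trace =
      ∑ i, ∑ j, ∑ z, Q i j * X (Fin.append j z) (Fin.append i z) := by
    simp only [Matrix.trace, Matrix.diag_apply, Matrix.mul_apply, partialTrace, Finset.mul_sum]
  have h2 : (ampliation l Q * X).trace =
      ∑ i, ∑ z, ∑ j, Q i j * X (Fin.append j z) (Fin.append i z) := by
    simp only [Matrix.trace, Matrix.diag_apply, Matrix.mul_apply]
    rw [sum_append]
    refine Finset.sum_congr rfl fun i _ => Finset.sum_congr rfl fun z _ => ?_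
    rw [sum_append]
    simp [ampliation_append]
  rw [h1, h2]
  exact Finset.sum_congr rfl fun i _ => Finset.sum_comm

theorem ampliation_one (m l : ℕ) : ampliation l (1 : Op m) = 1 := by
  ext s t
  obtain ⟨⟨i, z⟩, rfl⟩ := (Fin.appendEquiv m l).surjective s
  obtain ⟨⟨j, z'⟩, rfl⟩ := (Fin.appendEquiv m l).surjective t
  have h1 : Fin.appendEquiv m l (i, z) = Fin.appendEquiv m l (j, z') ↔ z = z' ∧ i = j := by
    rw [(Fin.appendEquiv m l).apply_eq_iff_eq, Prod.mk.injEq, and_comm]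
  rw [Matrix.one_apply, if_congr h1 rfl rfl]
  simp only [Fin.appendEquiv, Equiv.coe_fn_mk, ampliation_append, Matrix.one_apply, ite_and]

theorem ampliation_mul {m : ℕ} (l : ℕ) (A B : Op m) :
    ampliation l (A * B) = ampliation l A * ampliation l B := by
  ext s t
  obtain ⟨⟨i, z⟩, rfl⟩ := (Fin.appendEquiv m l).surjective s
  obtain ⟨⟨j, z'⟩, rfl⟩ := (Fin.appendEquiv m l).surjective t
  simp only [Fin.appendEquiv, Equiv.coe_fn_mk]
  rw [Matrix.mul_apply, sum_append]
  simp only [ampliation_append, Matrix.mul_apply]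
  by_cases h : z = z' <;> simp [h]

theorem ampliation_conjTranspose {m : ℕ} (l : ℕ) (A : Op m) :
    ampliation l Aᴴ = (ampliation l A)ᴴ := by
  ext s t
  simp only [ampliation, Matrix.conjTranspose_apply]
  rw [apply_ite star, star_zero]
  exact if_congr (forall_congr' fun _ => eq_comm) rfl rfl

theorem ampliation_sub {m : ℕ} (l : ℕ) (A B : Op m) :
    ampliation l (A - B) = ampliation l A - ampliation l B := by
  ext s t
  simp only [ampliation, Matrix.sub_apply]
  split_ifs <;> simp

theorem ampliation_smul {m : ℕ} (l : ℕ) (c : ℂ) (A : Op m) :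
    ampliation l (c • A) = c • ampliation l A := by
  ext s t
  simp only [ampliation, Matrix.smul_apply]
  split_ifs <;> simp

section
open scoped ComplexOrder

theorem Circuit.acceptProb_eq (C : Circuit) (ρ : Op C.witness) :
    C.acceptProb ρ = (C.acceptOp * ρ).trace.re := by
  rw [Circuit.acceptProb, Circuit.acceptOp, compress_eq, withAncillas_eq]
  congr 1
  simp only [Matrix.mul_assoc]
  conv_rhs => rw [Matrix.trace_mul_comm]
  simp only [Matrix.mul_assoc]
  rw [← Matrix.mul_assoc C.unitary, Matrix.trace_mul_comm]
  conv_rhs => rw [← Matrix.mul_assoc, Matrix.trace_mul_comm]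
  conv_rhs => rw [← Matrix.mul_assoc, Matrix.trace_mul_comm]
  simp only [Matrix.mul_assoc]
  conv_rhs => rw [Matrix.trace_mul_comm]
  simp only [Matrix.mul_assoc]

/-- The acceptance operator in front of a channel with the Stinespring dilation `V`. -/
def dilatedOp {m : ℕ} (l : ℕ) (V : Op (m + l)) (Q : Op m) : Op m :=
  compress l (Vᴴ * ampliation l Q * V)

theorem trace_mul_channel {m l : ℕ} {Φ : QuantumChannel m} {V : Op (m + l)}
    (h : IsStinespringDilation Φ l V) (Q ρ : Op m) :
    (Q * Φ.map ρ).trace = (dilatedOp l V Q * ρ).trace := by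
  rw [h.2, trace_mul_partialTrace, dilatedOp, compress_eq, withAncillas_eq]
  simp only [Matrix.mul_assoc]
  conv_rhs => rw [Matrix.trace_mul_comm]
  conv_lhs => rw [← Matrix.mul_assoc, ← Matrix.mul_assoc, ← Matrix.mul_assoc, Matrix.trace_mul_comm]
  conv_rhs => rw [← Matrix.mul_assoc, ← Matrix.mul_assoc, Matrix.trace_mul_comm]
  simp only [Matrix.mul_assoc]

open scoped MatrixOrder Matrix.Norms.L2Operator in
-- Ampliation is multiplicative and respects adjoints, so it sends B†B to a matrix of the same form.
theorem posSemidef_ampliation {m : ℕ} (l : ℕ) {A : Op m} (hA : A.PosSemidef) :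
    (ampliation l A).PosSemidef := by
  obtain ⟨B, rfl⟩ := CStarAlgebra.nonneg_iff_eq_star_mul_self.mp hA.nonneg
  rw [Matrix.star_eq_conjTranspose, ampliation_mul, ampliation_conjTranspose]
  exact Matrix.posSemidef_conjTranspose_mul_self _

theorem posSemidef_compress {m k : ℕ} {A : Op (m + k)} (hA : A.PosSemidef) :
    (compress k A).PosSemidef := by
  rw [compress_eq]
  exact hA.conjTranspose_mul_mul_same _

theorem posSemidef_dilatedOp {m l : ℕ} (V : Op (m + l)) {Q : Op m} (hQ : Q.PosSemidef) :
    (dilatedOp l V Q).PosSemidef :=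
  posSemidef_compress ((posSemidef_ampliation l hQ).conjTranspose_mul_mul_same _)

theorem Circuit.posSemidef_acceptOp (C : Circuit) : C.acceptOp.PosSemidef := by
  refine posSemidef_compress (Matrix.PosSemidef.conjTranspose_mul_mul_same ?_ _)
  rw [acceptProjector, Matrix.posSemidef_diagonal_iff]
  intro i
  split_ifs <;> simp

/-- The map is linear, and it is unital because V is unitary and appending zeros is an isometry. -/
theorem dilatedOp_sub {m l : ℕ} {V : Op (m + l)} (hV : V ∈ Matrix.unitaryGroup _ ℂ) (c : ℂ)
    (Q : Op m) : dilatedOp l V (c • 1 - Q) = c • 1 - dilatedOp l V Q := by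
  rw [dilatedOp, ampliation_sub, ampliation_smul, ampliation_one, Matrix.mul_sub, Matrix.sub_mul,
    Matrix.mul_smul, Matrix.smul_mul, Matrix.mul_one, ← Matrix.star_eq_conjTranspose,
    Matrix.mem_unitaryGroup_iff'.1 hV, compress_eq, Matrix.mul_sub, Matrix.sub_mul,
    Matrix.mul_smul, Matrix.smul_mul, ← compress_eq, compress_one, ← compress_eq]
  rfl

/-! ### Expectation values, eigenvalues and traces of powers -/

/-- The expectation value of `A` in the state `ψ`. -/
def expect {n : ℕ} (A : Op n) (ψ : Bits n → ℂ) : ℝ := (star ψ ⬝ᵥ (A *ᵥ ψ)).re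

theorem re_trace_mul_pureState {n : ℕ} (A : Op n) (ψ : Bits n → ℂ) :
    (A * pureState ψ).trace.re = expect A ψ := by
  rw [pureState, Matrix.mul_vecMulVec, Matrix.trace_vecMulVec, dotProduct_comm]
  rfl

theorem isState_iff {n : ℕ} (ψ : Bits n → ℂ) : IsState ψ ↔ star ψ ⬝ᵥ ψ = 1 := by
  have : star ψ ⬝ᵥ ψ = ((∑ i, ‖ψ i‖ ^ 2 : ℝ) : ℂ) := by
    simp only [dotProduct, Pi.star_apply, Complex.ofReal_sum]
    refine Finset.sum_congr rfl fun i _ => ?_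
    rw [Complex.star_def, ← Complex.normSq_eq_conj_mul_self, Complex.normSq_eq_norm_sq]
  rw [this, IsState]
  exact_mod_cast Iff.rfl

theorem expect_le_of_posSemidef {n : ℕ} {A : Op n} {c : ℝ}
    (h : ((c : ℂ) • 1 - A).PosSemidef) {ψ : Bits n → ℂ} (hψ : IsState ψ) : expect A ψ ≤ c := by
  have := h.re_dotProduct_nonneg ψ
  rw [Matrix.sub_mulVec, Matrix.smul_mulVec, Matrix.one_mulVec, dotProduct_sub,
    dotProduct_smul, (isState_iff ψ).1 hψ] at this
  simp only [smul_eq_mul, mul_one, map_sub, RCLike.re_to_complex, Complex.ofReal_re] at this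
  exact sub_nonneg.1 this

/-- The eigenvector unitary diagonalises A and fixes the scalar matrix, so positivity can be read
off the diagonal. -/
theorem posSemidef_smul_one_sub_iff {n : ℕ} {A : Op n} (hA : A.IsHermitian) (c : ℝ) :
    ((c : ℂ) • 1 - A).PosSemidef ↔ ∀ i, hA.eigenvalues i ≤ c := by
  have h1 : (c : ℂ) • 1 - A = Unitary.conjStarAlgAut ℂ _ hA.eigenvectorUnitary
      (Matrix.diagonal fun i => ((c - hA.eigenvalues i : ℝ) : ℂ)) := by
    have h2 : (Matrix.diagonal fun i => ((c - hA.eigenvalues i : ℝ) : ℂ)) =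
        (c : ℂ) • 1 - Matrix.diagonal (RCLike.ofReal ∘ hA.eigenvalues) := by
      ext i j
      by_cases h : i = j <;> simp [h]
    rw [h2, map_sub, map_smul, map_one]
    conv_lhs => rw [hA.spectral_theorem]
  rw [h1, Unitary.conjStarAlgAut_apply]
  have h3 := Matrix.IsUnit.posSemidef_star_right_conjugate_iff
    (U := (hA.eigenvectorUnitary : Op n)) (x := Matrix.diagonal fun i =>
      ((c - hA.eigenvalues i : ℝ) : ℂ)) (Unitary.toUnits hA.eigenvectorUnitary).isUnit
  rw [h3, Matrix.posSemidef_diagonal_iff]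
  exact forall_congr' fun i => by
    rw [Complex.zero_le_real, sub_nonneg]

theorem exists_state_expect_eq {n : ℕ} {A : Op n} (hA : A.IsHermitian) (i : Bits n) :
    ∃ ψ, IsState ψ ∧ expect A ψ = hA.eigenvalues i := by
  refine ⟨(hA.eigenvectorBasis i).ofLp, ?_, ?_⟩
  · have := hA.eigenvectorBasis.norm_eq_one i
    rw [EuclideanSpace.norm_eq, Real.sqrt_eq_one] at this
    exact this
  · rw [hA.eigenvalues_eq]
    rfl

theorem forall_state_expect_le_iff {n : ℕ} {A : Op n} (hA : A.IsHermitian) (c : ℝ) :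
    (∀ ψ, IsState ψ → expect A ψ ≤ c) ↔ ∀ i, hA.eigenvalues i ≤ c := by
  constructor
  · intro h i
    obtain ⟨ψ, h1, h2⟩ := exists_state_expect_eq hA i
    exact h2 ▸ h ψ h1
  · intro h ψ hψ
    exact expect_le_of_posSemidef ((posSemidef_smul_one_sub_iff hA c).2 h) hψ

theorem exists_state_le_expect_iff {n : ℕ} {A : Op n} (hA : A.IsHermitian) (c : ℝ) :
    (∃ ψ, IsState ψ ∧ c ≤ expect A ψ) ↔ ∃ i, c ≤ hA.eigenvalues i := by
  constructor
  · rintro ⟨ψ, h1, h2⟩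
    obtain ⟨i, hi⟩ := Finite.exists_max hA.eigenvalues
    exact ⟨i, h2.trans (expect_le_of_posSemidef ((posSemidef_smul_one_sub_iff hA _).2 hi) h1)⟩
  · rintro ⟨i, hi⟩
    obtain ⟨ψ, h1, h2⟩ := exists_state_expect_eq hA i
    exact ⟨ψ, h1, h2 ▸ hi⟩

/-- Power sums of the eigenvalues are thus accessible from the matrix entries alone, without
computing a spectrum. -/
theorem trace_pow {n : ℕ} {A : Op n} (hA : A.IsHermitian) (p : ℕ) :
    (A ^ p).trace = ∑ i, ((hA.eigenvalues i ^ p : ℝ) : ℂ) := by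
  conv_lhs => rw [hA.spectral_theorem, ← map_pow, Matrix.diagonal_pow,
    Unitary.conjStarAlgAut_apply, Matrix.trace_mul_cycle, Unitary.coe_star_mul_self, one_mul,
    Matrix.trace_diagonal]
  simp

end

end NoisyQMA

namespace NoisyQMA

/-! ## Denominators and conjugates of algebraic numbers -/

/-- `z` lies in `K`, becomes an algebraic integer when it is multiplied by `A`, and all its
conjugates have absolute value at most `H`. -/
def HasSize (K : IntermediateField ℚ ℂ) (A H : ℕ) (z : ℂ) : Prop :=
  ∃ hz : z ∈ K, IsIntegral ℤ ((A : ℂ) * z) ∧ ∀ σ : K →ₐ[ℚ] ℂ, ‖σ ⟨z, hz⟩‖ ≤ H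

section
variable {K : IntermediateField ℚ ℂ} {A B H J : ℕ} {y z : ℂ}

theorem HasSize.mono (hz : HasSize K A H z) (h1 : A ∣ B) (h2 : H ≤ J) : HasSize K B J z := by
  obtain ⟨h, hi, hs⟩ := hz
  obtain ⟨c, rfl⟩ := h1
  refine ⟨h, ?_, fun σ => (hs σ).trans (by exact_mod_cast h2)⟩
  have : ((A * c : ℕ) : ℂ) * z = (c : ℂ) * (A * z) := by push_cast; ring
  rw [this]
  exact (isIntegral_natCast (R := ℤ) c).mul hi

theorem HasSize.mul (hy : HasSize K A H y) (hz : HasSize K B J z) :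
    HasSize K (A * B) (H * J) (y * z) := by
  obtain ⟨h, hi, hs⟩ := hy
  obtain ⟨h', hi', hs'⟩ := hz
  refine ⟨K.mul_mem h h', ?_, fun σ => ?_⟩
  · have : ((A * B : ℕ) : ℂ) * (y * z) = (A * y) * (B * z) := by push_cast; ring
    rw [this]
    exact hi.mul hi'
  · have : (⟨y * z, K.mul_mem h h'⟩ : K) = ⟨y, h⟩ * ⟨z, h'⟩ := rfl
    rw [this, map_mul, norm_mul, Nat.cast_mul]
    exact mul_le_mul (hs σ) (hs' σ) (norm_nonneg _) (Nat.cast_nonneg _)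

theorem HasSize.sum {ι : Type*} (s : Finset ι) {f : ι → ℂ} (hf : ∀ i ∈ s, HasSize K A H (f i)) :
    HasSize K A (s.card * H) (∑ i ∈ s, f i) := by
  classical
  induction s using Finset.induction_on with
  | empty => exact ⟨by simp, by simpa using isIntegral_zero, fun σ => by
      have : (⟨∑ i ∈ (∅ : Finset ι), f i, by simp⟩ : K) = 0 := Subtype.ext (by simp)
      rw [this]; simp⟩
  | insert a s ha ih =>
    obtain ⟨h, hi, hs⟩ := hf a (Finset.mem_insert_self _ _)
    obtain ⟨h', hi', hs'⟩ := ih fun i hi => hf i (Finset.mem_insert_of_mem hi)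
    rw [Finset.sum_insert ha, Finset.card_insert_of_notMem ha]
    refine ⟨K.add_mem h h', ?_, fun σ => ?_⟩
    · rw [mul_add]; exact hi.add hi'
    · have : (⟨f a + ∑ i ∈ s, f i, K.add_mem h h'⟩ : K) = ⟨f a, h⟩ + ⟨∑ i ∈ s, f i, h'⟩ := rfl
      rw [this, map_add]
      refine (norm_add_le _ _).trans ((add_le_add (hs σ) (hs' σ)).trans (le_of_eq ?_))
      push_cast
      ring

theorem hasSize_intCast (c : ℤ) (hc : c.natAbs ≤ H) : HasSize K 1 H (c : ℂ) := by
  refine ⟨by simp, by simpa using isIntegral_algebraMap (R := ℤ) (A := ℂ) (x := c), fun σ => ?_⟩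
  have : (⟨(c : ℂ), by simp⟩ : K) = (c : K) := rfl
  rw [this, map_intCast, Complex.norm_intCast, ← Int.cast_abs, Int.abs_eq_natAbs, Int.cast_natCast]
  exact_mod_cast hc

theorem hasSize_zero : HasSize K 1 1 (0 : ℂ) := by
  simpa using hasSize_intCast (K := K) (H := 1) 0 (by simp)

theorem hasSize_one : HasSize K 1 1 (1 : ℂ) := by
  simpa using hasSize_intCast (K := K) (H := 1) 1 (by simp)

/-- The entries of the matrix and their complex conjugates have the given size. -/
def MatSize {ι κ : Type*} (K : IntermediateField ℚ ℂ) (A H : ℕ) (X : Matrix ι κ ℂ) : Prop :=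
  ∀ i j, HasSize K A H (X i j) ∧ HasSize K A H (star (X i j))

/-- Here it matters that `MatSize` also records conjugated entries: K need not be stable under
complex conjugation, and embeddings need not commute with it. -/
theorem MatSize.conjTranspose {ι κ : Type*} {X : Matrix ι κ ℂ} (hX : MatSize K A H X) :
    MatSize K A H Xᴴ := fun i j => ⟨(hX j i).2, by simpa using (hX j i).1⟩

theorem MatSize.mul {ι κ ν : Type*} [Fintype κ] {X : Matrix ι κ ℂ} {Y : Matrix κ ν ℂ}
    (hX : MatSize K A H X) (hY : MatSize K B J Y) :
    MatSize K (A * B) (Fintype.card κ * (H * J)) (X * Y) := by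
  intro i j
  rw [Matrix.mul_apply, star_sum]
  refine ⟨HasSize.sum _ fun u _ => (hX i u).1.mul (hY u j).1, HasSize.sum _ fun u _ => ?_⟩
  rw [star_mul']
  exact (hX i u).2.mul (hY u j).2

theorem matSize_of_zero_or_one {ι κ : Type*} {X : Matrix ι κ ℂ} (h : ∀ i j, X i j = 0 ∨ X i j = 1)
    : MatSize K 1 1 X := by
  intro i j
  rcases h i j with h | h <;> rw [h] <;> simp [hasSize_zero, hasSize_one]

theorem MatSize.mono {ι κ : Type*} {X : Matrix ι κ ℂ} (hX : MatSize K A H X) (h1 : A ∣ B)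
    (h2 : H ≤ J) : MatSize K B J X :=
  fun i j => ⟨(hX i j).1.mono h1 h2, (hX i j).2.mono h1 h2⟩

theorem MatSize.compress {m k : ℕ} {X : Op (m + k)} (hX : MatSize K A H X) :
    MatSize K A H (compress k X) := fun _ _ => hX _ _

theorem MatSize.ampliation {m l : ℕ} {X : Op m} (hX : MatSize K A H X) (hH : 1 ≤ H) :
    MatSize K A H (ampliation l X) := by
  intro i j
  unfold NoisyQMA.ampliation
  split_ifs
  · exact hX _ _
  · have := (hasSize_zero (K := K)).mono (one_dvd A) hH
    exact ⟨this, by simpa using this⟩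

end

/-! ## The distance between an eigenvalue and a rational number -/

section
variable {ι : Type*} [Fintype ι] [DecidableEq ι]

theorem isRoot_charpoly_iff {X : Matrix ι ι ℂ} {z : ℂ} :
    X.charpoly.IsRoot z ↔ Module.End.HasEigenvalue (Matrix.toLin' X) z := by
  rw [Module.End.hasEigenvalue_iff_mem_spectrum, Matrix.spectrum_toLin',
    Matrix.mem_spectrum_iff_isRoot_charpoly]

/-- Gershgorin's theorem puts z in a disc about a diagonal entry, so the absolute row sum bounds it.
-/
theorem norm_le_of_isRoot_charpoly {X : Matrix ι ι ℂ} {z : ℂ} (hz : X.charpoly.IsRoot z) {H : ℝ}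
    (hX : ∀ i j, ‖X i j‖ ≤ H) : ‖z‖ ≤ Fintype.card ι * H := by
  obtain ⟨k, hk⟩ := eigenvalue_mem_ball (isRoot_charpoly_iff.1 hz)
  rw [mem_closedBall_iff_norm] at hk
  have h1 : ‖z‖ ≤ ‖X k k‖ + ∑ j ∈ Finset.univ.erase k, ‖X k j‖ := by
    have := norm_add_le (z - X k k) (X k k)
    rw [sub_add_cancel] at this
    linarith
  rw [Finset.add_sum_erase _ (fun j => ‖X k j‖) (Finset.mem_univ k)] at h1
  refine h1.trans ((Finset.sum_le_sum fun j _ => hX k j).trans (le_of_eq ?_))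
  simp

/-- The characteristic polynomial is monic over the ring of algebraic integers, and integrality is
transitive. -/
theorem isIntegral_of_isRoot_charpoly {X : Matrix ι ι ℂ} {z : ℂ} (hz : X.charpoly.IsRoot z)
    (hX : ∀ i j, IsIntegral ℤ (X i j)) : IsIntegral ℤ z := by
  let Y : Matrix ι ι (integralClosure ℤ ℂ) := fun i j => ⟨X i j, hX i j⟩
  have hY : Y.map (algebraMap (integralClosure ℤ ℂ) ℂ) = X := rfl
  refine isIntegral_trans (A := integralClosure ℤ ℂ) z ⟨Y.charpoly, Y.charpoly_monic, ?_⟩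
  rw [← hY, Matrix.charpoly_map, Polynomial.IsRoot, Polynomial.eval_map] at hz
  exact hz

theorem isRoot_charpoly_smul {X : Matrix ι ι ℂ} {z : ℂ} (hz : X.charpoly.IsRoot z) (c : ℂ) :
    (c • X).charpoly.IsRoot (c * z) := by
  rw [isRoot_charpoly_iff] at hz ⊢
  obtain ⟨w, hw⟩ := hz.exists_hasEigenvector
  refine Module.End.hasEigenvalue_of_hasEigenvector (x := w)
    (Module.End.hasEigenvector_iff.2 ⟨?_, hw.2⟩)
  rw [Module.End.mem_eigenspace_iff, map_smul, LinearMap.smul_apply, hw.apply_eq_smul, mul_smul]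

/-- Liouville's argument: the norm of x is a nonzero integer and the product of all conjugates, so
one conjugate cannot be small when the others are bounded by B. -/
theorem one_le_norm_mul_pow {F : Type*} [Field F] [Algebra ℚ F] [FiniteDimensional ℚ F]
    (φ : F →ₐ[ℚ] ℂ) {x : F} (hx : x ≠ 0) (hi : IsIntegral ℤ x) {B : ℝ} (hB : 1 ≤ B)
    (hσ : ∀ σ : F →ₐ[ℚ] ℂ, ‖σ x‖ ≤ B) {D : ℕ} (hD : Module.finrank ℚ F ≤ D) :
    1 ≤ ‖φ x‖ * B ^ D := by
  classical
  have h1 := Algebra.norm_eq_prod_embeddings ℚ ℂ x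
  obtain ⟨y, hy⟩ := IsIntegrallyClosed.isIntegral_iff.1 (Algebra.isIntegral_norm ℚ hi)
  have hy0 : y ≠ 0 := by
    rintro rfl
    rw [map_zero, eq_comm, Algebra.norm_eq_zero_iff] at hy
    exact hx hy
  have h2 : (1 : ℝ) ≤ ‖∏ σ : F →ₐ[ℚ] ℂ, σ x‖ := by
    rw [← h1, ← hy]
    simp only [algebraMap_int_eq, eq_intCast, map_intCast, Complex.norm_intCast]
    rw [← Int.cast_abs]
    exact_mod_cast Int.one_le_abs hy0
  rw [norm_prod, Fintype.prod_eq_mul_prod_compl φ] at h2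
  refine h2.trans (mul_le_mul_of_nonneg_left ?_ (norm_nonneg _))
  refine (Finset.prod_le_prod (fun _ _ => norm_nonneg _) fun σ _ => hσ σ).trans ?_
  rw [Finset.prod_const]
  refine pow_le_pow_right₀ hB (le_trans (Finset.card_le_univ _) ?_)
  rw [AlgHom.card]
  exact hD

/-- Apply `one_le_norm_mul_pow` to A(uz - v) in K(z). The factor A makes it integral. The degree is
at most D times the size of the matrix, since z is a root of the characteristic polynomial over K.
-/
theorem one_le_norm_sub_mul {K : IntermediateField ℚ ℂ} [FiniteDimensional ℚ K] {D : ℕ}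
    (hD : Module.finrank ℚ K ≤ D) {A H : ℕ} {X : Matrix ι ι ℂ}
    (hX : ∀ i j, HasSize K A H (X i j)) {z : ℂ} (hz : X.charpoly.IsRoot z) (u v : ℕ) (hA : A ≠ 0)
    (hne : (u : ℂ) * z - v ≠ 0) :
    1 ≤ ‖(u : ℂ) * z - v‖ * (A * (A * (u * (Fintype.card ι * H) + v) + 1) ^
      (D * Fintype.card ι) : ℕ) := by
  let Y : Matrix ι ι K := fun i j => ⟨X i j, (hX i j).1⟩
  have hY : Y.map (algebraMap K ℂ) = X := rfl
  have hYz : Polynomial.aeval z Y.charpoly = 0 := by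
    rw [← hY, Matrix.charpoly_map, Polynomial.IsRoot, Polynomial.eval_map] at hz
    exact hz
  have hzi : IsIntegral K z := ⟨Y.charpoly, Y.charpoly_monic, hYz⟩
  let F := IntermediateField.adjoin K {z}
  have : FiniteDimensional K F := IntermediateField.adjoin.finiteDimensional hzi
  have : FiniteDimensional ℚ F := FiniteDimensional.trans ℚ K F
  have hF : Module.finrank ℚ F ≤ D * Fintype.card ι := by
    rw [← Module.finrank_mul_finrank ℚ K F, IntermediateField.adjoin.finrank hzi]
    refine Nat.mul_le_mul hD ?_
    rw [← Y.charpoly_natDegree_eq_dim]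
    exact Polynomial.natDegree_le_of_dvd (minpoly.dvd K z hYz) Y.charpoly_monic.ne_zero
  let g : F := ⟨z, IntermediateField.mem_adjoin_simple_self K z⟩
  let x : F := (A : F) * ((u : F) * g - v)
  have hφ : F.val.restrictScalars ℚ x = A * ((u : ℂ) * z - v) := rfl
  have hzA : IsIntegral ℤ ((A : ℂ) * z) :=
    isIntegral_of_isRoot_charpoly (isRoot_charpoly_smul hz A) fun i j => (hX i j).2.1
  have hxi : IsIntegral ℤ x := by
    rw [← isIntegral_algHom_iff ((F.val.restrictScalars ℚ).restrictScalars ℤ)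
      (F.val.restrictScalars ℚ).toRingHom.injective]
    change IsIntegral ℤ (F.val.restrictScalars ℚ x)
    rw [hφ]
    have : (A : ℂ) * ((u : ℂ) * z - v) = u * (A * z) - A * v := by ring
    rw [this]
    exact ((isIntegral_natCast _).mul hzA).sub ((isIntegral_natCast _).mul (isIntegral_natCast _))
  have hx0 : x ≠ 0 := by
    intro h
    rw [h, map_zero, eq_comm] at hφ
    exact mul_ne_zero (Nat.cast_ne_zero.2 hA) hne hφ
  -- The summand 1 only makes the bound at least 1, as its powers require.
  have hσ : ∀ σ : F →ₐ[ℚ] ℂ, ‖σ x‖ ≤ ((A * (u * (Fintype.card ι * H) + v) + 1 : ℕ) : ℝ) := by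
    intro σ
    have h1 : ‖σ g‖ ≤ Fintype.card ι * H := by
      -- A conjugate of the eigenvalue is an eigenvalue of the conjugated matrix, whose entries are
      -- also bounded by H.
      let τ : K →ₐ[ℚ] ℂ := σ.comp (IsScalarTower.toAlgHom ℚ K F)
      refine norm_le_of_isRoot_charpoly (X := Y.map (τ : K →+* ℂ)) ?_ fun i j => (hX i j).2.2 τ
      rw [Matrix.charpoly_map, Polynomial.IsRoot, Polynomial.eval_map]
      have h2 : Polynomial.aeval g Y.charpoly = 0 := by
        apply (algebraMap F ℂ).injective
        rw [← Polynomial.aeval_algebraMap_apply, map_zero]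
        exact hYz
      have h3 := congrArg σ h2
      rw [map_zero, Polynomial.aeval_def, ← AlgHom.coe_toRingHom, Polynomial.hom_eval₂] at h3
      exact h3
    have h2 : σ x = A * ((u : ℂ) * σ g - v) := by simp [x]
    rw [h2, norm_mul, Complex.norm_natCast]
    have h3 : ‖(u : ℂ) * σ g - v‖ ≤ u * (Fintype.card ι * H) + v := by
      refine (norm_sub_le _ _).trans ?_
      rw [norm_mul, Complex.norm_natCast, Complex.norm_natCast]
      gcongr
    have := mul_le_mul_of_nonneg_left h3 (Nat.cast_nonneg (α := ℝ) A)
    push_cast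
    linarith
  have := one_le_norm_mul_pow (F.val.restrictScalars ℚ) hx0 hxi (by push_cast; simp; positivity) hσ hF
  rw [hφ, norm_mul, Complex.norm_natCast] at this
  push_cast at this ⊢
  linarith

end

end NoisyQMA

namespace NoisyQMA

/-! ## Sizes of roots of integer polynomials -/

/-- The polynomial with the given coefficients, constant term first. -/
noncomputable def intPoly (l : List ℤ) : Polynomial ℤ :=
  l.foldr (fun a p => Polynomial.C a + Polynomial.X * p) 0

/-- A multiple of the leading coefficient. -/
def leadBound (l : List ℤ) : ℕ := l.foldr (fun a n => if a = 0 then n else a.natAbs * n) 1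

/-- A bound for the absolute values of the roots. -/
def rootBound (l : List ℤ) : ℕ := l.foldr (fun a n => a.natAbs + n) 1

theorem aeval_intPoly (r : AlgebraicCode) (z : ℂ) :
    Polynomial.aeval z (intPoly r.1) = r.evalPoly z := by
  unfold intPoly AlgebraicCode.evalPoly
  induction r.1 with
  | nil => simp
  | cons a l ih =>
    rw [List.foldr_cons, List.foldr_cons, map_add, map_mul, ih, Polynomial.aeval_X,
      Polynomial.aeval_C]
    rfl

theorem coeff_intPoly (l : List ℤ) (n : ℕ) : (intPoly l).coeff n = l.getD n 0 := by
  induction l generalizing n with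
  | nil => simp [intPoly]
  | cons a l ih =>
    have : intPoly (a :: l) = Polynomial.C a + Polynomial.X * intPoly l := rfl
    rw [this]
    cases n with
    | zero => simp
    | succ n =>
      rw [Polynomial.coeff_add, Polynomial.coeff_C_succ, zero_add, Polynomial.coeff_X_mul, ih,
        List.getD_cons_succ]

theorem intPoly_ne_zero {l : List ℤ} (h : ∃ a ∈ l, a ≠ 0) : intPoly l ≠ 0 := by
  obtain ⟨a, ha, h0⟩ := h
  obtain ⟨i, hi, rfl⟩ := List.getElem_of_mem ha
  intro h
  apply h0
  have := coeff_intPoly l i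
  rw [h, Polynomial.coeff_zero, List.getD_eq_getElem _ _ hi] at this
  exact this.symm

theorem natDegree_intPoly_le (l : List ℤ) : (intPoly l).natDegree ≤ l.length := by
  rw [Polynomial.natDegree_le_iff_coeff_eq_zero]
  intro n hn
  rw [coeff_intPoly, List.getD_eq_default _ _ hn.le]

theorem leadBound_ne_zero (l : List ℤ) : leadBound l ≠ 0 := by
  induction l with
  | nil => simp [leadBound]
  | cons a l ih =>
    change (if a = 0 then leadBound l else a.natAbs * leadBound l) ≠ 0
    split_ifs with h
    · exact ih
    · exact mul_ne_zero (Int.natAbs_ne_zero.2 h) ih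

/-- The list may end in zeros. The product of all nonzero coefficients is a multiple of the leading
one without locating it. -/
theorem natAbs_dvd_leadBound {l : List ℤ} {a : ℤ} (ha : a ∈ l) (h0 : a ≠ 0) :
    a.natAbs ∣ leadBound l := by
  induction l with
  | nil => simp at ha
  | cons c l ih =>
    change _ ∣ (if c = 0 then leadBound l else c.natAbs * leadBound l)
    rcases List.mem_cons.1 ha with rfl | ha
    · rw [if_neg h0]; exact dvd_mul_right _ _
    · split_ifs
      · exact ih ha
      · exact (ih ha).mul_left _

theorem natAbs_lt_rootBound {l : List ℤ} {a : ℤ} (ha : a ∈ l) : a.natAbs + 1 ≤ rootBound l := by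
  induction l with
  | nil => simp at ha
  | cons c l ih =>
    change _ ≤ c.natAbs + rootBound l
    have h1 : 1 ≤ rootBound l := by
      clear ih ha
      induction l with
      | nil => simp [rootBound]
      | cons c l ih => exact ih.trans (Nat.le_add_left _ _)
    rcases List.mem_cons.1 ha with rfl | ha
    · omega
    · have := ih ha; omega

theorem leadingCoeff_intPoly_mem {l : List ℤ} (h : ∃ a ∈ l, a ≠ 0) :
    (intPoly l).leadingCoeff ∈ l := by
  have h1 : (intPoly l).leadingCoeff ≠ 0 := Polynomial.leadingCoeff_ne_zero.2 (intPoly_ne_zero h)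
  rw [Polynomial.leadingCoeff, coeff_intPoly] at h1 ⊢
  by_cases hn : (intPoly l).natDegree < l.length
  · rw [List.getD_eq_getElem _ _ hn]
    exact List.getElem_mem hn
  · rw [List.getD_eq_default _ _ (not_lt.1 hn)] at h1
    exact absurd rfl h1

/-- This is Cauchy's bound; the division by the leading coefficient is harmless, as a nonzero
integer has absolute value at least 1. -/
theorem norm_le_rootBound {l : List ℤ} (h : ∃ a ∈ l, a ≠ 0) {z : ℂ}
    (hz : Polynomial.aeval z (intPoly l) = 0) : ‖z‖ ≤ rootBound l := by
  have hinj : Function.Injective (Int.castRingHom ℂ) := Int.cast_injective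
  have h0 : (intPoly l).map (Int.castRingHom ℂ) ≠ 0 :=
    (Polynomial.map_ne_zero_iff hinj).2 (intPoly_ne_zero h)
  have hr : ((intPoly l).map (Int.castRingHom ℂ)).IsRoot z := by
    rw [Polynomial.IsRoot, Polynomial.eval_map]; exact hz
  have h1 := (hr.norm_lt_cauchyBound h0).le
  have h2 : ((intPoly l).map (Int.castRingHom ℂ)).cauchyBound ≤ (rootBound l : NNReal) := by
    have hb : (1 : NNReal) ≤ ‖((intPoly l).map (Int.castRingHom ℂ)).leadingCoeff‖₊ := by
      rw [Polynomial.leadingCoeff_map_of_injective hinj, ← NNReal.coe_le_coe]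
      simp only [eq_intCast, NNReal.coe_one, coe_nnnorm, Complex.norm_intCast]
      rw [← Int.cast_abs]
      exact_mod_cast Int.one_le_abs (Polynomial.leadingCoeff_ne_zero.2 (intPoly_ne_zero h))
    obtain ⟨a, ha, -⟩ := h
    obtain ⟨c, hc⟩ : ∃ c, rootBound l = c + 1 :=
      ⟨rootBound l - 1, by have := natAbs_lt_rootBound ha; omega⟩
    rw [Polynomial.cauchyBound, hc, Nat.cast_add, Nat.cast_one]
    gcongr
    refine (div_le_self zero_le hb).trans (Finset.sup_le fun i _ => ?_)
    rw [Polynomial.coeff_map, coeff_intPoly, ← NNReal.coe_le_coe]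
    simp only [eq_intCast, coe_nnnorm, Complex.norm_intCast, NNReal.coe_natCast]
    rw [← Int.cast_abs, Int.abs_eq_natAbs, Int.cast_natCast]
    norm_cast
    by_cases hi : i < l.length
    · rw [List.getD_eq_getElem _ _ hi]
      have := natAbs_lt_rootBound (List.getElem_mem hi)
      omega
    · rw [List.getD_eq_default _ _ (not_lt.1 hi)]
      simp
  exact_mod_cast h1.trans h2

/-- The leading coefficient times a root is integral. Every conjugate of z is a root of the same
integer polynomial and obeys the same bound. -/
theorem hasSize_of_root {K : IntermediateField ℚ ℂ} {l : List ℤ} (h : ∃ a ∈ l, a ≠ 0) {z : ℂ}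
    (hzK : z ∈ K) (hz : Polynomial.aeval z (intPoly l) = 0) :
    HasSize K (leadBound l) (rootBound l) z := by
  refine ⟨hzK, ?_, fun σ => norm_le_rootBound h ?_⟩
  · obtain ⟨c, hc⟩ := natAbs_dvd_leadBound (leadingCoeff_intPoly_mem h)
      (Polynomial.leadingCoeff_ne_zero.2 (intPoly_ne_zero h))
    have h1 := isIntegral_leadingCoeff_smul (intPoly l) z hz
    have h2 : IsIntegral ℤ (((intPoly l).leadingCoeff.natAbs : ℂ) * z) := by
      rcases Int.natAbs_eq (intPoly l).leadingCoeff with h3 | h3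
      · rw [h3] at h1
        simpa using h1
      · rw [h3] at h1
        simpa using h1.neg
    rw [hc, Nat.cast_mul, mul_right_comm, mul_comm]
    exact (isIntegral_natCast _).mul h2
  · have h1 : Polynomial.aeval (⟨z, hzK⟩ : K) (intPoly l) = 0 := by
      apply (algebraMap K ℂ).injective
      rw [← Polynomial.aeval_algebraMap_apply, map_zero]
      exact hz
    have h2 := congrArg (σ.restrictScalars ℤ) h1
    rwa [map_zero, ← Polynomial.aeval_algHom_apply] at h2

theorem aeval_star_intPoly {l : List ℤ} {z : ℂ} (hz : Polynomial.aeval z (intPoly l) = 0) :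
    Polynomial.aeval (star z) (intPoly l) = 0 := by
  have := congrArg (Complex.conjAe.toAlgHom.restrictScalars ℤ) hz
  rwa [map_zero, ← Polynomial.aeval_algHom_apply] at this

/-- Adjoin the numbers one by one: the degree of a compositum is at most the product of the degrees,
and the length of a coefficient list bounds the degree of its root. -/
theorem exists_intermediateField {ι : Type*} (s : Finset ι) (z : ι → ℂ) (l : ι → List ℤ)
    (h0 : ∀ i, ∃ a ∈ l i, a ≠ 0) (hz : ∀ i, Polynomial.aeval (z i) (intPoly (l i)) = 0) :
    ∃ K : IntermediateField ℚ ℂ, FiniteDimensional ℚ K ∧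
      Module.finrank ℚ K ≤ ∏ i ∈ s, (l i).length ∧ ∀ i ∈ s, z i ∈ K := by
  classical
  induction s using Finset.induction_on with
  | empty => exact ⟨⊥, inferInstance, by simp, by simp⟩
  | insert a s ha ih =>
    obtain ⟨K, hK, hd, hs⟩ := ih
    have hinj : Function.Injective (Int.castRingHom ℚ) := Int.cast_injective
    have hp : Polynomial.aeval (z a) ((intPoly (l a)).map (Int.castRingHom ℚ)) = 0 := by
      rw [← hz a, ← algebraMap_int_eq, Polynomial.aeval_map_algebraMap]
    have hp0 := (Polynomial.map_ne_zero_iff hinj).2 (intPoly_ne_zero (h0 a))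
    have hi : IsIntegral ℚ (z a) := isAlgebraic_iff_isIntegral.1 ⟨_, hp0, hp⟩
    have hfd := IntermediateField.adjoin.finiteDimensional hi
    refine ⟨IntermediateField.adjoin ℚ {z a} ⊔ K, IntermediateField.finiteDimensional_sup _ _,
      (IntermediateField.finrank_sup_le _ _).trans ?_, ?_⟩
    · rw [Finset.prod_insert ha]
      refine Nat.mul_le_mul ?_ hd
      rw [IntermediateField.adjoin.finrank hi]
      refine (Polynomial.natDegree_le_of_dvd (minpoly.dvd ℚ _ hp) hp0).trans ?_
      rw [Polynomial.natDegree_map_eq_of_injective hinj]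
      exact natDegree_intPoly_le _
    · intro i hi
      rcases Finset.mem_insert.1 hi with rfl | hi
      · exact le_sup_left (a := IntermediateField.adjoin ℚ {z i})
          (IntermediateField.mem_adjoin_simple_self ℚ _)
      · exact le_sup_right (a := IntermediateField.adjoin ℚ {z a}) (hs i hi)

theorem exists_intermediateField_star {κ : Type*} [Fintype κ] (z : κ → ℂ) (l : κ → List ℤ)
    (h0 : ∀ i, ∃ a ∈ l i, a ≠ 0) (hz : ∀ i, Polynomial.aeval (z i) (intPoly (l i)) = 0) :
    ∃ K : IntermediateField ℚ ℂ, FiniteDimensional ℚ K ∧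
      Module.finrank ℚ K ≤ (∏ i, (l i).length) ^ 2 ∧ ∀ i,
        HasSize K (leadBound (l i)) (rootBound (l i)) (z i) ∧
        HasSize K (leadBound (l i)) (rootBound (l i)) (star (z i)) := by
  -- The Boolean selects a number or its complex conjugate, which is a root of the same polynomial;
  -- this squares the degree bound.
  obtain ⟨K, h1, h2, h3⟩ := exists_intermediateField (Finset.univ : Finset (κ × Bool))
    (fun p => if p.2 then star (z p.1) else z p.1) (fun p => l p.1) (fun p => h0 p.1) (by
      rintro ⟨i, b⟩
      cases b
      · simpa using hz i
      · simpa using aeval_star_intPoly (hz i))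
  refine ⟨K, h1, h2.trans (le_of_eq ?_), fun i => ⟨?_, ?_⟩⟩
  · rw [Fintype.prod_prod_type, ← Finset.prod_pow]
    simp [sq]
  · exact hasSize_of_root (h0 i) (by simpa using h3 (i, false) (Finset.mem_univ _)) (hz i)
  · exact hasSize_of_root (h0 i) (by simpa using h3 (i, true) (Finset.mem_univ _))
      (aeval_star_intPoly (hz i))

/-! ## Sizes of acceptance operators -/

def invSqrtTwoPoly : List ℤ := [-1, 0, 2]

def eighthRootPoly : List ℤ := [1, 0, 0, 0, 1]

theorem aeval_invSqrtTwoPoly :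
    Polynomial.aeval (1 / (Real.sqrt 2 : ℂ)) (intPoly invSqrtTwoPoly) = 0 := by
  have h : (Real.sqrt 2 : ℂ) ^ 2 = 2 := by
    rw [← Complex.ofReal_pow, Real.sq_sqrt (by norm_num)]; simp
  have h0 : (Real.sqrt 2 : ℂ) ≠ 0 := by intro h'; rw [h'] at h; norm_num at h
  rw [aeval_intPoly (invSqrtTwoPoly, (0, 0), (0, 0), 0)]
  simp only [AlgebraicCode.evalPoly, invSqrtTwoPoly, List.foldr_cons, List.foldr_nil]
  push_cast
  field_simp
  linear_combination -(Real.sqrt 2 : ℂ) * h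

theorem aeval_eighthRootPoly :
    Polynomial.aeval (Complex.exp (Complex.I * (Real.pi / 4))) (intPoly eighthRootPoly) = 0 := by
  have h : Complex.exp (Complex.I * (Real.pi / 4)) ^ 4 = -1 := by
    rw [← Complex.exp_nat_mul]
    convert Complex.exp_pi_mul_I using 2
    push_cast; ring
  rw [aeval_intPoly (eighthRootPoly, (0, 0), (0, 0), 0)]
  simp only [AlgebraicCode.evalPoly, eighthRootPoly, List.foldr_cons, List.foldr_nil]
  push_cast
  linear_combination h

/-- The field contains the entries of the gates. -/
def ContainsGates (K : IntermediateField ℚ ℂ) : Prop :=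
  HasSize K 2 4 (1 / (Real.sqrt 2 : ℂ)) ∧ HasSize K 2 4 (star (1 / (Real.sqrt 2 : ℂ))) ∧
  HasSize K 2 4 (Complex.exp (Complex.I * (Real.pi / 4))) ∧
  HasSize K 2 4 (star (Complex.exp (Complex.I * (Real.pi / 4))))

section
variable {K : IntermediateField ℚ ℂ} {A H : ℕ}

theorem matSize_onQubit {n : ℕ} (q : Fin n) {G : Matrix Bool Bool ℂ} (hG : MatSize K A H G)
    (hH : 1 ≤ H) : MatSize K A H (onQubit q G) := by
  intro i j
  unfold onQubit
  split_ifs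
  · exact hG _ _
  · have := (hasSize_zero (K := K)).mono (one_dvd A) hH
    exact ⟨this, by simpa using this⟩

theorem matSize_gate (hK : ContainsGates K) {n : ℕ} (g : Gate n) : MatSize K 2 4 g.matrix := by
  obtain ⟨h1, h2, h3, h4⟩ := hK
  cases g with
  | H q =>
    refine matSize_onQubit q (fun a b => ?_) (by norm_num)
    unfold hadamard
    split_ifs
    · have h := (hasSize_intCast (K := K) (H := 1) (-1) (by simp))
      have e1 := h1.mul h
      have e2 := h2.mul h
      simp only [mul_one, Int.cast_neg, Int.cast_one] at e1 e2
      refine ⟨e1, ?_⟩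
      rwa [star_mul', star_neg, star_one]
    · rw [mul_one]; exact ⟨h1, h2⟩
  | T q =>
    have e1 := (hasSize_one (K := K)).mono (one_dvd 2) (by norm_num : 1 ≤ 4)
    have e0 := (hasSize_zero (K := K)).mono (one_dvd 2) (by norm_num : 1 ≤ 4)
    refine matSize_onQubit q (fun a b => ?_) (by norm_num)
    unfold tGate
    rw [Matrix.diagonal_apply]
    split_ifs
    · exact ⟨h3, h4⟩
    · exact ⟨e1, by simpa using e1⟩
    · exact ⟨e0, by simpa using e0⟩
  | CNOT c t ne =>
    refine (matSize_of_zero_or_one fun i j => ?_).mono (one_dvd 2) (by norm_num : 1 ≤ 4)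
    change cnot c t i j = 0 ∨ cnot c t i j = 1
    unfold cnot
    split_ifs <;> simp

theorem card_bits (n : ℕ) : Fintype.card (Bits n) = 2 ^ n := by simp

theorem matSize_foldl_gates (hK : ContainsGates K) {n : ℕ} (gs : List (Gate n)) {U : Op n}
    (hU : MatSize K A H U) : MatSize K (2 ^ gs.length * A) ((2 ^ n * 4) ^ gs.length * H)
      (gs.foldl (fun U g => g.matrix * U) U) := by
  induction gs generalizing U A H with
  | nil => simpa using hU
  | cons g gs ih =>
    refine (ih ((matSize_gate hK g).mul hU)).mono (dvd_of_eq ?_) (le_of_eq ?_)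
    · rw [List.length_cons, pow_succ, mul_assoc]
    · rw [List.length_cons, card_bits, pow_succ]; ring

theorem matSize_acceptOp (hK : ContainsGates K) (C : Circuit) :
    MatSize K (2 ^ C.gates.length * 2 ^ C.gates.length)
      (2 ^ (C.witness + C.ancilla) * (2 ^ (C.witness + C.ancilla) *
        (2 ^ (C.witness + C.ancilla) * 4) ^ C.gates.length *
          (2 ^ (C.witness + C.ancilla) * 4) ^ C.gates.length)) C.acceptOp := by
  have h1 : MatSize K 1 1 (1 : Op (C.witness + C.ancilla)) := matSize_of_zero_or_one fun i j => by
    rw [Matrix.one_apply]; split_ifs <;> simp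
  have h2 : MatSize K 1 1 C.acceptProjector := matSize_of_zero_or_one fun i j => by
    rw [Circuit.acceptProjector, Matrix.diagonal_apply]; split_ifs <;> simp
  have h3 := matSize_foldl_gates hK C.gates h1
  refine (((h3.conjTranspose.mul h2).mul h3).compress).mono (dvd_of_eq ?_) (le_of_eq ?_)
  · ring
  · rw [card_bits]; ring

theorem matSize_dilatedOp {m l B J : ℕ} {V : Op (m + l)} {Q : Op m} (hV : MatSize K B J V)
    (hQ : MatSize K A H Q) (hH : 1 ≤ H) :
    MatSize K (B * A * B) (2 ^ (m + l) * (2 ^ (m + l) * (J * H) * J)) (dilatedOp l V Q) := by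
  have := ((hV.conjTranspose.mul (hQ.ampliation (l := l) hH)).mul hV).compress
  rwa [card_bits] at this

end

end NoisyQMA

namespace NoisyQMA

/-! ## Deciding whether there is a large eigenvalue -/

/-- Bernoulli's inequality gives (1 + 1/B)^B ≥ 2, and (1 - 1/B)(1 + 1/B) ≤ 1 turns this into x^B ≤
1/2. -/
theorem pow_mul_le_half_pow {B : ℕ} (hB : 0 < B) {x : ℝ} (h0 : 0 ≤ x) (hx : x ≤ 1 - 1 / B) (k : ℕ) :
    x ^ (B * k) ≤ (1 / 2) ^ k := by
  have hB' : (0 : ℝ) < B := Nat.cast_pos.2 hB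
  have h1 : (2 : ℝ) ≤ (1 + 1 / B) ^ B := by
    have := one_add_mul_le_pow (a := (1 / B : ℝ)) (by linarith [one_div_pos.2 hB']) B
    rw [mul_one_div_cancel hB'.ne'] at this
    linarith
  have h2 : x * (1 + 1 / B) ≤ 1 := by
    have : x * (1 + 1 / B) ≤ (1 - 1 / B) * (1 + 1 / B) := by gcongr
    nlinarith [sq_nonneg (1 / B : ℝ)]
  have h3 : x ^ B * (1 + 1 / B) ^ B ≤ 1 := by
    rw [← mul_pow]; exact pow_le_one₀ (by positivity) h2
  have h4 : x ^ B ≤ 1 / 2 := by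
    have : x ^ B * 2 ≤ x ^ B * (1 + 1 / B) ^ B := by gcongr
    linarith
  rw [pow_mul]
  exact pow_le_pow_left₀ (by positivity) h4 k

theorem two_pow_le_pow_mul {B : ℕ} (hB : 0 < B) {x : ℝ} (hx : 1 + 1 / B ≤ x) (k : ℕ) :
    2 ^ k ≤ x ^ (B * k) := by
  have hB' : (0 : ℝ) < B := Nat.cast_pos.2 hB
  have h0 : (0 : ℝ) ≤ 1 / B := by positivity
  have h1 := one_add_mul_le_pow (a := (1 / B : ℝ)) (by linarith) B
  rw [mul_one_div_cancel hB'.ne'] at h1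
  rw [pow_mul]
  refine pow_le_pow_left₀ (by norm_num) (le_trans ?_ (pow_le_pow_left₀ (by positivity) hx B)) k
  linarith

theorem isRoot_eigenvalue {n : ℕ} {A : Op n} (hA : A.IsHermitian) (i : Bits n) :
    A.charpoly.IsRoot (hA.eigenvalues i : ℂ) := by
  rw [hA.charpoly_eq, Polynomial.IsRoot, Polynomial.eval_prod]
  exact Finset.prod_eq_zero (Finset.mem_univ i) (by simp)

section
variable {α : Type*} [Primcodable α] {n : α → ℕ} {X : ∀ a, Op (n a)} {c : ℝ} {b : α → ℕ}

theorem compC_trace_pow (hn : Computable n) (hX : CompMat X)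
    (hA : ∀ a, (X a).IsHermitian) (hc : CompC (fun _ : α => (c : ℂ))) {p : α → ℕ}
    (hp : Computable p) :
    CompC (fun a => ((∑ i, (c * (hA a).eigenvalues i) ^ p a : ℝ) : ℂ)) := by
  refine ((CompC.prod_range (f := fun (_ : α) _ => (c : ℂ)) (hc.comp Computable.fst) hp).mul
    (CompMat.trace hn (hX.pow hn hp))).of_eq fun a => ?_
  rw [trace_pow (hA a), Finset.prod_const, Finset.card_range, Finset.mul_sum]
  push_cast
  exact Finset.sum_congr rfl fun i _ => (mul_pow _ _ _).symm

/-- There is a gap between `1` and the other eigenvalues of `c • X a`. -/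
def HasGap (hA : ∀ a, (X a).IsHermitian) (c : ℝ) (b : α → ℕ) : Prop :=
  ∀ a i, c * (hA a).eigenvalues i = 1 ∨ 1 ≤ |c * (hA a).eigenvalues i - 1| * b a

open Classical ComplexOrder in
-- One eigenvalue with c * λ ≥ 1 makes the power sum at least 1. Otherwise the gap makes each of the
-- 2^n terms at most 2^-(n+1), so the sum is at most 1/2.
theorem computable_exists_one_le (hn : Computable n) (hX : CompMat X)
    (hp : ∀ a, (X a).PosSemidef) (hc0 : 0 ≤ c) (hc : CompC (fun _ : α => (c : ℂ)))
    (hb : Computable b) (hb0 : ∀ a, 0 < b a) (hgap : HasGap (fun a => (hp a).1) c b) :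
    Computable (fun a => decide (∃ i, 1 ≤ c * (hp a).1.eigenvalues i)) := by
  have h0 : ∀ a i, 0 ≤ c * (hp a).1.eigenvalues i := fun a i =>
    mul_nonneg hc0 ((hp a).eigenvalues_nonneg i)
  have key1 : ∀ a, (∃ i, 1 ≤ c * (hp a).1.eigenvalues i) →
      1 ≤ ∑ i, (c * (hp a).1.eigenvalues i) ^ (b a * (n a + 1)) := by
    rintro a ⟨i, hi⟩
    exact (one_le_pow₀ hi).trans (Finset.single_le_sum (f := fun i =>
      (c * (hp a).1.eigenvalues i) ^ (b a * (n a + 1))) (fun j _ => pow_nonneg (h0 a j) _)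
      (Finset.mem_univ i))
  have key2 : ∀ a, (¬ ∃ i, 1 ≤ c * (hp a).1.eigenvalues i) →
      ∑ i, (c * (hp a).1.eigenvalues i) ^ (b a * (n a + 1)) ≤ 1 / 2 := by
    intro a h
    have hB' : (0 : ℝ) < b a := Nat.cast_pos.2 (hb0 a)
    have h1 : ∀ i, (c * (hp a).1.eigenvalues i) ^ (b a * (n a + 1)) ≤ (1 / 2) ^ (n a + 1) := by
      intro i
      refine pow_mul_le_half_pow (hb0 a) (h0 a i) ?_ _
      have h2 : c * (hp a).1.eigenvalues i < 1 := not_le.1 fun h' => h ⟨i, h'⟩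
      have h3 := (hgap a i).resolve_left h2.ne
      rw [abs_of_neg (by linarith)] at h3
      have h4 : 1 / (b a : ℝ) ≤ 1 - c * (hp a).1.eigenvalues i := by
        rw [div_le_iff₀ hB']; linarith
      linarith
    refine (Finset.sum_le_sum fun i _ => h1 i).trans (le_of_eq ?_)
    rw [Finset.sum_const, Finset.card_univ, card_bits, nsmul_eq_mul, pow_succ, Nat.cast_pow,
      ← mul_assoc, ← mul_pow]
    norm_num
  refine (CompC.computable_decide (compC_trace_pow hn hX (fun a => (hp a).1) hc
    (p := fun a => b a * (n a + 1)) (by fun_prop)) fun a => ?_).of_eq fun a => ?_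
  · by_cases h : ∃ i, 1 ≤ c * (hp a).1.eigenvalues i
    · exact Or.inr (key1 a h)
    · exact Or.inl (key2 a h)
  · rw [decide_eq_decide, Complex.ofReal_re]
    refine ⟨fun h => ?_, key1 a⟩
    by_contra h'
    linarith [key2 a h']

open Classical ComplexOrder in
-- The strict version must ignore scaled eigenvalues equal to 1. Those that are at most 1 contribute
-- at most 2^n in total, whereas one beyond the gap contributes at least 2^(n+1); the factor
-- 2^-(n+1) normalises this to 1/2 against 1.
theorem computable_exists_one_lt (hn : Computable n) (hX : CompMat X)
    (hp : ∀ a, (X a).PosSemidef) (hc0 : 0 ≤ c) (hc : CompC (fun _ : α => (c : ℂ)))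
    (hb : Computable b) (hb0 : ∀ a, 0 < b a) (hgap : HasGap (fun a => (hp a).1) c b) :
    Computable (fun a => decide (∃ i, 1 < c * (hp a).1.eigenvalues i)) := by
  have h0 : ∀ a i, 0 ≤ c * (hp a).1.eigenvalues i := fun a i =>
    mul_nonneg hc0 ((hp a).eigenvalues_nonneg i)
  have key1 : ∀ a, (∃ i, 1 < c * (hp a).1.eigenvalues i) →
      1 ≤ (1 / 2) ^ (n a + 1) * ∑ i, (c * (hp a).1.eigenvalues i) ^ (b a * (n a + 1)) := by
    rintro a ⟨i, hi⟩
    have hB' : (0 : ℝ) < b a := Nat.cast_pos.2 (hb0 a)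
    have h3 := (hgap a i).resolve_left hi.ne'
    rw [abs_of_pos (by linarith)] at h3
    have h4 : 1 / (b a : ℝ) ≤ c * (hp a).1.eigenvalues i - 1 := by
      rw [div_le_iff₀ hB']; linarith
    have h5 := (two_pow_le_pow_mul (hb0 a) (by linarith) (n a + 1)).trans
      (Finset.single_le_sum (f := fun i =>
        (c * (hp a).1.eigenvalues i) ^ (b a * (n a + 1))) (fun j _ => pow_nonneg (h0 a j) _)
        (Finset.mem_univ i))
    calc (1 : ℝ) = (1 / 2) ^ (n a + 1) * 2 ^ (n a + 1) := by rw [← mul_pow]; norm_num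
      _ ≤ _ := by gcongr
  have key2 : ∀ a, (¬ ∃ i, 1 < c * (hp a).1.eigenvalues i) →
      (1 / 2) ^ (n a + 1) * ∑ i, (c * (hp a).1.eigenvalues i) ^ (b a * (n a + 1)) ≤ 1 / 2 := by
    intro a h
    have h1 : ∑ i, (c * (hp a).1.eigenvalues i) ^ (b a * (n a + 1)) ≤ 2 ^ n a := by
      refine (Finset.sum_le_sum fun i _ => pow_le_one₀ (h0 a i)
        (not_lt.1 fun h' => h ⟨i, h'⟩)).trans (le_of_eq ?_)
      simp
    calc _ ≤ (1 / 2 : ℝ) ^ (n a + 1) * 2 ^ n a := by gcongr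
      _ = 1 / 2 := by rw [pow_succ, mul_right_comm, ← mul_pow]; norm_num
  have hhalf : CompC (fun _ : α × ℕ => ((1 / 2 : ℝ) : ℂ)) :=
    (compC_val (computable_const (((1, 0), 1) : GaussDyadic))).of_eq fun _ => by
      simp [GaussDyadic.val]
  refine (CompC.computable_decide (f := fun a => (((1 / 2) ^ (n a + 1) *
    ∑ i, (c * (hp a).1.eigenvalues i) ^ (b a * (n a + 1)) : ℝ) : ℂ)) ?_ fun a => ?_).of_eq
      fun a => ?_
  · refine ((CompC.prod_range (f := fun (_ : α) _ => ((1 / 2 : ℝ) : ℂ)) hhalf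
      (N := fun a => n a + 1) (by fun_prop)).mul (compC_trace_pow hn hX (fun a => (hp a).1) hc
        (p := fun a => b a * (n a + 1)) (by fun_prop))).of_eq fun a => ?_
    rw [Finset.prod_const, Finset.card_range]
    push_cast
    rfl
  · by_cases h : ∃ i, 1 < c * (hp a).1.eigenvalues i
    · exact Or.inr (key1 a h)
    · exact Or.inl (key2 a h)
  · rw [decide_eq_decide, Complex.ofReal_re]
    refine ⟨fun h => ?_, key1 a⟩
    by_contra h'
    linarith [key2 a h']

end

/-! ## The gap for acceptance operators -/

theorem prod_bits (n : ℕ) (f : Bits n → ℕ) :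
    ∏ b, f b = ∏ u ∈ Finset.range (2 ^ n), f (bitsOf n u) :=
  sum_bits (M := Additive ℕ) n f

/-- The gate constants are adjoined together with the entries of V, so one field serves all
circuits. The factors 3 and 5 are the lengths of the coefficient lists of 2x² - 1 and x⁴ + 1. -/
theorem exists_field_of_codes {n : ℕ} {V : Op n} {c : Bits n → Bits n → AlgebraicCode}
    (hc : ∀ i j, (c i j).Represents (V i j)) :
    ∃ K : IntermediateField ℚ ℂ, FiniteDimensional ℚ K ∧
      Module.finrank ℚ K ≤ (3 * (5 * ∏ i, ∏ j, (c i j).1.length)) ^ 2 ∧ ContainsGates K ∧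
      MatSize K (∏ i, ∏ j, leadBound (c i j).1) (∑ i, ∑ j, rootBound (c i j).1) V := by
  obtain ⟨K, h1, h2, h3⟩ := exists_intermediateField_star (κ := Option (Option (Bits n × Bits n)))
    (fun k => match k with
      | none => Complex.exp (Complex.I * (Real.pi / 4))
      | some none => 1 / (Real.sqrt 2 : ℂ)
      | some (some p) => V p.1 p.2)
    (fun k => match k with
      | none => eighthRootPoly
      | some none => invSqrtTwoPoly
      | some (some p) => (c p.1 p.2).1)
    (by
      rintro (_ | _ | p)
      · exact ⟨1, by simp [eighthRootPoly], by norm_num⟩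
      · exact ⟨2, by simp [invSqrtTwoPoly], by norm_num⟩
      · exact (hc p.1 p.2).1)
    (by
      rintro (_ | _ | p)
      · exact aeval_eighthRootPoly
      · exact aeval_invSqrtTwoPoly
      · exact (aeval_intPoly _ _).trans (hc p.1 p.2).2.1)
  refine ⟨K, h1, h2.trans (le_of_eq ?_), ⟨?_, ?_, ?_, ?_⟩, fun i j => ?_⟩
  · rw [Fintype.prod_option, Fintype.prod_option, Fintype.prod_prod_type]
    simp only [eighthRootPoly, invSqrtTwoPoly, List.length_cons, List.length_nil]
    ring
  · exact (h3 (some none)).1.mono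
      (show leadBound invSqrtTwoPoly ∣ 2 by decide) (show rootBound invSqrtTwoPoly ≤ 4 by decide)
  · exact (h3 (some none)).2.mono
      (show leadBound invSqrtTwoPoly ∣ 2 by decide) (show rootBound invSqrtTwoPoly ≤ 4 by decide)
  · exact (h3 none).1.mono
      (show leadBound eighthRootPoly ∣ 2 by decide) (show rootBound eighthRootPoly ≤ 4 by decide)
  · exact (h3 none).2.mono
      (show leadBound eighthRootPoly ∣ 2 by decide) (show rootBound eighthRootPoly ≤ 4 by decide)
  · have e1 : leadBound (c i j).1 ∣ ∏ i, ∏ j, leadBound (c i j).1 :=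
      (Finset.dvd_prod_of_mem (fun j => leadBound (c i j).1) (Finset.mem_univ j)).trans
        (Finset.dvd_prod_of_mem (fun i => ∏ j, leadBound (c i j).1) (Finset.mem_univ i))
    have e2 : rootBound (c i j).1 ≤ ∑ i, ∑ j, rootBound (c i j).1 :=
      (Finset.single_le_sum (f := fun j => rootBound (c i j).1) (fun _ _ => Nat.zero_le _)
        (Finset.mem_univ j)).trans
        (Finset.single_le_sum (f := fun i => ∑ j, rootBound (c i j).1) (fun _ _ => Nat.zero_le _)
          (Finset.mem_univ i))
    exact ⟨(h3 (some (some (i, j)))).1.mono e1 e2, (h3 (some (some (i, j)))).2.mono e1 e2⟩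

def gapBound (N A H D u v : ℕ) : ℕ := A * (A * (u * (N * H) + v) + 1) ^ (D * N)

theorem gap_of_matSize {n : ℕ} {K : IntermediateField ℚ ℂ} [FiniteDimensional ℚ K] {D : ℕ}
    (hD : Module.finrank ℚ K ≤ D) {A H : ℕ} {X : Op n} (hX : MatSize K A H X)
    (hh : X.IsHermitian) (u v : ℕ) (hv : v ≠ 0) (hA : A ≠ 0) (i : Bits n) :
    (u / v : ℝ) * hh.eigenvalues i = 1 ∨
      1 ≤ |(u / v : ℝ) * hh.eigenvalues i - 1| * (v * gapBound (2 ^ n) A H D u v : ℕ) := by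
  have hv' : (v : ℝ) ≠ 0 := Nat.cast_ne_zero.2 hv
  -- This identity accounts for the factor v in front of `gapBound`.
  have e : (u : ℝ) * hh.eigenvalues i - v = v * ((u / v : ℝ) * hh.eigenvalues i - 1) := by
    field_simp
  by_cases h : (u / v : ℝ) * hh.eigenvalues i = 1
  · exact Or.inl h
  · right
    have h1 := one_le_norm_sub_mul hD (fun i j => (hX i j).1) (isRoot_eigenvalue hh i) u v hA (by
      have : (u : ℝ) * hh.eigenvalues i - v ≠ 0 := by
        rw [e]; exact mul_ne_zero hv' (sub_ne_zero.2 h)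
      exact_mod_cast this)
    rw [card_bits] at h1
    have h2 : ‖(u : ℂ) * (hh.eigenvalues i : ℂ) - v‖ =
        v * |(u / v : ℝ) * hh.eigenvalues i - 1| := by
      rw [← Nat.abs_cast (R := ℝ) v, ← abs_mul, Nat.abs_cast, ← e, ← Real.norm_eq_abs,
        ← Complex.norm_real]
      push_cast
      rfl
    rw [h2] at h1
    unfold gapBound
    rw [Nat.cast_mul]
    linarith

@[fun_prop] theorem computable_gapBound {α : Type*} [Primcodable α] {N A H D u v : α → ℕ}
    (hN : Computable N) (hA : Computable A) (hH : Computable H) (hD : Computable D)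
    (hu : Computable u) (hv : Computable v) :
    Computable (fun a => gapBound (N a) (A a) (H a) (D a) (u a) (v a)) := by
  unfold gapBound; fun_prop

@[fun_prop] theorem computable_leadBound {α : Type*} [Primcodable α] {l : α → List ℤ}
    (hl : Computable l) : Computable (fun a => leadBound (l a)) := by
  unfold leadBound; fun_prop

@[fun_prop] theorem computable_rootBound {α : Type*} [Primcodable α] {l : α → List ℤ}
    (hl : Computable l) : Computable (fun a => rootBound (l a)) := by
  unfold rootBound; fun_prop

/-! ### The two conditions on a circuit and their decidability -/

theorem Circuit.acceptProb_pureState (C : Circuit) (ψ : Bits C.witness → ℂ) :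
    C.acceptProb (pureState ψ) = expect C.acceptOp ψ := by
  rw [C.acceptProb_eq, re_trace_mul_pureState]

theorem Circuit.acceptProb_channel (C : Circuit) {Φ : QuantumChannel C.witness} {l : ℕ}
    {V : Op (C.witness + l)} (h : IsStinespringDilation Φ l V) (ψ : Bits C.witness → ℂ) :
    C.acceptProb (Φ.map (pureState ψ)) = expect (dilatedOp l V C.acceptOp) ψ := by
  rw [C.acceptProb_eq, trace_mul_channel h, re_trace_mul_pureState]

/-- Some witness is accepted with probability at least `2 / 3` after it has passed the channel. -/
def AcceptsNoisy (E : ∀ m, QuantumChannel m) (C : Circuit) : Prop :=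
  ∃ ψ : Bits C.witness → ℂ, IsState ψ ∧ 2 / 3 ≤ C.acceptProb ((E _).map (pureState ψ))

/-- All noiseless witnesses are accepted with probability at most `1 / 3`. -/
def RejectsAll (C : Circuit) : Prop :=
  ∀ ψ : Bits C.witness → ℂ, IsState ψ → C.acceptProb (pureState ψ) ≤ 1 / 3

/-- Rejection of all pure states means Q ≤ 1/3 as operators. The dual of the channel is positive and
unital, so R ≤ 1/3, and no state reaches 2/3 behind the channel. -/
theorem not_acceptsNoisy_of_rejectsAll {E : ∀ m, QuantumChannel m}
    (hE : HasComputableStinespringDilation E) {C : Circuit} (h : RejectsAll C) :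
    ¬ AcceptsNoisy E C := by
  obtain ⟨l, V, entry, -, -, hV⟩ := hE
  rintro ⟨ψ, hψ, h2⟩
  rw [C.acceptProb_channel (hV C.witness).1] at h2
  have hQ := C.posSemidef_acceptOp
  have h3 := (posSemidef_smul_one_sub_iff hQ.1 (1 / 3)).2
    ((forall_state_expect_le_iff hQ.1 (1 / 3)).1 fun φ hφ => by
      rw [← C.acceptProb_pureState]; exact h φ hφ)
  have h4 := posSemidef_dilatedOp (V C.witness) h3
  rw [dilatedOp_sub (hV C.witness).1.1] at h4
  linarith [expect_le_of_posSemidef h4 hψ]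

section
variable {l : ℕ → ℕ} {V : ∀ m, Op (m + l m)} {entry : ℕ × List Bool × List Bool → AlgebraicCode}

/-- The description of the entry whose row and column have the numbers `s` and `t`. -/
def entryAt (l : ℕ → ℕ) (entry : ℕ × List Bool × List Bool → AlgebraicCode) (m s t : ℕ) :
    AlgebraicCode :=
  entry (m, (List.range (m + l m)).map s.testBit, (List.range (m + l m)).map t.testBit)

theorem computable_entryAt {α : Type*} [Primcodable α] (hl : Computable l) (he : Computable entry)
    {m s t : α → ℕ} (hm : Computable m) (hs : Computable s) (ht : Computable t) :
    Computable (fun a => entryAt l entry (m a) (s a) (t a)) := by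
  unfold entryAt; fun_prop

theorem entryAt_represents (hV : ∀ m i j, (entry (m, List.ofFn i, List.ofFn j)).Represents (V m i j))
    (m s t : ℕ) : (entryAt l entry m s t).Represents
      (V m (bitsOf (m + l m) s) (bitsOf (m + l m) t)) := by
  rw [entryAt, ← ofFn_bitsOf, ← ofFn_bitsOf]
  exact hV m _ _

theorem compMat_dilation (hl : Computable l) (he : Computable entry)
    (hV : ∀ m i j, (entry (m, List.ofFn i, List.ofFn j)).Represents (V m i j)) :
    CompMat (n := fun m => m + l m) V :=
  compC_of_represents (r := fun p : ℕ × ℕ × ℕ => entryAt l entry p.1 p.2.1 p.2.2)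
    (computable_entryAt hl he (by fun_prop) (by fun_prop) (by fun_prop))
    fun p => entryAt_represents hV _ _ _

/-- The field itself is never computed. The gap needs only the numerical bounds, which are read off
the codes of all entries. -/
theorem exists_size_bounds (hl : Computable l) (he : Computable entry)
    (hV : ∀ m i j, (entry (m, List.ofFn i, List.ofFn j)).Represents (V m i j)) :
    ∃ D A H : ℕ → ℕ, Computable D ∧ Computable A ∧ Computable H ∧ ∀ m, A m ≠ 0 ∧
      ∃ K : IntermediateField ℚ ℂ, FiniteDimensional ℚ K ∧ Module.finrank ℚ K ≤ D m ∧
        ContainsGates K ∧ MatSize K (A m) (H m) (V m) := by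
  have hc : Computable (fun p : (ℕ × ℕ) × ℕ => (entryAt l entry p.1.1 p.1.2 p.2).1) :=
    computable_fst (computable_entryAt hl he (by fun_prop) (by fun_prop) (by fun_prop))
  refine ⟨fun m => (3 * (5 * ∏ s ∈ Finset.range (2 ^ (m + l m)), ∏ t ∈ Finset.range (2 ^ (m + l m)),
      (entryAt l entry m s t).1.length)) ^ 2,
    fun m => ∏ s ∈ Finset.range (2 ^ (m + l m)), ∏ t ∈ Finset.range (2 ^ (m + l m)),
      leadBound (entryAt l entry m s t).1,
    fun m => ∑ s ∈ Finset.range (2 ^ (m + l m)), ∑ t ∈ Finset.range (2 ^ (m + l m)),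
      rootBound (entryAt l entry m s t).1, ?_, ?_, ?_, fun m => ⟨?_, ?_⟩⟩
  · have : Computable (fun m => ∏ s ∈ Finset.range (2 ^ (m + l m)),
        ∏ t ∈ Finset.range (2 ^ (m + l m)), (entryAt l entry m s t).1.length) :=
      computable_prod_range (by fun_prop) (computable_prod_range
        (f := fun p : ℕ × ℕ => 2 ^ (p.1 + l p.1)) (by fun_prop) (computable_length hc))
    fun_prop
  · exact computable_prod_range (by fun_prop) (computable_prod_range
      (f := fun p : ℕ × ℕ => 2 ^ (p.1 + l p.1)) (by fun_prop) (computable_leadBound hc))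
  · exact computable_sum_range (by fun_prop) (computable_sum_range
      (f := fun p : ℕ × ℕ => 2 ^ (p.1 + l p.1)) (by fun_prop) (computable_rootBound hc))
  · exact Finset.prod_ne_zero_iff.2 fun s _ => Finset.prod_ne_zero_iff.2 fun t _ =>
      leadBound_ne_zero _
  · obtain ⟨K, h1, h2, h3, h4⟩ := exists_field_of_codes (hV m)
    refine ⟨K, h1, ?_, h3, ?_⟩
    · simpa only [prod_bits, entryAt, ofFn_bitsOf] using h2
    · simpa only [prod_bits, sum_bits, entryAt, ofFn_bitsOf] using h4

open Classical in
-- The threshold 2/3 for R is the non-strict test with c = 3/2. The threshold 1/3 for Q is the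
-- negation of the strict test with c = 3.
theorem computable_verdicts {E : ∀ m, QuantumChannel m} (hE : HasComputableStinespringDilation E) :
    Computable (fun w => decide (AcceptsNoisy E (Circuit.ofString w))) ∧
    Computable (fun w => decide (RejectsAll (Circuit.ofString w))) := by
  obtain ⟨l, V, entry, hl, he, hEV⟩ := hE
  have hV := fun m => (hEV m).2
  obtain ⟨D, A, H, hD, hA, hH, hs⟩ := exists_size_bounds hl he hV
  have hm : Computable (fun w => (Circuit.ofString w).witness) := computable_witness computable_id
  have hk : Computable (fun w => (Circuit.ofString w).ancilla) := computable_ancilla computable_id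
  have hg : Computable (fun w => (Circuit.ofString w).gates.length) :=
    computable_length_gates computable_id
  -- `AQ` and `HQ` are the bounds from `matSize_acceptOp`; those for the dilated operator follow
  -- from `matSize_dilatedOp`.
  let AQ : List Bool → ℕ := fun w =>
    2 ^ (Circuit.ofString w).gates.length * 2 ^ (Circuit.ofString w).gates.length
  let HQ : List Bool → ℕ := fun w =>
    2 ^ ((Circuit.ofString w).witness + (Circuit.ofString w).ancilla) *
      (2 ^ ((Circuit.ofString w).witness + (Circuit.ofString w).ancilla) *
        (2 ^ ((Circuit.ofString w).witness + (Circuit.ofString w).ancilla) * 4) ^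
          (Circuit.ofString w).gates.length *
        (2 ^ ((Circuit.ofString w).witness + (Circuit.ofString w).ancilla) * 4) ^
          (Circuit.ofString w).gates.length)
  have hAQ : Computable AQ := by fun_prop
  have hHQ : Computable HQ := by fun_prop
  have hHQ1 : ∀ w, 1 ≤ HQ w := fun w => Nat.one_le_iff_ne_zero.2 (by positivity)
  let N : List Bool → ℕ := fun w =>
    2 ^ ((Circuit.ofString w).witness + l (Circuit.ofString w).witness)
  have hN : Computable N := by fun_prop
  let mw : List Bool → ℕ := fun w => (Circuit.ofString w).witness
  have hAR : Computable (fun w => A (mw w) * AQ w * A (mw w)) := by fun_prop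
  have hHR : Computable (fun w => N w * (N w * (H (mw w) * HQ w) * H (mw w))) := by fun_prop
  constructor
  · have hX : CompMat (fun w => dilatedOp (l (mw w)) (V (mw w)) (Circuit.ofString w).acceptOp) := by
      have hVw := (compMat_dilation hl he hV).comp (h := mw) hm
      have hn : Computable (fun w => mw w + l (mw w)) := by fun_prop
      exact CompMat.compress (k := fun w => l (mw w)) hm (CompMat.mul hn (CompMat.mul hn
        hVw.conjTranspose (CompMat.ampliation hm (hl.comp hm) compMat_acceptOp)) hVw)
    have hp := fun w => posSemidef_dilatedOp (V (mw w)) (Circuit.ofString w).posSemidef_acceptOp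
    refine computable_decide_iff (fun w => ?_) (computable_exists_one_le (c := (3 : ℕ) / (2 : ℕ))
      hm hX hp (by positivity) ?_
      (b := fun w => 2 * gapBound (2 ^ mw w) (A (mw w) * AQ w * A (mw w))
        (N w * (N w * (H (mw w) * HQ w) * H (mw w))) (D (mw w)) 3 2) ?_ ?_ ?_)
    · have h1 := exists_state_le_expect_iff (hp w).1 (2 / 3)
      have h2 : AcceptsNoisy E (Circuit.ofString w) ↔ ∃ ψ, IsState ψ ∧
          2 / 3 ≤ expect (dilatedOp (l (mw w)) (V (mw w)) (Circuit.ofString w).acceptOp) ψ :=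
        exists_congr fun ψ => and_congr_right fun _ => by
          rw [Circuit.acceptProb_channel _ (hEV _).1]
      rw [h2, h1]
      exact exists_congr fun i => by push_cast; constructor <;> intro h <;> linarith
    · exact (compC_val (computable_const (((3, 0), 1) : GaussDyadic))).of_eq fun _ => by
        simp [GaussDyadic.val]
    · exact computable_nat_mul (by fun_prop) (computable_gapBound (by fun_prop) hAR hHR
        (by fun_prop) (by fun_prop) (by fun_prop))
    · intro w
      have : A (mw w) ≠ 0 := (hs _).1
      simp only [gapBound]
      positivity
    · intro w i
      obtain ⟨hA0, K, hK, hKD, hKg, hKV⟩ := hs (mw w)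
      exact gap_of_matSize hKD
        (matSize_dilatedOp hKV (matSize_acceptOp hKg (Circuit.ofString w)) (hHQ1 w)) (hp w).1 3 2
        (by norm_num) (by positivity) i
  · have hp := fun w => (Circuit.ofString w).posSemidef_acceptOp
    have h0 := computable_exists_one_lt (c := (3 : ℕ) / (1 : ℕ)) hm compMat_acceptOp hp
      (by positivity)
      ((compC_natCast (computable_const 3)).of_eq fun _ => by simp)
      (b := fun w => 1 * gapBound (2 ^ mw w) (AQ w) (HQ w) (D (mw w)) 3 1)
      (computable_nat_mul (by fun_prop) (computable_gapBound (by fun_prop) hAQ hHQ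
        (by fun_prop) (by fun_prop) (by fun_prop)))
      (fun w => by simp only [gapBound]; positivity)
      (fun w i => by
        obtain ⟨hA0, K, hK, hKD, hKg, hKV⟩ := hs (mw w)
        exact gap_of_matSize hKD (matSize_acceptOp hKg (Circuit.ofString w)) (hp w).1 3 1
          (by norm_num) (by positivity) i)
    refine computable_decide_iff (fun w => ?_) (computable_decide_not h0)
    have h2 : RejectsAll (Circuit.ofString w) ↔ ∀ ψ, IsState ψ →
        expect (Circuit.ofString w).acceptOp ψ ≤ 1 / 3 :=
      forall_congr' fun ψ => imp_congr_right fun _ => by rw [Circuit.acceptProb_pureState]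
    rw [h2, forall_state_expect_le_iff (hp w).1]
    simp only [not_exists, not_lt]
    exact forall_congr' fun i => by push_cast; constructor <;> intro h <;> linarith

end

end NoisyQMA

namespace NoisyQMA

/-! ## Simulation of Turing machines -/

/-- Descriptions of Turing machines by finite data: number of states, initial state, list of the
values of `final`, and the transition table, whose entries consist of the new state, the symbol
written, and the head movement (`some true` is to the right). -/
abbrev DTMCode : Type := ℕ × ℕ × List Bool × List (ℕ × Option Bool × Option Bool)

def symbolIndex : Option Bool → ℕ
  | none => 0
  | some false => 1
  | some true => 2

def direction (b : Bool) : Turing.Dir := if b then .right else .left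

def DTMCode.entry (r : DTMCode) (q : ℕ) (a : Option Bool) : ℕ × Option Bool × Option Bool :=
  r.2.2.2.getD (3 * q + symbolIndex a) (0, none, none)

/-- Reduction modulo the number of states and default table values make every tuple a machine, so
codes need no syntactic check. -/
def DTMCode.toDTM (r : DTMCode) : DTM where
  numStates := r.1
  initial := Fin.ofNat (r.1 + 1) r.2.1
  final q := r.2.2.1.getD q false
  transition q a := (Fin.ofNat (r.1 + 1) (r.entry q a).1, (r.entry q a).2.1,
    (r.entry q a).2.2.map direction)

def symbolOfIndex (i : ℕ) : Option Bool := if i = 0 then none else some (decide (i = 2))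

theorem DTMCode.toDTM_surjective : Function.Surjective DTMCode.toDTM := by
  rintro ⟨n, q₀, f, t⟩
  let s : Fin (3 * (n + 1)) → ℕ × Option Bool × Option Bool := fun i =>
    let e := t ⟨i / 3, by omega⟩ (symbolOfIndex (i % 3))
    (e.1, e.2.1, e.2.2.map fun d => decide (d = .right))
  refine ⟨(n, q₀, List.ofFn f, List.ofFn s), ?_⟩
  have h1 : ∀ q : Fin (n + 1), (List.ofFn f).getD q false = f q := fun q => by
    rw [List.getD_eq_getElem _ _ (by rw [List.length_ofFn]; exact q.2), List.getElem_ofFn]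
  have h2 : ∀ (q : Fin (n + 1)) a, (List.ofFn s).getD (3 * q + symbolIndex a) (0, none, none) =
      (((t q a).1 : ℕ), (t q a).2.1, (t q a).2.2.map fun d => decide (d = .right)) := by
    intro q a
    have h3 : symbolIndex a < 3 := by rcases a with _ | _ | _ <;> simp [symbolIndex]
    have h4 : symbolOfIndex (symbolIndex a) = a := by
      rcases a with _ | _ | _ <;> simp [symbolIndex, symbolOfIndex]
    rw [List.getD_eq_getElem _ _ (by simp; omega), List.getElem_ofFn]
    have h5 : (3 * (q : ℕ) + symbolIndex a) / 3 = q := by omega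
    have h6 : (3 * (q : ℕ) + symbolIndex a) % 3 = symbolIndex a := by omega
    simp only [s, h5, h6, h4]
  have h7 : ∀ d : Option Turing.Dir,
      (d.map fun d => decide (d = Turing.Dir.right)).map direction = d := by
    rintro (_ | _ | _) <;> simp [direction]
  simp only [toDTM, DTMCode.entry, h1, h2, h7, Fin.ofNat_eq_cast, Fin.cast_val_eq_self]

/-- Configurations: the state, the tape to the left of the head, and the tape from the head on. -/
abbrev RawCfg : Type := ℕ × List (Option Bool) × List (Option Bool)

def headSymbol (l : List (Option Bool)) : Option Bool := l.head?.getD none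

theorem headSymbol_eq (l : List (Option Bool)) : headSymbol l = l.headI := by
  cases l <;> rfl

def moveTape (d a : Option Bool) (L R : List (Option Bool)) :
    List (Option Bool) × List (Option Bool) :=
  if d = none then (L, a :: R.tail)
  else if d = some true then (a :: L, R.tail)
  else (L.tail, headSymbol L :: a :: R.tail)

def rawTape (p : List (Option Bool) × List (Option Bool)) : Turing.Tape (Option Bool) :=
  Turing.Tape.mk' (Turing.ListBlank.mk p.1) (Turing.ListBlank.mk p.2)

theorem rawTape_moveTape (d a : Option Bool) (p : List (Option Bool) × List (Option Bool)) :
    rawTape (moveTape d a p.1 p.2) = match d.map direction with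
      | none => (rawTape p).write a
      | some d => ((rawTape p).write a).move d := by
  rcases d with _ | _ | _ <;>
    simp [moveTape, rawTape, direction, headSymbol_eq, Turing.ListBlank.cons_mk,
      Turing.ListBlank.tail_mk, Turing.ListBlank.head_mk]

def DTMCode.step (r : DTMCode) (c : RawCfg) : RawCfg :=
  if r.2.2.1.getD c.1 false = true then c
  else ((r.entry c.1 (headSymbol c.2.2)).1 % (r.1 + 1),
    moveTape (r.entry c.1 (headSymbol c.2.2)).2.2 (r.entry c.1 (headSymbol c.2.2)).2.1 c.2.1 c.2.2)

def DTMCode.run (r : DTMCode) (x : List Bool) (n : ℕ) : RawCfg :=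
  r.step^[n] (r.2.1 % (r.1 + 1), [], x.map some)

theorem DTMCode.run_spec (r : DTMCode) (x : List Bool) (n : ℕ) :
    ((r.toDTM.step^[n] (r.toDTM.start x)).state : ℕ) = (r.run x n).1 ∧
      (r.toDTM.step^[n] (r.toDTM.start x)).tape = rawTape (r.run x n).2 := by
  induction n with
  | zero => exact ⟨rfl, rfl⟩
  | succ n ih =>
    have h1 : r.run x (n + 1) = r.step (r.run x n) := Function.iterate_succ_apply' _ _ _
    rw [Function.iterate_succ_apply', h1]
    generalize r.toDTM.step^[n] (r.toDTM.start x) = c at ih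
    generalize r.run x n = c' at ih
    obtain ⟨h2, h3⟩ := ih
    have hf : r.toDTM.final c.state = r.2.2.1.getD c'.1 false := by rw [← h2]; rfl
    unfold DTM.step DTMCode.step
    rw [hf]
    by_cases h : r.2.2.1.getD c'.1 false = true
    · rw [if_pos h, if_pos h]
      exact ⟨h2, h3⟩
    · rw [if_neg h, if_neg h]
      have hh : c.tape.head = headSymbol c'.2.2 := by rw [h3, headSymbol_eq]; rfl
      have ht : r.toDTM.transition c.state c.tape.head =
          (Fin.ofNat (r.1 + 1) (r.entry c'.1 (headSymbol c'.2.2)).1,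
            (r.entry c'.1 (headSymbol c'.2.2)).2.1,
            (r.entry c'.1 (headSymbol c'.2.2)).2.2.map direction) := by
        rw [hh, ← h2]; rfl
      simp only [ht]
      refine ⟨rfl, ?_⟩
      rw [h3]
      exact (rawTape_moveTape _ _ _).symm

/-- The string up to the first blank. -/
def readOff (l : List (Option Bool)) : List Bool :=
  l.foldr (fun a w => if a = none then [] else a.getD false :: w) []

theorem readOff_some (b : Bool) (l : List (Option Bool)) :
    readOff (some b :: l) = b :: readOff l := rfl

/-- The case i = w.length requires a blank behind w; this is what determines w uniquely. -/
theorem getI_iff_readOff (l : List (Option Bool)) (w : List Bool) :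
    (∀ i : ℕ, i ≤ w.length → l.getI i = w[i]?) ↔ readOff l = w := by
  induction l generalizing w with
  | nil =>
    constructor
    · intro h
      cases w with
      | nil => rfl
      | cons b w => simpa using h 0 (Nat.zero_le _)
    · rintro rfl i -
      simp only [List.getI_nil, readOff, List.foldr_nil, List.getElem?_nil]
      rfl
  | cons a l ih =>
    rcases a with _ | b
    · have h1 : readOff (none :: l) = [] := rfl
      rw [h1]
      constructor
      · intro h
        cases w with
        | nil => rfl
        | cons b w => simpa using h 0 (Nat.zero_le _)
      · rintro rfl i hi
        obtain rfl : i = 0 := by simpa using hi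
        rfl
    · rw [readOff_some]
      constructor
      · intro h
        cases w with
        | nil => simpa using h 0 (Nat.zero_le _)
        | cons b' w =>
          have h0 := h 0 (Nat.zero_le _)
          simp only [List.getI_cons_zero, List.getElem?_cons_zero, Option.some.injEq] at h0
          rw [h0, (ih w).1 fun i hi => by simpa using h (i + 1) (by simpa using hi)]
      · rintro rfl i hi
        cases i with
        | zero => rfl
        | succ i => simpa using (ih (readOff l)).2 rfl i (by simpa using hi)

theorem reads_rawTape (p : List (Option Bool) × List (Option Bool)) (w : List Bool) :
    Reads (rawTape p) w ↔ readOff p.2 = w := by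
  rw [← getI_iff_readOff]
  refine forall_congr' fun i => imp_congr_right fun _ => ?_
  rw [rawTape, Turing.Tape.mk'_nth_nat, Turing.ListBlank.nth_mk]

/-- The output, if the machine has halted after `n` steps. -/
def DTMCode.output (r : DTMCode) (x : List Bool) (n : ℕ) : Option (List Bool) :=
  if r.2.2.1.getD (r.run x n).1 false = true then some (readOff (r.run x n).2.2) else none

theorem DTMCode.outputsWithin_iff (r : DTMCode) (x w : List Bool) (n : ℕ) :
    r.toDTM.OutputsWithin x w n ↔ r.output x n = some w := by
  obtain ⟨h1, h2⟩ := r.run_spec x n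
  rw [DTM.OutputsWithin, h2, reads_rawTape]
  have h3 : r.toDTM.final (r.toDTM.step^[n] (r.toDTM.start x)).state =
      r.2.2.1.getD (r.run x n).1 false := by rw [← h1]; rfl
  rw [h3, DTMCode.output]
  split_ifs with h
  · rw [Option.some.injEq]
    exact and_iff_right h
  · exact iff_of_false (fun h' => h h'.1) (by simp)

/-- Final configurations are fixed points of `DTM.step`. -/
theorem DTM.OutputsWithin.mono {M : DTM} {x w : List Bool} {n n' : ℕ} (h : M.OutputsWithin x w n)
    (hn : n ≤ n') : M.OutputsWithin x w n' := by
  induction n', hn using Nat.le_induction with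
  | base => exact h
  | succ k _ ih =>
    have : M.step^[k + 1] (M.start x) = M.step^[k] (M.start x) := by
      rw [Function.iterate_succ_apply', DTM.step, if_pos ih.1]
    rw [DTM.OutputsWithin, this]
    exact ih

section
variable {α : Type*} [Primcodable α]

@[fun_prop] theorem computable_symbolIndex {a : α → Option Bool} (ha : Computable a) :
    Computable (fun x => symbolIndex (a x)) := (Primrec.dom_finite symbolIndex).to_comp.comp ha

@[fun_prop] theorem computable_entry {r : α → DTMCode} {q : α → ℕ} {a : α → Option Bool}
    (hr : Computable r) (hq : Computable q) (ha : Computable a) :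
    Computable (fun x => (r x).entry (q x) (a x)) := by
  unfold DTMCode.entry; fun_prop

@[fun_prop] theorem computable_headSymbol {l : α → List (Option Bool)} (hl : Computable l) :
    Computable (fun x => headSymbol (l x)) := by
  unfold headSymbol; fun_prop

@[fun_prop] theorem computable_moveTape {d a : α → Option Bool} {L R : α → List (Option Bool)}
    (hd : Computable d) (ha : Computable a) (hL : Computable L) (hR : Computable R) :
    Computable (fun x => moveTape (d x) (a x) (L x) (R x)) := by
  unfold moveTape; fun_prop

@[fun_prop] theorem computable_step {r : α → DTMCode} {c : α → RawCfg}
    (hr : Computable r) (hc : Computable c) : Computable (fun x => (r x).step (c x)) := by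
  have he : Computable (fun x => (r x).entry (c x).1 (headSymbol (c x).2.2)) := by fun_prop
  have h1 : Computable (fun x => decide ((r x).2.2.1.getD (c x).1 false = true)) :=
    computable_decide_eq (computable_getD (by fun_prop) (by fun_prop) (by fun_prop))
      (computable_const true)
  have h2 : Computable (fun x => ((r x).entry (c x).1 (headSymbol (c x).2.2)).1 % ((r x).1 + 1)) :=
    computable_nat_mod (by fun_prop) (by fun_prop)
  exact computable_ite h1 hc (computable_mk h2
    (computable_moveTape (by fun_prop) (by fun_prop) (by fun_prop) (by fun_prop)))

@[fun_prop] theorem computable_run {r : α → DTMCode} {x : α → List Bool} {n : α → ℕ}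
    (hr : Computable r) (hx : Computable x) (hn : Computable n) :
    Computable (fun a => (r a).run (x a) (n a)) := by
  unfold DTMCode.run
  exact computable_iterate hn (computable_mk (computable_nat_mod (by fun_prop) (by fun_prop))
    (computable_mk (computable_const []) (computable_map hx (by fun_prop)))) (by fun_prop)

@[fun_prop] theorem computable_readOff {l : α → List (Option Bool)} (hl : Computable l) :
    Computable (fun a => readOff (l a)) := by
  unfold readOff; fun_prop

@[fun_prop] theorem computable_output {r : α → DTMCode} {x : α → List Bool} {n : α → ℕ}
    (hr : Computable r) (hx : Computable x) (hn : Computable n) :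
    Computable (fun a => (r a).output (x a) (n a)) := by
  unfold DTMCode.output
  have h := computable_run hr hx hn
  exact computable_ite (computable_decide_eq (computable_getD (by fun_prop) (by fun_prop)
    (by fun_prop)) (computable_const true)) (by fun_prop) (by fun_prop)

end

end NoisyQMA

namespace NoisyQMA

/-! ## Machines with a lookup table -/

section
variable {S : Type*}

/-- One step of a machine whose set of states may be infinite. -/
def abstractStep (fin : S → Bool) (trans : S → Option Bool → S × Option Bool × Option Bool)
    (c : S × List (Option Bool) × List (Option Bool)) :
    S × List (Option Bool) × List (Option Bool) :=
  if fin c.1 = true then c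
  else ((trans c.1 (headSymbol c.2.2)).1,
    moveTape (trans c.1 (headSymbol c.2.2)).2.2 (trans c.1 (headSymbol c.2.2)).2.1 c.2.1 c.2.2)

/-- A machine that stays within a finite set of states is a Turing machine. -/
theorem exists_dtm_of_finite (fin : S → Bool)
    (trans : S → Option Bool → S × Option Bool × Option Bool) (s₀ : S) {F : Set S} (hF : F.Finite)
    (h₀ : s₀ ∈ F) (hcl : ∀ s ∈ F, ∀ a, (trans s a).1 ∈ F) :
    ∃ M : DTM, ∀ x w n, fin ((abstractStep fin trans)^[n] (s₀, [], x.map some)).1 = true →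
      readOff ((abstractStep fin trans)^[n] (s₀, [], x.map some)).2.2 = w →
      M.OutputsWithin x w n := by
  have := hF.to_subtype
  obtain ⟨N, hN⟩ : ∃ N, Nat.card F = N + 1 :=
    ⟨Nat.card F - 1, by
      have : 0 < Nat.card F := Nat.card_pos_iff.2 ⟨⟨⟨s₀, h₀⟩⟩, this⟩
      omega⟩
  let e : F ≃ Fin (N + 1) := (Finite.equivFin F).trans (finCongr hN)
  let M : DTM :=
    { numStates := N
      initial := e ⟨s₀, h₀⟩
      final := fun q => fin (e.symm q)
      transition := fun q a => (e ⟨(trans (e.symm q) a).1, hcl _ (e.symm q).2 a⟩,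
        (trans (e.symm q) a).2.1, (trans (e.symm q) a).2.2.map direction) }
  have key : ∀ x n, ((e.symm (M.step^[n] (M.start x)).state : F) : S) =
      ((abstractStep fin trans)^[n] (s₀, [], x.map some)).1 ∧ (M.step^[n] (M.start x)).tape =
        rawTape ((abstractStep fin trans)^[n] (s₀, [], x.map some)).2 := by
    intro x n
    induction n with
    | zero => exact ⟨by simp [M, DTM.start], rfl⟩
    | succ n ih =>
      rw [Function.iterate_succ_apply', Function.iterate_succ_apply']
      generalize M.step^[n] (M.start x) = c at ih
      generalize (abstractStep fin trans)^[n] (s₀, [], x.map some) = c' at ih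
      obtain ⟨h2, h3⟩ := ih
      have hf : M.final c.state = fin c'.1 := by rw [← h2]
      unfold DTM.step abstractStep
      rw [hf]
      by_cases h : fin c'.1 = true
      · rw [if_pos h, if_pos h]
        exact ⟨h2, h3⟩
      · rw [if_neg h, if_neg h]
        have hh : c.tape.head = headSymbol c'.2.2 := by rw [h3, headSymbol_eq]; rfl
        simp only [hh, M, h2, Equiv.symm_apply_apply, true_and]
        rw [h3]
        exact (rawTape_moveTape _ _ _).symm
  refine ⟨M, fun x w n h1 h2 => ?_⟩
  obtain ⟨h3, h4⟩ := key x n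
  rw [DTM.OutputsWithin, h4, reads_rawTape]
  exact ⟨by rw [← h1, ← h3], h2⟩

end

/-- In `read p` the prefix p has been read; in `write w k` the string w is still to be written after
k symbols; in `back k` there are k moves to the left to go. -/
inductive LookupState where
  | read (p : List Bool)
  | write (w : List Bool) (k : ℕ)
  | back (k : ℕ)

namespace LookupState

/-- The machine reads up to `L` symbols, looks up the output in a table, writes it, and moves back
to its first symbol. -/
def next (f : List Bool → List Bool) (L : ℕ) (d : List Bool) :
    LookupState → Option Bool → LookupState × Option Bool × Option Bool
  | read p, some b => if p.length < L then (read (p ++ [b]), some b, some true)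
      else (write d 0, some b, none)
  | read p, none => (write (f p) 0, none, none)
  | write (b :: w) k, _ => (write w (k + 1), some b, some true)
  | write [] k, _ => (back k, none, none)
  | back (k + 1), a => (back k, a, some false)
  | back 0, a => (back 0, a, none)

def isDone : LookupState → Bool
  | back 0 => true
  | _ => false

variable {f : List Bool → List Bool} {L : ℕ} {d : List Bool}

/-- Reading stops at the end of the input or at a symbol beyond the first L. In the second case the
input is longer than L, and its value is known to be d. -/
theorem steps_read (hf : ∀ x, L < x.length → f x = d) (rest : List Bool) :
    ∀ p T, p.length ≤ L → ∃ n ≤ rest.length + 1, ∃ T' R,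
      (abstractStep isDone (next f L d))^[n] (read p, T, rest.map some) =
        (write (f (p ++ rest)) 0, T', R) := by
  induction rest with
  | nil =>
    intro p T _
    exact ⟨1, le_rfl, T, [none], by simp [abstractStep, isDone, next, headSymbol, moveTape]⟩
  | cons b rest ih =>
    intro p T hp
    by_cases h : p.length < L
    · obtain ⟨n, hn, T', R, h1⟩ := ih (p ++ [b]) (some b :: T) (by simpa using h)
      refine ⟨n + 1, by simpa using hn, T', R, ?_⟩
      rw [Function.iterate_succ_apply]
      have h2 : abstractStep isDone (next f L d) (read p, T, (b :: rest).map some) =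
          (read (p ++ [b]), some b :: T, rest.map some) := by
        simp [abstractStep, isDone, next, headSymbol, moveTape, h]
      rw [h2, h1]
      simp
    · refine ⟨1, by simp, T, some b :: rest.map some, ?_⟩
      rw [hf (p ++ b :: rest) (by simp; omega)]
      simp [abstractStep, isDone, next, headSymbol, moveTape, h]

/-- The output is followed by a blank, which shields it from unread input still on the tape. -/
theorem steps_write (w : List Bool) : ∀ k T R, ∃ R',
    (abstractStep isDone (next f L d))^[w.length + 1] (write w k, T, R) =
      (back (k + w.length), (w.map some).reverse ++ T, none :: R') := by
  induction w with
  | nil =>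
    intro k T R
    exact ⟨R.tail, by simp [abstractStep, isDone, next, moveTape]⟩
  | cons b w ih =>
    intro k T R
    obtain ⟨R', h⟩ := ih (k + 1) (some b :: T) R.tail
    refine ⟨R', ?_⟩
    rw [List.length_cons, Function.iterate_succ_apply]
    have h2 : abstractStep isDone (next f L d) (write (b :: w) k, T, R) =
        (write w (k + 1), some b :: T, R.tail) := by
      simp [abstractStep, isDone, next, moveTape]
    rw [h2, h]
    simp [add_comm, add_left_comm]

theorem steps_back (u : List (Option Bool)) : ∀ T a R,
    (abstractStep isDone (next f L d))^[u.length] (back u.length, u ++ T, a :: R) =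
      (back 0, T, u.reverse ++ a :: R) := by
  induction u with
  | nil => intro T a R; rfl
  | cons b u ih =>
    intro T a R
    rw [List.length_cons, Function.iterate_succ_apply]
    have h2 : abstractStep isDone (next f L d) (back (u.length + 1), b :: u ++ T, a :: R) =
        (back u.length, u ++ T, b :: a :: R) := by
      simp [abstractStep, isDone, next, moveTape, headSymbol]
    rw [h2, ih]
    simp

theorem readOff_map_some (w : List Bool) (R : List (Option Bool)) :
    readOff (w.map some ++ none :: R) = w := by
  induction w with
  | nil => rfl
  | cons b w ih => rw [List.map_cons, List.cons_append, readOff_some, ih]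

end LookupState

open LookupState in
-- Such a function has finitely many values, so a lookup table fits into finitely many states. This
-- realises the outputs of defective codes.
theorem exists_dtm_of_eventually_const {f : List Bool → List Bool} {L : ℕ} {d : List Bool}
    (hf : ∀ x, L < x.length → f x = d) : ∃ M : DTM, M.ComputesInPolyTime f := by
  obtain ⟨B, hB⟩ : ∃ B, ∀ x, (f x).length ≤ B := by
    obtain ⟨B, hB⟩ := ((List.finite_length_le Bool L).image fun x => (f x).length).bddAbove
    refine ⟨max B d.length, fun x => ?_⟩
    by_cases h : L < x.length
    · rw [hf x h]; exact le_max_right _ _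
    · exact (hB ⟨x, not_lt.1 h, rfl⟩).trans (le_max_left _ _)
  have hd : d.length ≤ B := by
    rw [← hf (List.replicate (L + 1) false) (by simp)]
    exact hB _
  -- Each writing step preserves `w.length + k`, so bounding this sum by B gives a closed set of
  -- states and also bounds the counter of the way back.
  let F : Set LookupState := read '' {p | p.length ≤ L} ∪
    ((fun q : List Bool × ℕ => write q.1 q.2) '' ({w | w.length ≤ B} ×ˢ Set.Iic B) ∩
      {s | ∀ w k, s = write w k → w.length + k ≤ B}) ∪ back '' Set.Iic B
  have hF : F.Finite := ((List.finite_length_le Bool L).image _ |>.union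
    ((((List.finite_length_le Bool B).prod (Set.finite_Iic B)).image _).inter_of_left _)).union
      ((Set.finite_Iic B).image _)
  have hr : ∀ p, p.length ≤ L → read p ∈ F := fun p hp => Or.inl (Or.inl ⟨p, hp, rfl⟩)
  have hw : ∀ w k, w.length + k ≤ B → write w k ∈ F := fun w k hwk =>
    Or.inl (Or.inr ⟨⟨(w, k), ⟨le_trans (Nat.le_add_right _ _) hwk,
      le_trans (Nat.le_add_left _ _) hwk⟩, rfl⟩, by
        rintro w' k' h
        obtain ⟨rfl, rfl⟩ := LookupState.write.inj h
        exact hwk⟩)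
  have hb : ∀ k, k ≤ B → back k ∈ F := fun k hk => Or.inr ⟨k, hk, rfl⟩
  obtain ⟨M, hM⟩ := exists_dtm_of_finite isDone (next f L d) (read []) hF (hr _ (Nat.zero_le _)) (by
    rintro s ((⟨p, hp, rfl⟩ | ⟨⟨⟨w, k⟩, -, rfl⟩, h⟩) | ⟨k, hk, rfl⟩) a
    · rcases a with _ | b
      · exact hw _ _ (hB p)
      · simp only [next]
        split_ifs with h
        · exact hr _ (by simpa using h)
        · exact hw _ _ hd
    · have h1 : w.length + k ≤ B := h w k rfl
      cases w with
      | nil => exact hb _ (by simpa using h1)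
      | cons b w => exact hw _ _ (by simp at h1; omega)
    · cases k with
      | zero => exact hb _ hk
      | succ k => exact hb _ (le_trans (Nat.le_succ _) hk))
  refine ⟨M, Polynomial.X + Polynomial.C (2 * B + 2), fun x => ?_⟩
  obtain ⟨n, hn, T, R, h1⟩ := steps_read hf x [] [] (Nat.zero_le _)
  obtain ⟨R', h2⟩ := steps_write (f := f) (L := L) (d := d) (f x) 0 T R
  have h3 := steps_back (f := f) (L := L) (d := d) ((f x).map some).reverse T none R'
  rw [List.nil_append] at h1
  have h4 : (abstractStep isDone (next f L d))^[(f x).length + ((f x).length + 1 + n)]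
      (read [], [], x.map some) = (back 0, T, (f x).map some ++ none :: R') := by
    rw [Function.iterate_add_apply, Function.iterate_add_apply, h1, h2]
    simpa using h3
  refine (hM x (f x) _ (by rw [h4]; rfl) (by rw [h4]; exact readOff_map_some _ _)).mono ?_
  have := hB x
  simp only [Polynomial.eval_add, Polynomial.eval_X, Polynomial.eval_C]
  omega

end NoisyQMA

namespace NoisyQMA

/-! ## Binary representations -/

/-- The number with the given binary digits, least significant first. -/
def ofDigits (l : List Bool) : ℕ := l.foldr (fun b n => 2 * n + b.toNat) 0

theorem ofDigits_cons (b : Bool) (l : List Bool) : ofDigits (b :: l) = Nat.bit b (ofDigits l) := by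
  change 2 * ofDigits l + b.toNat = _
  cases b <;> simp [Nat.bit]

theorem bits_ofDigits (l : List Bool) (h : l = [] ∨ l.getLast? = some true) :
    (ofDigits l).bits = l := by
  induction l with
  | nil => simp [ofDigits]
  | cons b l ih =>
    rw [ofDigits_cons]
    rcases l with _ | ⟨b', l⟩
    · obtain rfl : b = true := by simpa using h
      simp [ofDigits]
    · have h1 := ih (Or.inr (by simpa using h))
      rw [Nat.bits_append_bit, h1]
      intro h0
      rw [h0] at h1
      simp at h1

theorem ofDigits_bits (n : ℕ) : ofDigits n.bits = n := by
  induction n using Nat.binaryRec' with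
  | zero => simp [ofDigits]
  | bit b n h ih => rw [Nat.bits_append_bit _ _ h, ofDigits_cons, ih]

theorem getLast?_bits {n : ℕ} (hn : n ≠ 0) : n.bits.getLast? = some true := by
  induction n using Nat.binaryRec' with
  | zero => exact absurd rfl hn
  | bit b n h ih =>
    rw [Nat.bits_append_bit _ _ h]
    by_cases h0 : n = 0
    · subst h0
      simp [h rfl]
    · rw [List.getLast?_cons, ih h0]
      rfl

def bitValue (w : List Bool) : ℕ := ofDigits w.reverse

theorem bitValue_bin (n : ℕ) : bitValue (bin n) = n := by
  unfold bin bitValue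
  split_ifs with h
  · simp [h, ofDigits]
  · rw [List.reverse_reverse, ofDigits_bits]

/-- There are no leading zeros. -/
def isBin (w : List Bool) : Bool := decide (w = [false]) || decide (w.head? = some true)

theorem isBin_bin (n : ℕ) : isBin (bin n) = true := by
  unfold bin isBin
  split_ifs with h
  · simp
  · simp [getLast?_bits h]

theorem bin_bitValue {w : List Bool} (h : isBin w = true) : bin (bitValue w) = w := by
  simp only [isBin, Bool.or_eq_true, decide_eq_true_eq] at h
  rcases h with rfl | h
  · simp [bin, bitValue, ofDigits]
  · have h1 : (bitValue w).bits = w.reverse := bits_ofDigits _ (Or.inr (by simpa using h))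
    unfold bin
    split_ifs with h0
    · rw [h0] at h1
      have : w = [] := by simpa using h1.symm
      simp [this] at h
    · rw [h1, List.reverse_reverse]

/-! ## Codes of machines -/

/-- A polynomial bound for runtimes. -/
def clock (c n : ℕ) : ℕ := c * (n + 1) ^ c

theorem clock_mono {c c' : ℕ} (h : c ≤ c') (n : ℕ) : clock c n ≤ clock c' n :=
  Nat.mul_le_mul h (Nat.pow_le_pow_right (Nat.succ_pos _) h)

theorem exists_clock (p : Polynomial ℕ) : ∃ c, ∀ n, p.eval n ≤ clock c n := by
  refine ⟨p.natDegree + ∑ i ∈ Finset.range (p.natDegree + 1), p.coeff i, fun n => ?_⟩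
  rw [Polynomial.eval_eq_sum_range, clock]
  calc ∑ i ∈ Finset.range (p.natDegree + 1), p.coeff i * n ^ i
      ≤ ∑ i ∈ Finset.range (p.natDegree + 1), p.coeff i * (n + 1) ^ p.natDegree := by
        refine Finset.sum_le_sum fun i hi => Nat.mul_le_mul_left _ ?_
        exact (Nat.pow_le_pow_left (Nat.le_succ n) i).trans (Nat.pow_le_pow_right (Nat.succ_pos n)
          (Nat.le_of_lt_succ (Finset.mem_range.1 hi)))
    _ = (∑ i ∈ Finset.range (p.natDegree + 1), p.coeff i) * (n + 1) ^ p.natDegree := by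
        rw [Finset.sum_mul]
    _ ≤ _ := Nat.mul_le_mul (Nat.le_add_left _ _)
        (Nat.pow_le_pow_right (Nat.succ_pos n) (Nat.le_add_right _ _))

theorem exists_polynomial_clock (c : ℕ) : ∃ p : Polynomial ℕ, ∀ n, p.eval n = clock c n :=
  ⟨Polynomial.C c * (Polynomial.X + 1) ^ c, fun n => by simp [clock]⟩

/-- Codes of the Turing machines for the circuits and for the numbers of qubits, and of a common
bound for their runtimes. -/
abbrev MachineCode : Type := (DTMCode × DTMCode × DTMCode) × ℕ

/-- The output of `r` on `x` within the clock. -/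
def clocked (r : DTMCode) (c : ℕ) (x : List Bool) : Option (List Bool) :=
  r.output x (clock c x.length)

/-- The number that `r` computes from inputs of length `n`. -/
def sizeFor (r : DTMCode) (c n : ℕ) : ℕ :=
  bitValue ((clocked r c (List.replicate n false)).getD [])

/-- On input `x`, the machine outputs the binary representation of a small number that depends only
on the length of `x`. -/
def isSizeAt (r : DTMCode) (c : ℕ) (x : List Bool) : Bool :=
  (clocked r c x).isSome &&
  (decide (clocked r c x = clocked r c (List.replicate x.length false)) &&
  (isBin ((clocked r c x).getD []) && decide (sizeFor r c x.length ≤ clock c x.length)))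

def MachineCode.output (i : MachineCode) (x : List Bool) : List Bool :=
  (clocked i.1.1 i.2 x).getD []

/-- On input `x`, nothing contradicts that `i` is the code of a machine. -/
noncomputable def MachineCode.isValidAt (i : MachineCode) (x : List Bool) : Bool :=
  (clocked i.1.1 i.2 x).isSome && (isSizeAt i.1.2.1 i.2 x && (isSizeAt i.1.2.2 i.2 x &&
    (!isCircuitRuns (runs (i.output x)) ||
      (decide ((Circuit.ofString (i.output x)).witness = sizeFor i.1.2.1 i.2 x.length) &&
      decide ((Circuit.ofString (i.output x)).ancilla = sizeFor i.1.2.2 i.2 x.length)))))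

theorem computesInPolyTime_of_clocked {r : DTMCode} {c : ℕ} {f : List Bool → List Bool}
    (h : ∀ x, clocked r c x = some (f x)) : r.toDTM.ComputesInPolyTime f := by
  obtain ⟨p, hp⟩ := exists_polynomial_clock c
  refine ⟨p, fun x => ?_⟩
  rw [hp, DTMCode.outputsWithin_iff]
  exact h x

/-- All larger clocks are allowed because the three machines in a `MachineCode` share one clock. -/
theorem DTM.ComputesInPolyTime.exists_clocked {M : DTM} {f : List Bool → List Bool}
    (h : M.ComputesInPolyTime f) :
    ∃ r c, ∀ c' ≥ c, ∀ x, clocked r c' x = some (f x) := by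
  obtain ⟨r, rfl⟩ := DTMCode.toDTM_surjective M
  obtain ⟨p, hp⟩ := h
  obtain ⟨c, hc⟩ := exists_clock p
  exact ⟨r, c, fun c' hc' x => (r.outputsWithin_iff _ _ _).1
    ((hp x).mono ((hc _).trans (clock_mono hc' _)))⟩

theorem eq_some_getD {β : Type*} {o : Option β} (h : o.isSome = true) (d : β) :
    o = some (o.getD d) := by
  cases o with
  | none => simp at h
  | some b => rfl

theorem inPoly_of_isSizeAt {r : DTMCode} {c : ℕ} (h : ∀ x, isSizeAt r c x = true) :
    InPoly (sizeFor r c) := by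
  simp only [isSizeAt, Bool.and_eq_true, decide_eq_true_eq] at h
  constructor
  · obtain ⟨p, hp⟩ := exists_polynomial_clock c
    refine ⟨p, fun n => ?_⟩
    have := (h (List.replicate n false)).2.2.2
    rwa [List.length_replicate, ← hp] at this
  · refine ⟨r.toDTM, computesInPolyTime_of_clocked (c := c) fun x => ?_⟩
    obtain ⟨h1, h2, h3, -⟩ := h x
    rw [sizeFor, ← h2, bin_bitValue h3]
    exact eq_some_getD h1 []

theorem InPoly.exists_isSizeAt {f : ℕ → ℕ} (h : InPoly f) :
    ∃ r c, ∀ c' ≥ c, (∀ n, sizeFor r c' n = f n) ∧ ∀ x, isSizeAt r c' x = true := by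
  obtain ⟨⟨p, hp⟩, M, hM⟩ := h
  obtain ⟨r, c₁, h1⟩ := hM.exists_clocked
  obtain ⟨c₂, h2⟩ := exists_clock p
  have hs : ∀ c' ≥ max c₁ c₂, ∀ n, sizeFor r c' n = f n := fun c' hc' n => by
    rw [sizeFor, h1 c' ((le_max_left _ _).trans hc')]
    simp [bitValue_bin]
  refine ⟨r, max c₁ c₂, fun c' hc' => ⟨hs c' hc', fun x => ?_⟩⟩
  simp only [isSizeAt, Bool.and_eq_true, decide_eq_true_eq, hs c' hc',
    h1 c' ((le_max_left _ _).trans hc'), List.length_replicate, Option.isSome_some,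
    Option.getD_some, isBin_bin, true_and]
  exact (hp _).trans ((h2 _).trans (clock_mono ((le_max_right _ _).trans hc') _))

theorem isSizeAt_of_isValidAt {i : MachineCode} {x : List Bool} (h : i.isValidAt x = true) :
    isSizeAt i.1.2.1 i.2 x = true ∧ isSizeAt i.1.2.2 i.2 x = true := by
  simp only [MachineCode.isValidAt, Bool.and_eq_true] at h
  exact ⟨h.2.1, h.2.2.1⟩

theorem sizes_of_isValidAt {i : MachineCode} {x : List Bool} (h : i.isValidAt x = true)
    {C : Circuit} (hC : C.encode = i.output x) :
    C.witness = sizeFor i.1.2.1 i.2 x.length ∧ C.ancilla = sizeFor i.1.2.2 i.2 x.length := by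
  simp only [MachineCode.isValidAt, Bool.and_eq_true] at h
  have h1 := h.2.2.2
  have h2 : isCircuitRuns (runs (i.output x)) = true := (isCircuitRuns_iff _).2 ⟨C, hC⟩
  rw [h2, ← hC, Circuit.ofString_encode] at h1
  simpa using h1

/-- The output of the machine with code `i`. If `i` turns out not to be the code of a machine on
some string that is not enumerated after `x`, then the output is empty, which describes the trivial
circuit. -/
noncomputable def MachineCode.safeOutput (i : MachineCode) (x : List Bool) : List Bool :=
  if ∀ n, n < Encodable.encode x + 1 →
    i.isValidAt ((Encodable.decode n : Option (List Bool)).getD []) = true then i.output x else []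

theorem MachineCode.isValidAt_of_safeOutput_ne {i : MachineCode} {x : List Bool}
    (h : i.safeOutput x ≠ []) : i.isValidAt x = true ∧ i.safeOutput x = i.output x := by
  unfold safeOutput at h ⊢
  split_ifs at h ⊢ with h1
  · exact ⟨by simpa using h1 _ (Nat.lt_succ_self _), rfl⟩
  · exact absurd rfl h

theorem Circuit.encode_ne_nil (C : Circuit) : C.encode ≠ [] := by
  simp [Circuit.encode]

theorem inPoly_of_eventually_zero {f : ℕ → ℕ} {L : ℕ} (hf : ∀ n, L < n → f n = 0) : InPoly f := by
  refine ⟨⟨Polynomial.C (∑ i ∈ Finset.range (L + 1), f i), fun n => ?_⟩,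
    exists_dtm_of_eventually_const (L := L) (d := bin 0) fun x hx => by rw [hf _ hx]⟩
  rw [Polynomial.eval_C]
  by_cases h : L < n
  · rw [hf n h]; exact Nat.zero_le _
  · exact Finset.single_le_sum (f := f) (fun _ _ => Nat.zero_le _) (Finset.mem_range.2 (by omega))

/-- A code that is valid everywhere is run as it stands. If it fails at y, all strings from y on in
the enumeration get the empty output, so only finitely many outputs are nonempty and a lookup table
computes them. -/
theorem MachineCode.exists_machine (i : MachineCode) :
    ∃ M : QMAMachine, ∀ x, M.output x = i.safeOutput x := by
  by_cases h : ∀ x, i.isValidAt x = true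
  · have hs : ∀ x, i.safeOutput x = i.output x := fun x => if_pos fun n _ => h _
    exact ⟨{
      dtm := i.1.1.toDTM
      output := i.output
      computes := computesInPolyTime_of_clocked (c := i.2) fun x => by
        have h1 := h x
        simp only [MachineCode.isValidAt, Bool.and_eq_true] at h1
        exact eq_some_getD h1.1 []
      m := sizeFor i.1.2.1 i.2
      k := sizeFor i.1.2.2 i.2
      m_poly := inPoly_of_isSizeAt fun x => (isSizeAt_of_isValidAt (h x)).1
      k_poly := inPoly_of_isSizeAt fun x => (isSizeAt_of_isValidAt (h x)).2
      sizes := fun x C hC => sizes_of_isValidAt (h x) hC }, fun x => (hs x).symm⟩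
  · push Not at h
    obtain ⟨y, hy⟩ := h
    have h1 : ∀ x : List Bool, Encodable.encode y ≤ Encodable.encode x → i.safeOutput x = [] :=
      fun x hx => if_neg fun h2 => hy (by
        have := h2 _ (Nat.lt_succ_of_le hx)
        rwa [Encodable.encodek, Option.getD_some] at this)
    obtain ⟨L, hL⟩ : ∃ L, ∀ x : List Bool, L < x.length → i.safeOutput x = [] := by
      have hfin : {x : List Bool | Encodable.encode x < Encodable.encode y}.Finite :=
        (Set.finite_Iio (Encodable.encode y)).preimage Encodable.encode_injective.injOn
      obtain ⟨L, hL⟩ := (hfin.image List.length).bddAbove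
      exact ⟨L, fun x hx => h1 x (not_lt.1 fun h2 => not_le.2 hx (hL ⟨x, h2, rfl⟩))⟩
    obtain ⟨M, hM⟩ := exists_dtm_of_eventually_const hL
    -- Beyond length L no output encodes a circuit, so the sizes are unconstrained there and may be
    -- set to 0.
    have hz : ∀ r : DTMCode, InPoly fun n => if n ≤ L then sizeFor r i.2 n else 0 := fun r =>
      inPoly_of_eventually_zero (L := L) fun n hn => if_neg (not_le.2 hn)
    refine ⟨{
      dtm := M
      output := i.safeOutput
      computes := hM
      m := _
      k := _
      m_poly := hz i.1.2.1
      k_poly := hz i.1.2.2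
      sizes := fun x C hC => ?_ }, fun x => rfl⟩
    have h2 : i.safeOutput x ≠ [] := hC ▸ C.encode_ne_nil
    have hx : x.length ≤ L := not_lt.1 fun h => h2 (hL x h)
    obtain ⟨h3, h4⟩ := isValidAt_of_safeOutput_ne h2
    rw [if_pos hx, if_pos hx]
    exact sizes_of_isValidAt h3 (hC.trans h4)

/-- A code with a clock large enough for all three machines passes the test on every string, so the
safeguard never intervenes. -/
theorem QMAMachine.exists_code (M : QMAMachine) :
    ∃ i : MachineCode, ∀ x, i.safeOutput x = M.output x := by
  obtain ⟨d, c₁, h1⟩ := M.computes.exists_clocked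
  obtain ⟨dm, c₂, h2⟩ := M.m_poly.exists_isSizeAt
  obtain ⟨dk, c₃, h3⟩ := M.k_poly.exists_isSizeAt
  let c := max c₁ (max c₂ c₃)
  have hd := h1 c (le_max_left _ _)
  obtain ⟨hm, hm'⟩ := h2 c ((le_max_left _ _).trans (le_max_right _ _))
  obtain ⟨hk, hk'⟩ := h3 c ((le_max_right _ _).trans (le_max_right _ _))
  have ho : ∀ x, MachineCode.output ((d, dm, dk), c) x = M.output x := fun x => by
    simp [MachineCode.output, hd]
  suffices h : ∀ x, MachineCode.isValidAt ((d, dm, dk), c) x = true from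
    ⟨((d, dm, dk), c), fun x => (if_pos fun n _ => h _).trans (ho x)⟩
  intro x
  simp only [MachineCode.isValidAt, ho, hd, hm, hk, hm', hk', Option.isSome_some, Bool.true_and,
    Bool.or_eq_true, Bool.not_eq_true', Bool.and_eq_true, decide_eq_true_eq]
  by_cases h : ∃ C : Circuit, C.encode = M.output x
  · obtain ⟨C, hC⟩ := h
    rw [← hC, Circuit.ofString_encode]
    exact Or.inr (M.sizes x C hC)
  · exact Or.inl (by rwa [← isCircuitRuns_iff, Bool.not_eq_true] at h)

section
variable {α : Type*} [Primcodable α]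

@[fun_prop] theorem computable_bitValue {w : α → List Bool} (hw : Computable w) :
    Computable (fun a => bitValue (w a)) := by
  have : Computable (fun b : Bool => b.toNat) := (Primrec.dom_finite _).to_comp
  unfold bitValue ofDigits
  exact computable_foldr (by fun_prop) (by fun_prop) (computable_nat_add (by fun_prop)
    (this.comp (by fun_prop)))

@[fun_prop] theorem computable_isBin {w : α → List Bool} (hw : Computable w) :
    Computable (fun a => isBin (w a)) := by
  unfold isBin
  exact computable_or (computable_decide_eq hw (by fun_prop))
    (computable_decide_eq (by fun_prop) (by fun_prop))

@[fun_prop] theorem computable_clock {c n : α → ℕ} (hc : Computable c) (hn : Computable n) :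
    Computable (fun a => clock (c a) (n a)) := by
  unfold clock; fun_prop

@[fun_prop] theorem computable_clocked {r : α → DTMCode} {c : α → ℕ} {x : α → List Bool}
    (hr : Computable r) (hc : Computable c) (hx : Computable x) :
    Computable (fun a => clocked (r a) (c a) (x a)) :=
  computable_output hr hx (by fun_prop)

@[fun_prop] theorem computable_sizeFor {r : α → DTMCode} {c n : α → ℕ}
    (hr : Computable r) (hc : Computable c) (hn : Computable n) :
    Computable (fun a => sizeFor (r a) (c a) (n a)) := by
  unfold sizeFor
  exact computable_bitValue (computable_option_getD (computable_clocked hr hc (by fun_prop))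
    (by fun_prop))

@[fun_prop] theorem computable_isSizeAt {r : α → DTMCode} {c : α → ℕ} {x : α → List Bool}
    (hr : Computable r) (hc : Computable c) (hx : Computable x) :
    Computable (fun a => isSizeAt (r a) (c a) (x a)) := by
  unfold isSizeAt
  have h1 := computable_clocked hr hc hx
  have h2 := computable_clocked hr hc (x := fun a => List.replicate (x a).length false)
    (by fun_prop)
  exact computable_and (computable_isSome h1) (computable_and (computable_decide_eq h1 h2)
    (computable_and (computable_isBin (computable_option_getD h1 (by fun_prop)))
      (computable_decide_le (computable_sizeFor hr hc (by fun_prop)) (by fun_prop))))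

@[fun_prop] theorem computable_machineOutput {i : α → MachineCode} {x : α → List Bool}
    (hi : Computable i) (hx : Computable x) : Computable (fun a => (i a).output (x a)) :=
  computable_option_getD (computable_clocked (by fun_prop) (by fun_prop) hx) (by fun_prop)

@[fun_prop] theorem computable_isValidAt {i : α → MachineCode} {x : α → List Bool}
    (hi : Computable i) (hx : Computable x) : Computable (fun a => (i a).isValidAt (x a)) := by
  have h1 : Computable (fun a => (i a).1.1) := by fun_prop
  have h2 : Computable (fun a => (i a).1.2.1) := by fun_prop
  have h3 : Computable (fun a => (i a).1.2.2) := by fun_prop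
  have h4 : Computable (fun a => (i a).2) := by fun_prop
  have ho := computable_machineOutput hi hx
  unfold MachineCode.isValidAt
  exact computable_and (computable_isSome (computable_clocked h1 h4 hx)) (computable_and
    (computable_isSizeAt h2 h4 hx) (computable_and (computable_isSizeAt h3 h4 hx) (computable_or
      (computable_not (computable_isCircuitRuns (computable_runs ho))) (computable_and
        (computable_decide_eq (computable_witness ho) (computable_sizeFor h2 h4 (by fun_prop)))
        (computable_decide_eq (computable_ancilla ho) (computable_sizeFor h3 h4 (by fun_prop)))))))

theorem computable_safeOutput :
    Computable (fun p : MachineCode × List Bool => p.1.safeOutput p.2) := by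
  have h1 : Computable (fun q : (MachineCode × List Bool) × ℕ => q.1.1.isValidAt
      ((Encodable.decode q.2 : Option (List Bool)).getD [])) :=
    computable_isValidAt (by fun_prop) (computable_option_getD
      (Computable.decode.comp Computable.snd) (computable_const _))
  exact computable_ite (computable_decide_forall_lt (computable_nat_add
    (Computable.encode.comp Computable.snd) (computable_const 1))
      (computable_decide_eq h1 (computable_const true)))
    (computable_machineOutput Computable.fst Computable.snd) (computable_const [])

end

/-! ## The presentation -/

/-- The extremal problem of a machine. -/
def QMAMachine.extremal {E : ∀ m, QuantumChannel m} (hE : HasComputableStinespringDilation E)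
    (M : QMAMachine) : PromiseProblem where
  yes := {x | AcceptsNoisy E (M.circuit x)}
  no := {x | RejectsAll (M.circuit x)}
  disjoint := Set.disjoint_left.2 fun _ h h' => not_acceptsNoisy_of_rejectsAll hE h' h

section
variable {E : ∀ m, QuantumChannel m}

/-- To decide a problem is a condition on each string separately, so collecting all strings that
satisfy the conditions gives the largest decided problem. -/
theorem QMAMachine.isExtremalProblem_extremal (hE : HasComputableStinespringDilation E)
    (M : QMAMachine) :
    M.IsExtremalProblem E (M.extremal hE) :=
  ⟨⟨fun _ h => h, fun _ h => h⟩, fun _ hB => ⟨fun x hx => hB.1 x hx, fun x hx => hB.2 x hx⟩⟩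

theorem PromiseProblem.ext' {A B : PromiseProblem} (h1 : A.yes = B.yes) (h2 : A.no = B.no) :
    A = B := by
  cases A; cases B; simp_all

theorem QMAMachine.IsExtremalProblem.eq_extremal (hE : HasComputableStinespringDilation E)
    {M : QMAMachine} {A : PromiseProblem}
    (h : M.IsExtremalProblem E A) : A = M.extremal hE := by
  have h1 := (M.isExtremalProblem_extremal hE).2 A h.1
  have h2 := h.2 _ (M.isExtremalProblem_extremal hE).1
  exact PromiseProblem.ext' (h1.1.antisymm h2.1) (h1.2.antisymm h2.2)

/-- A machine that decides a problem decides all its subproblems, and every problem that it decides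
is a subproblem of the extremal one. -/
theorem qma_eq_restrictionClosure (hE : HasComputableStinespringDilation E) :
    QMA E = restrictionClosure (QMAStar E) := by
  ext A
  constructor
  · rintro ⟨M, hM⟩
    exact ⟨M.extremal hE, ⟨M, M.isExtremalProblem_extremal hE⟩,
      (M.isExtremalProblem_extremal hE).2 A hM⟩
  · rintro ⟨B, ⟨M, hM⟩, hAB⟩
    exact ⟨M, fun x hx => hM.1.1 x (hAB.1 hx), fun x hx => hM.1.2 x (hAB.2 hx)⟩

open Classical in
/-- The verdict on the string `w`, considered as a circuit. -/
noncomputable def verdict (E : ∀ m, QuantumChannel m) (w : List Bool) : List Bool :=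
  if AcceptsNoisy E (Circuit.ofString w) then [true]
  else if RejectsAll (Circuit.ofString w) then [false]
  else [true, false]

open Classical in
theorem computable_verdict (hE : HasComputableStinespringDilation E) : Computable (verdict E) := by
  obtain ⟨h1, h2⟩ := computable_verdicts hE
  exact computable_ite h1 (computable_const _)
    (computable_ite h2 (computable_const _) (computable_const _))

/-- Programs for a computable family of functions. -/
theorem exists_programs {f : MachineCode × List Bool → List Bool} (hf : Computable f) :
    ∃ c : ℕ → Nat.Partrec.Code, Computable c ∧ ∀ i x w, ProgramOutputs (c i) x w ↔
      w = f ((Encodable.decode i).getD default, x) := by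
  let g : ℕ → ℕ := fun n => Encodable.encode (f ((Encodable.decode n.unpair.1).getD default,
    (Encodable.decode n.unpair.2).getD []))
  have hu : Computable (fun n : ℕ => n.unpair) := Primrec.unpair.to_comp
  have hg : Computable g := by
    refine Computable.encode.comp (hf.comp (Computable.pair ?_ ?_))
    · exact computable_option_getD (Computable.decode.comp (Computable.fst.comp hu))
        (computable_const _)
    · exact computable_option_getD (Computable.decode.comp (Computable.snd.comp hu))
        (computable_const _)
  obtain ⟨e, he⟩ := Nat.Partrec.Code.exists_code.1 (Partrec.nat_iff.1 hg)
  -- One program e takes the index and the input as a pair; fixing the index computably (s-m-n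
  -- theorem) gives the sequence.
  refine ⟨fun i => Nat.Partrec.Code.curry e i,
    (Nat.Partrec.Code.primrec₂_curry.comp (Primrec.const e) Primrec.id).to_comp, fun i x w => ?_⟩
  rw [ProgramOutputs, Nat.Partrec.Code.eval_curry, he]
  simp only [PFun.coe_val, Part.mem_some_iff, g, Nat.unpair_pair, Encodable.encodek,
    Option.getD_some]
  exact Encodable.encode_injective.eq_iff

theorem ProgramOutputs.unique {c : Nat.Partrec.Code} {x w w' : List Bool}
    (h : ProgramOutputs c x w) (h' : ProgramOutputs c x w') : w = w' :=
  Encodable.encode_injective (Part.mem_unique h h')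

/-- The three outputs are distinct, so the program determines the status of every string. Hence a
presented program decides nothing but the extremal problem of its machine. -/
theorem TotallyDecides.unique {c : Nat.Partrec.Code} {A B : PromiseProblem}
    (hA : TotallyDecides c A) (hB : TotallyDecides c B) : A = B := by
  have key : ∀ {A B : PromiseProblem}, TotallyDecides c A → TotallyDecides c B →
      A.yes ⊆ B.yes ∧ A.no ⊆ B.no := by
    intro A B hA hB
    constructor <;> intro x hx <;> by_contra h
    · by_cases hn : x ∈ B.no
      · simpa using (hA.1 x hx).unique (hB.2.1 x hn)
      · simpa using (hA.1 x hx).unique (hB.2.2 x (by simp [h, hn]))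
    · by_cases hy : x ∈ B.yes
      · simpa using (hA.2.1 x hx).unique (hB.1 x hy)
      · simpa using (hA.2.1 x hx).unique (hB.2.2 x (by simp [h, hy]))
  exact PromiseProblem.ext' ((key hA hB).1.antisymm (key hB hA).1)
    ((key hA hB).2.antisymm (key hB hA).2)

theorem QMAMachine.totallyDecides_extremal (hE : HasComputableStinespringDilation E)
    (M : QMAMachine) {c : Nat.Partrec.Code}
    (hc : ∀ x, ProgramOutputs c x (verdict E (M.output x))) :
    TotallyDecides c (M.extremal hE) := by
  refine ⟨fun x hx => ?_, fun x hx => ?_, fun x hx => ?_⟩ <;> convert hc x using 1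
  · exact (if_pos hx).symm
  · exact ((if_neg (not_acceptsNoisy_of_rejectsAll hE hx)).trans (if_pos hx)).symm
  · exact ((if_neg fun h => hx (Or.inl h)).trans (if_neg fun h => hx (Or.inr h))).symm

theorem recursivelyPresentable_qmaStar (hE : HasComputableStinespringDilation E) :
    RecursivelyPresentable (QMAStar E) := by
  obtain ⟨c, hc, hcw⟩ := exists_programs ((computable_verdict hE).comp computable_safeOutput)
  refine ⟨c, hc, fun i x => ⟨_, (hcw i x _).2 rfl⟩, fun A => ⟨?_, ?_⟩⟩
  · rintro ⟨M, hM⟩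
    obtain rfl := QMAMachine.IsExtremalProblem.eq_extremal hE hM
    obtain ⟨i, hi⟩ := M.exists_code
    refine ⟨Encodable.encode i, M.totallyDecides_extremal hE fun x => (hcw _ x _).2 ?_⟩
    rw [Encodable.encodek, Option.getD_some, hi]
  -- Every index, also one that decodes only to the default code, belongs to a genuine machine.
  · rintro ⟨i, hi⟩
    obtain ⟨M, hM⟩ := MachineCode.exists_machine ((Encodable.decode i).getD default)
    have := hi.unique (M.totallyDecides_extremal hE fun x => (hcw _ x _).2 (by rw [hM]))
    exact ⟨M, this ▸ M.isExtremalProblem_extremal hE⟩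

end

end NoisyQMA

theorem mainTheorem11 (E : ∀ m : ℕ, NoisyQMA.QuantumChannel m)
    (hE : NoisyQMA.HasComputableStinespringDilation E) :
    (∀ M : NoisyQMA.QMAMachine, ∃ A : NoisyQMA.PromiseProblem,
      M.IsExtremalProblem E A ∧ NoisyQMA.TotallyDecidable A) ∧
    NoisyQMA.RecursivelyPresentable (NoisyQMA.QMAStar E) ∧
    NoisyQMA.RecursivelyRepresentable (NoisyQMA.QMA E) := by
  have hP := NoisyQMA.recursivelyPresentable_qmaStar hE
  refine ⟨fun M => ?_, hP, NoisyQMA.QMAStar E, hP, NoisyQMA.qma_eq_restrictionClosure hE⟩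
  have hM := M.isExtremalProblem_extremal hE
  obtain ⟨c, -, -, hc⟩ := hP
  obtain ⟨i, hi⟩ := (hc _).1 ⟨M, hM⟩
  exact ⟨M.extremal hE, hM, c i, hi⟩
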